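/- Update packets arrive at a source without storage according to a Poisson process of rate $\lambda>0$. Each packet is generated at its arrival. The transfer times $T_0,T_1,\dots$ of the packets to the destination are i.i.d. copies of a random variable $T\ge 0$ with $E[T^2]<\infty$, independent of the arrivals. The age of information at time $t$ is $G(t)=t-r_t$, where $r_t$ is the generation time of the last packet received at the destination by time $t$; at time $0$ the source is idle and the age is some $g_0\ge 0$. At the $k$-th delivery epoch $R_k$ (with $R_0=0$) the source is idle, and it starts to transfer the next packet that arrives. For a threshold $\theta\in[0,\infty]$, if $G(R_k)<\theta$ then until the next delivery old packets are dropped (DOP): each new arrival replaces the packet in transfer, whose transfer is aborted. Otherwise new packets are dropped (DNP): packets that arrive during a transfer are lost. Let $\bar a(\theta)=\lim_{t\to\infty}\frac1t\int_0^tG(s)\,ds$ be the almost sure average age of information under this policy, and let $\bar a_{DNP}$ be the average age when DNP is always used. Let $\xi,\xi_1,\xi_2,\dots$ be i.i.d. exponential random variables of rate $\lambda$, independent of $T,T_0,T_1,\dots$; let $N=\inf\{i\ge1:\xi_i>T_{i-1}\}$, $\Gamma=\sum_{i=1}^{N-1}\xi_i+T_{N-1}$, and let $d_n=E[T+\xi]$,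 $d_o=E[\xi+\Gamma]$ be the mean lengths of a DNP cycle and of a DOP cycle. Put $\rho=\lambda E[T]$. Suppose that $d_n<d_o$ and $$\rho\,\frac{E[T^2]}{2E[T]}-(1+\rho)(d_o-d_n)\bigl(1-\lambda E[Te^{-\lambda T}]\bigr)\le 0 .$$ Then $\bar a(\theta)$ exists as an almost sure, deterministic limit, not depending on $g_0$, for every $\theta\in[0,\infty]$, and always dropping the new packets is optimal: $$\min_{\theta\ge0}\bar a(\theta)=\bar a(0)=\bar a_{DNP}=E[T]+\frac1\lambda+\frac{E[T^2]}{2E[T]}\,\frac{\rho}{1+\rho}.$$ -/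

import Mathlib

open MeasureTheory ProbabilityTheory Filter Topology

namespace AgeOfInformation

/-! ### Sample paths

One source, no storage. `ξ n` is the `n`-th inter-arrival time and `T n` is the time needed to
transfer packet `n` (`n = 0, 1, 2, …`). -/

/-- Arrival (= generation) time of packet `n`. -/
def arrivalTime (ξ : ℕ → ℝ) (n : ℕ) : ℝ := ∑ i ∈ Finset.range (n + 1), ξ i

/-- The first packet that arrives (strictly) after time `t`. -/
noncomputable def firstArrivalAfter (ξ : ℕ → ℝ) (t : ℝ) : ℕ := sInf {n | t < arrivalTime ξ n}

/-- When every new arrival interrupts the ongoing transfer and the transfer of packet `n` has just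
been started: the number of interruptions before the first transfer that is completed before the
next arrival. Packet `n + interruptions ξ T n` is the one that gets delivered. -/
noncomputable def interruptions (ξ T : ℕ → ℝ) (n : ℕ) : ℕ := sInf {i | T (n + i) < ξ (n + i + 1)}

/-- The time `Γ` to complete one transfer in the midst of interruptions by new arrivals, when the
transfer of packet `0` has just been started: `ξ 1 + ⋯ + ξ (N - 1) + T (N - 1)` with
`N = inf {i ≥ 1 | ξ i > T (i - 1)}`; here `N - 1 = interruptions ξ T 0`. -/
noncomputable def interruptedTransferTime (ξ T : ℕ → ℝ) : ℝ :=
  (∑ i ∈ Finset.range (interruptions ξ T 0), ξ (i + 1)) + T (interruptions ξ T 0)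

open scoped Classical in
/-- The packet delivered in the cycle that starts, with an idle source, at the delivery epoch `R`
with age `g`. The set `D` of ages is the policy: if `g ∈ D`, old packets are dropped (DOP) during
the whole cycle, otherwise new packets are dropped (DNP). In both cases the source waits for the
first packet that arrives after `R`. -/
noncomputable def deliveredPacket (D : Set ℝ) (ξ T : ℕ → ℝ) (R g : ℝ) : ℕ :=
  if g ∈ D then firstArrivalAfter ξ R + interruptions ξ T (firstArrivalAfter ξ R)
  else firstArrivalAfter ξ R

/-- The `k`-th decision epoch, as a pair: the time `R` of the `k`-th delivery, and the generation
time of the packet then delivered. The age at the epoch is the difference of the two. At time `0`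
the source is idle and the age is `g₀`. -/
noncomputable def epoch (D : Set ℝ) (ξ T : ℕ → ℝ) (g₀ : ℝ) : ℕ → ℝ × ℝ
  | 0 => (0, -g₀)
  | k + 1 =>
    let e := epoch D ξ T g₀ k
    let j := deliveredPacket D ξ T e.1 (e.1 - e.2)
    (arrivalTime ξ j + T j, arrivalTime ξ j)

/-- Index of the last delivery up to time `t` (`0` if there was none). -/
noncomputable def lastDelivery (D : Set ℝ) (ξ T : ℕ → ℝ) (g₀ t : ℝ) : ℕ :=
  sSup {k | (epoch D ξ T g₀ k).1 ≤ t}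

/-- The age of information at time `t`: `t` minus the generation time of the last packet
received by time `t`. -/
noncomputable def age (D : Set ℝ) (ξ T : ℕ → ℝ) (g₀ t : ℝ) : ℝ :=
  t - (epoch D ξ T g₀ (lastDelivery D ξ T g₀ t)).2

/-- The threshold policy `θ ∈ [0, ∞]`: old packets are dropped iff the age is smaller than `θ`. -/
def threshold (θ : EReal) : Set ℝ := {g | (g : EReal) < θ}

/-- The policy that always drops the new packets. -/
def alwaysDropNew : Set ℝ := ∅

/-! ### Averages -/

/-- Under the policy `D`, whatever the initial age, the time-average age of information
`lim_{t → ∞} (1/t) ∫₀ᵗ G(s) ds` almost surely exists and equals `a`. -/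
def HasAverageAge {Ω : Type*} [MeasurableSpace Ω] (P : Measure Ω) (ξ T : ℕ → Ω → ℝ) (D : Set ℝ)
    (a : ℝ) : Prop :=
  ∀ g₀ : ℝ, 0 ≤ g₀ → ∀ᵐ ω ∂P,
    (∀ t : ℝ, IntervalIntegrable (age D (ξ · ω) (T · ω) g₀) volume 0 t) ∧
    Tendsto (fun t : ℝ => (∫ s in (0 : ℝ)..t, age D (ξ · ω) (T · ω) g₀ s) / t) atTop (𝓝 a)

/-- Expected length of a DNP cycle, `d_n = E[T + ξ]`. -/
noncomputable def meanCycleDNP {Ω : Type*} [MeasurableSpace Ω] (P : Measure Ω)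
    (ξ T : ℕ → Ω → ℝ) : ℝ := ∫ ω, (T 0 ω + ξ 0 ω) ∂P

/-- Expected length of a DOP cycle, `d_o = E[ξ + Γ]`. -/
noncomputable def meanCycleDOP {Ω : Type*} [MeasurableSpace Ω] (P : Measure Ω)
    (ξ T : ℕ → Ω → ℝ) : ℝ := ∫ ω, (ξ 0 ω + interruptedTransferTime (ξ · ω) (T · ω)) ∂P

end AgeOfInformation

/-!
A cycle is the time between two deliveries. At its end the source is idle and, since the exponential
law has no memory, the input seen from there is a fresh copy of the original input, independent of
all earlier cycles (`law_state_snd`, by a strong Markov property for the inputs). Hence the ages at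
the epochs matter only through the action they select, and the actions form a two-state Markov
chain, whose stationary probability `π` of DOP is `dopFrequency`.

The area under the age over a cycle of length `L` with initial age `g` is `g L + L ^ 2 / 2`. Here
`L` is independent of `g` given the action, so strong laws along the cycles give the average age as
a ratio of stationary means (`ae_tendsto_average_age`). For the product `g L` the centred length,
multiplied by the predictable factor `g`, is a square-integrable martingale difference
(`ae_tendsto_average_predictable_mul`). Where only first moments are at hand, as for `L ^ 2`, the
increments are truncated first (`ae_tendsto_average_thinned`).

The moments of a DOP cycle follow from a recursion at the first interruption: with
`p = E[exp (-λ T)]` and `e₁ = E[T exp (-λ T)]` one gets `d_o = 1 / (λ p)`, final age `e₁ / p` on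
average, and second moment `2 d_o ^ 2 (1 - λ e₁)`.

For the optimality let `a` be the average age when new packets are always dropped. As `d_n < d_o`,
the average age of any policy is at least the ratio that one gets if every cycle is followed by one
of mean length `d_n`. The numerator of this ratio minus `a` times its denominator vanishes for a DNP
cycle, and for a DOP cycle it is `d_o (d_o - λ e₁ (d_o - d_n) - a)`. Since
`a = d_n + λ E[T ^ 2] / (2 (1 + ρ))`, the assumption of the theorem says exactly that this is
nonnegative (`averageAgeDropNew_le_averageAge`).
-/

namespace AgeOfInformation

/-! ### Strong laws with predictable weights -/

/-- Kronecker's lemma for the weights `k + 1`. -/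
theorem tendsto_average_zero_of_tendsto_sum_div {a : ℕ → ℝ} {l : ℝ}
    (h : Tendsto (fun n => ∑ k ∈ Finset.range n, a k / ((k : ℝ) + 1)) atTop (𝓝 l)) :
    Tendsto (fun n : ℕ => (∑ k ∈ Finset.range n, a k) / n) atTop (𝓝 0) := by
  set s : ℕ → ℝ := fun n => ∑ k ∈ Finset.range n, a k / ((k : ℝ) + 1) with hs
  have hsum : ∀ n : ℕ, ∑ k ∈ Finset.range n, a k = n * s n - ∑ k ∈ Finset.range n, s k := by
    intro n
    induction n with
    | zero => simp
    | succ n ih =>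
      have : ((n : ℝ) + 1) * (a n / ((n : ℝ) + 1)) = a n := by field_simp
      rw [Finset.sum_range_succ, Finset.sum_range_succ, ih, hs]
      simp only [Finset.sum_range_succ]
      push_cast
      linear_combination -this
  have hces := h.cesaro
  have := h.sub hces
  rw [sub_self] at this
  refine this.congr' ?_
  filter_upwards [eventually_gt_atTop 0] with n hn
  have hn' : (n : ℝ) ≠ 0 := by positivity
  rw [hsum n]
  field_simp

/-- A strong law for martingale differences `V k * Z k` with predictable `V k` and with a centred
`Z k` that is independent of the past. -/
theorem ae_tendsto_average_predictable_mul {Ω : Type*} {m : MeasurableSpace Ω} {μ : Measure Ω}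
    [IsProbabilityMeasure μ] (ℱ : Filtration ℕ m) {V Z : ℕ → Ω → ℝ}
    (hV : ∀ k, StronglyMeasurable[ℱ k] (V k)) (hV2 : ∀ k, MemLp (V k) 2 μ)
    (hZm : ∀ k, Measurable (Z k))
    (hZ2 : ∀ k, MemLp (Z k) 2 μ) (hZ0 : ∀ k, ∫ ω, Z k ω ∂μ = 0)
    (hind : ∀ k, Indep (ℱ k) (MeasurableSpace.comap (Z k) inferInstance) μ)
    (hVZ : ∀ k, StronglyMeasurable[ℱ (k + 1)] (fun ω => V k ω * Z k ω)) {C : ℝ}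
    (hC : ∀ n, ∑ k ∈ Finset.range n,
      (∫ ω, V k ω ^ 2 ∂μ) * (∫ ω, Z k ω ^ 2 ∂μ) / ((k : ℝ) + 1) ^ 2 ≤ C) :
    ∀ᵐ ω ∂μ, Tendsto (fun n : ℕ => (∑ k ∈ Finset.range n, V k ω * Z k ω) / n) atTop (𝓝 0) := by
  -- a function measurable at time `k` is independent of `Z k`
  have hindF : ∀ k (f : Ω → ℝ), Measurable[ℱ k] f → IndepFun f (Z k) μ := by
    intro k f hf
    rw [IndepFun_iff_Indep]
    exact indep_of_indep_of_le_left (hind k) hf.comap_le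
  have hVZ2 : ∀ k, MemLp (fun ω => V k ω * Z k ω) 2 μ := by
    intro k
    refine (memLp_two_iff_integrable_sq ((hV2 k).1.mul (hZ2 k).1)).2 ?_
    have h1 : IndepFun (fun ω => V k ω ^ 2) (fun ω => Z k ω ^ 2) μ :=
      (hindF k _ (hV k).measurable).comp (φ := fun x => x ^ 2) (ψ := fun x => x ^ 2)
        (by fun_prop) (by fun_prop)
    have := h1.integrable_mul (hV2 k).integrable_sq (hZ2 k).integrable_sq
    refine this.congr (Eventually.of_forall fun ω => ?_)
    simp only [Pi.mul_apply]
    ring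
  -- the weighted sums form a martingale that is bounded in `L²`, so that it converges
  set M : ℕ → Ω → ℝ := fun n ω => ∑ k ∈ Finset.range n, V k ω * Z k ω / ((k : ℝ) + 1) with hM
  have hMsucc : ∀ n ω, M (n + 1) ω = M n ω + V n ω * Z n ω / ((n : ℝ) + 1) := by
    intro n ω
    simp only [hM, Finset.sum_range_succ]
  have hMad : ∀ n, StronglyMeasurable[ℱ n] (M n) := by
    intro n
    refine Finset.stronglyMeasurable_fun_sum _ fun k hk => ?_
    exact (((hVZ k).mono
      (ℱ.mono (Finset.mem_range.1 hk))).measurable.div_const _).stronglyMeasurable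
  have hM2 : ∀ n, MemLp (M n) 2 μ := by
    intro n
    refine memLp_finsetSum _ fun k _ => ?_
    simpa only [div_eq_inv_mul] using (hVZ2 k).const_mul ((k : ℝ) + 1)⁻¹
  have hmart : Martingale M ℱ μ := by
    refine martingale_nat hMad (fun n => (hM2 n).integrable (by norm_num)) fun n => ?_
    have hsm : StronglyMeasurable[ℱ n] (fun ω => V n ω / ((n : ℝ) + 1)) :=
      ((hV n).measurable.div_const _).stronglyMeasurable
    have hi : Integrable ((fun ω => V n ω / ((n : ℝ) + 1)) * Z n) μ := by
      refine (((hVZ2 n).integrable (by norm_num)).div_const ((n : ℝ) + 1)).congr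
        (Eventually.of_forall fun ω => ?_)
      simp only [Pi.mul_apply]
      ring
    have hZi : Integrable (Z n) μ := (hZ2 n).integrable (by norm_num)
    have h1 := condExp_mul_of_stronglyMeasurable_left (m := ℱ n) hsm hi hZi
    have h2 : μ[Z n | ℱ n] =ᵐ[μ] fun _ => μ[Z n] :=
      condExp_indep_eq (hZm n).comap_le (ℱ.le n) (comap_measurable (Z n)).stronglyMeasurable
        (hind n).symm
    have h3 : M (n + 1) = M n + (fun ω => V n ω / ((n : ℝ) + 1)) * Z n := by
      ext ω
      simp only [Pi.add_apply, Pi.mul_apply, hMsucc]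
      ring
    have h4 := condExp_add (μ := μ) ((hM2 n).integrable (by norm_num)) hi (ℱ n)
    have h5 : μ[M n | ℱ n] = M n :=
      condExp_of_stronglyMeasurable (ℱ.le n) (hMad n) ((hM2 n).integrable (by norm_num))
    rw [h3]
    filter_upwards [h1, h2, h4] with ω w1 w2 w4
    rw [w4, Pi.add_apply, h5, w1, Pi.mul_apply, w2, hZ0 n]
    simp
  have hMsq : ∀ n, ∫ ω, M n ω ^ 2 ∂μ ≤ ∑ k ∈ Finset.range n,
      (∫ ω, V k ω ^ 2 ∂μ) * (∫ ω, Z k ω ^ 2 ∂μ) / ((k : ℝ) + 1) ^ 2 := by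
    intro n
    induction n with
    | zero => simp [hM]
    | succ n ih =>
      have e1 : IndepFun (fun ω => M n ω * V n ω) (Z n) μ :=
        hindF n _ ((hMad n).measurable.mul (hV n).measurable)
      have e2 : ∫ ω, (M n ω * V n ω) * Z n ω ∂μ = 0 := by
        rw [e1.integral_fun_mul_eq_mul_integral ((hM2 n).1.mul (hV2 n).1) (hZ2 n).1, hZ0 n,
          mul_zero]
      have e3 : IndepFun (fun ω => V n ω ^ 2) (fun ω => Z n ω ^ 2) μ :=
        (hindF n _ (hV n).measurable).comp (φ := fun x => x ^ 2) (ψ := fun x => x ^ 2)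
          (by fun_prop) (by fun_prop)
      have e4 : ∫ ω, V n ω ^ 2 * Z n ω ^ 2 ∂μ = (∫ ω, V n ω ^ 2 ∂μ) * ∫ ω, Z n ω ^ 2 ∂μ :=
        e3.integral_fun_mul_eq_mul_integral (hV2 n).integrable_sq.1 (hZ2 n).integrable_sq.1
      have i1 := (hM2 n).integrable_sq
      have i2 : Integrable (fun ω => (M n ω * V n ω) * Z n ω) μ := by
        refine ((hM2 n).integrable_mul (hVZ2 n)).congr (Eventually.of_forall fun ω => ?_)
        simp only [Pi.mul_apply]
        ring
      have i3 : Integrable (fun ω => V n ω ^ 2 * Z n ω ^ 2) μ := by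
        refine (hVZ2 n).integrable_sq.congr (Eventually.of_forall fun ω => ?_)
        simp only
        ring
      have e5 : ∀ ω, M (n + 1) ω ^ 2 = M n ω ^ 2 + 2 / ((n : ℝ) + 1) * ((M n ω * V n ω) * Z n ω)
          + (V n ω ^ 2 * Z n ω ^ 2) / ((n : ℝ) + 1) ^ 2 := by
        intro ω
        rw [hMsucc]
        field_simp
        ring
      simp_rw [e5]
      have i4 : Integrable (fun ω => M n ω ^ 2 + 2 / ((n : ℝ) + 1) * ((M n ω * V n ω) * Z n ω)) μ :=
        i1.add (i2.const_mul _)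
      rw [integral_add i4 (i3.div_const _), integral_add i1 (i2.const_mul _), integral_const_mul,
        e2, integral_div, e4, Finset.sum_range_succ]
      linarith
  have hbdd : ∀ n, eLpNorm (M n) 1 μ ≤ (Real.toNNReal (1 + C) : ENNReal) := by
    intro n
    have hi := (hM2 n).integrable (q := 2) (by norm_num)
    rw [eLpNorm_one_eq_lintegral_enorm, ← ofReal_integral_norm_eq_lintegral_enorm hi]
    refine ENNReal.ofReal_le_ofReal ?_
    calc ∫ ω, ‖M n ω‖ ∂μ ≤ ∫ ω, (1 + M n ω ^ 2) ∂μ := by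
          refine integral_mono hi.norm ((integrable_const _).add (hM2 n).integrable_sq) fun ω => ?_
          simp only [Real.norm_eq_abs]
          nlinarith [abs_nonneg (M n ω), sq_abs (M n ω), sq_nonneg (|M n ω| - 1)]
      _ = 1 + ∫ ω, M n ω ^ 2 ∂μ := by
          rw [integral_add (integrable_const _) (hM2 n).integrable_sq]
          simp
      _ ≤ 1 + C := by linarith [hMsq n, hC n]
  filter_upwards [hmart.submartingale.ae_tendsto_limitProcess hbdd] with ω hω
  exact tendsto_average_zero_of_tendsto_sum_div hω

/-- The strong law for a thinned sequence: the `Z k` have a common integrable law, `Z k` is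
independent of the past, and whether it is counted is decided by the past event `E k`. -/
theorem ae_tendsto_average_thinned {Ω : Type*} {m : MeasurableSpace Ω} {μ : Measure Ω}
    [IsProbabilityMeasure μ] (ℱ : Filtration ℕ m) {E : ℕ → Set Ω} {Z : ℕ → Ω → ℝ}
    (hE : ∀ k, MeasurableSet[ℱ k] (E k)) (hZm : ∀ k, Measurable (Z k))
    (hZ0 : ∀ k ω, 0 ≤ Z k ω) (hident : ∀ k, IdentDistrib (Z k) (Z 0) μ μ)
    (hint : Integrable (Z 0) μ)
    (hind : ∀ k, Indep (ℱ k) (MeasurableSpace.comap (Z k) inferInstance) μ)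
    (hEZ : ∀ k, Measurable[ℱ (k + 1)] ((E k).indicator (Z k))) :
    ∀ᵐ ω ∂μ, Tendsto (fun n : ℕ => (∑ k ∈ Finset.range n,
      (E k).indicator 1 ω * (Z k ω - ∫ x, Z 0 x ∂μ)) / n) atTop (𝓝 0) := by
  let _ : MeasureSpace Ω := ⟨μ⟩
  -- truncation as in Etemadi's proof, since `Z` need not be square-integrable
  set Y : ℕ → Ω → ℝ := fun k => truncation (Z k) k with hY
  set c : ℕ → ℝ := fun k => ∫ ω, Y k ω ∂μ with hc
  have hYm : ∀ k, Measurable (Y k) := fun k =>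
    (measurable_id.indicator measurableSet_Ioc).comp (hZm k)
  have hY2 : ∀ k, MemLp (Y k) 2 μ := fun k => (hZm k).aestronglyMeasurable.memLp_truncation
  have hYi : ∀ k, Integrable (Y k) μ := fun k => (hY2 k).integrable (by norm_num)
  have hEℱ : ∀ k, Measurable[ℱ k] ((E k).indicator (1 : Ω → ℝ)) := fun k =>
    Measurable.indicator measurable_const (hE k)
  have hIm : ∀ k, Measurable ((E k).indicator (1 : Ω → ℝ)) := fun k =>
    (hEℱ k).mono (ℱ.le k) le_rfl
  have hI2 : ∀ k, MemLp ((E k).indicator (1 : Ω → ℝ)) 2 μ := fun k =>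
    MemLp.of_bound (hIm k).aestronglyMeasurable 1 (Eventually.of_forall fun ω => by
      by_cases h : ω ∈ E k <;> simp [h])
  have hcY : ∀ k, Measurable[MeasurableSpace.comap (Z k) inferInstance] (Y k) := fun k =>
    (measurable_id.indicator measurableSet_Ioc).comp (comap_measurable (Z k))
  have hI1 : ∀ k, ∫ ω, (E k).indicator (1 : Ω → ℝ) ω ^ 2 ∂μ ≤ 1 := by
    intro k
    calc ∫ ω, (E k).indicator (1 : Ω → ℝ) ω ^ 2 ∂μ ≤ ∫ ω, (1 : ℝ) ∂μ := by
          refine integral_mono (hI2 k).integrable_sq (integrable_const _) fun ω => ?_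
          by_cases h : ω ∈ E k <;> simp [h]
      _ = 1 := by simp
  have hZsq : ∀ k, ∫ ω, (Y k ω - c k) ^ 2 ∂μ ≤ ∫ ω, Y k ω ^ 2 ∂μ := by
    intro k
    have e : ∀ ω, (Y k ω - c k) ^ 2 = Y k ω ^ 2 - 2 * c k * Y k ω + c k ^ 2 := fun ω => by ring
    simp_rw [e]
    have i1 : Integrable (fun ω => Y k ω ^ 2 - 2 * c k * Y k ω) μ :=
      (hY2 k).integrable_sq.sub ((hYi k).const_mul _)
    rw [integral_add i1 (integrable_const _),
      integral_sub (hY2 k).integrable_sq ((hYi k).const_mul _), integral_const_mul]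
    simp only [integral_const, probReal_univ, one_smul]
    have : ∫ ω, Y k ω ∂μ = c k := rfl
    rw [this]
    nlinarith [sq_nonneg (c k)]
  have hYident : ∀ k, ∫ ω, Y k ω ^ 2 ∂μ = ∫ ω, truncation (Z 0) k ω ^ 2 ∂μ := fun k =>
    (((hident k).truncation (A := (k : ℝ))).comp (u := fun x : ℝ => x ^ 2)
      (by fun_prop)).integral_eq
  have h1 : ∀ᵐ ω ∂μ, Tendsto (fun n : ℕ => (∑ k ∈ Finset.range n,
      (E k).indicator 1 ω * (Y k ω - c k)) / n) atTop (𝓝 0) := by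
    refine ae_tendsto_average_predictable_mul ℱ (V := fun k => (E k).indicator 1)
      (Z := fun k ω => Y k ω - c k) (C := 2 * ∫ x, Z 0 x ∂μ)
      (fun k => (hEℱ k).stronglyMeasurable) hI2 (fun k => (hYm k).sub_const _)
      (fun k => (hY2 k).sub (memLp_const _)) (fun k => ?_) (fun k => ?_) (fun k => ?_)
      (fun n => ?_)
    · rw [integral_sub (hYi k) (integrable_const _)]
      simp [hc]
    · refine indep_of_indep_of_le_right (hind k) (Measurable.comap_le ?_)
      exact (hcY k).sub_const _
    · have e : (fun ω => (E k).indicator (1 : Ω → ℝ) ω * (Y k ω - c k)) = fun ω =>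
          (Set.Ioc (-(k : ℝ)) k).indicator id ((E k).indicator (Z k) ω) -
            (E k).indicator (1 : Ω → ℝ) ω * c k := by
        ext ω
        by_cases h : ω ∈ E k
        · simp [h, hY, truncation]
        · simp [h, Set.indicator_apply]
      rw [e]
      refine Measurable.stronglyMeasurable (Measurable.sub ?_ ?_)
      · exact (measurable_id.indicator measurableSet_Ioc).comp (hEZ k)
      · exact ((hEℱ k).mono (ℱ.mono k.le_succ) le_rfl).mul_const _
    · refine le_trans (Finset.sum_le_sum fun k _ => ?_)
        (sum_variance_truncation_le hint (fun ω => hZ0 0 ω) n)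
      have hint2 : ∫ ω, (truncation (Z 0) k ^ 2) ω = ∫ ω, Y k ω ^ 2 ∂μ := (hYident k).symm
      rw [hint2]
      have hnn : 0 ≤ ∫ ω, Y k ω ^ 2 ∂μ := integral_nonneg fun ω => sq_nonneg _
      have hle : (∫ ω, (E k).indicator (1 : Ω → ℝ) ω ^ 2 ∂μ) * (∫ ω, (Y k ω - c k) ^ 2 ∂μ) ≤
          ∫ ω, Y k ω ^ 2 ∂μ := by
        calc _ ≤ 1 * ∫ ω, Y k ω ^ 2 ∂μ :=
              mul_le_mul (hI1 k) (hZsq k) (integral_nonneg fun ω => sq_nonneg _) zero_le_one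
          _ = _ := one_mul _
      rcases Nat.eq_zero_or_pos k with rfl | hk
      · have h0 : ∫ ω, Y 0 ω ^ 2 ∂μ = 0 := by simp [hY]
        rw [h0] at hle ⊢
        simpa using hle
      · have hk' : (0 : ℝ) < k := by exact_mod_cast hk
        rw [div_eq_inv_mul]
        refine mul_le_mul ?_ hle ?_ (by positivity)
        · refine inv_anti₀ (by positivity) ?_
          gcongr
          linarith
        · exact mul_nonneg (integral_nonneg fun ω => sq_nonneg _)
            (integral_nonneg fun ω => sq_nonneg _)
  have hcl : Tendsto c atTop (𝓝 (∫ x, Z 0 x ∂μ)) := by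
    have := (tendsto_integral_truncation hint).comp tendsto_natCast_atTop_atTop
    refine this.congr fun k => ?_
    exact ((hident k).truncation (A := (k : ℝ))).integral_eq.symm
  -- almost surely only finitely many of the truncations change anything
  have h2 : ∀ᵐ ω ∂μ, Tendsto (fun k : ℕ => Y k ω - Z k ω) atTop (𝓝 0) := by
    have A : (∑' j : ℕ, μ {ω | Z j ω ∈ Set.Ioi (j : ℝ)}) < ⊤ := by
      convert! tsum_prob_mem_Ioi_lt_top hint (hZ0 0) using 2
      ext1 j
      exact (hident j).measure_mem_eq measurableSet_Ioi
    filter_upwards [ae_eventually_notMem A.ne] with ω hω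
    refine tendsto_const_nhds.congr' ?_
    filter_upwards [hω, eventually_gt_atTop 0] with n hn npos
    have hn' : Z n ω ≤ n := by simpa using hn
    have hlt : -(n : ℝ) < Z n ω := lt_of_lt_of_le (by simpa using npos) (hZ0 n ω)
    simp [hY, truncation, hn', hlt]
  filter_upwards [h1, h2] with ω w1 w2
  have w3 : Tendsto (fun k : ℕ => (E k).indicator (1 : Ω → ℝ) ω *
      ((Z k ω - ∫ x, Z 0 x ∂μ) - (Y k ω - c k))) atTop (𝓝 0) := by
    have hd : Tendsto (fun k : ℕ => (Z k ω - ∫ x, Z 0 x ∂μ) - (Y k ω - c k)) atTop (𝓝 0) := by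
      have := (hcl.sub_const (∫ x, Z 0 x ∂μ)).sub w2
      rw [sub_self, sub_zero] at this
      refine this.congr fun k => ?_
      ring
    refine squeeze_zero_norm (a := fun k => ‖(Z k ω - ∫ x, Z 0 x ∂μ) - (Y k ω - c k)‖)
      (fun k => ?_) (by simpa using hd.norm)
    rw [norm_mul]
    refine mul_le_of_le_one_left (norm_nonneg _) ?_
    by_cases h : ω ∈ E k <;> simp [h]
  have := w1.add w3.cesaro
  rw [add_zero] at this
  refine this.congr fun n => ?_
  rw [div_eq_inv_mul, ← mul_add, ← Finset.sum_add_distrib, div_eq_inv_mul]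
  congr 1
  refine Finset.sum_congr rfl fun k _ => ?_
  ring

/-! ### The exponential law -/

theorem lintegral_expMeasure {r : ℝ} (f : ℝ → ENNReal) :
    ∫⁻ x, f x ∂(expMeasure r) = ∫⁻ x, exponentialPDF r x * f x := by
  have : Measurable (exponentialPDF r) := (measurable_exponentialPDFReal r).ennreal_ofReal
  exact lintegral_withDensity_eq_lintegral_mul_non_measurable _ this
    (Eventually.of_forall fun _ => ENNReal.ofReal_lt_top) f

/-- The exponential law has no memory: beyond `u ≥ 0` it is a scaled copy of itself, shifted by
`u`. -/
theorem lintegral_expMeasure_indicator_sub {r u : ℝ} (hu : 0 ≤ u) (f : ℝ → ENNReal) :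
    ∫⁻ x, (Set.Ioi u).indicator (fun x => f (x - u)) x ∂(expMeasure r) =
      ENNReal.ofReal (Real.exp (-(r * u))) * ∫⁻ x, f x ∂(expMeasure r) := by
  rw [lintegral_expMeasure, lintegral_expMeasure, ← lintegral_const_mul' _ _ ENNReal.ofReal_ne_top,
    ← lintegral_add_right_eq_self _ u]
  refine lintegral_congr_ae ?_
  have h0 : ∀ᵐ x : ℝ, x ≠ 0 := by simp [ae_iff]
  filter_upwards [h0] with x hx
  rcases lt_or_gt_of_ne hx with hx | hx
  · rw [exponentialPDF_of_neg hx, Set.indicator_of_notMem (by simpa using hx.le)]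
    simp
  · rw [Set.indicator_of_mem (by simpa using hx), exponentialPDF_of_nonneg hx.le,
      exponentialPDF_of_nonneg (by linarith), add_sub_cancel_right, ← mul_assoc,
      ← ENNReal.ofReal_mul (Real.exp_pos _).le]
    congr 2
    rw [mul_left_comm, ← Real.exp_add]
    congr 2
    ring

theorem expMeasure_memoryless {r u : ℝ} (hu : 0 ≤ u) {A : Set ℝ}
    (hA : MeasurableSet A) :
    expMeasure r {x | u < x ∧ x - u ∈ A} =
      ENNReal.ofReal (Real.exp (-(r * u))) * expMeasure r A := by
  have h := lintegral_expMeasure_indicator_sub (r := r) hu (A.indicator 1)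
  rw [lintegral_indicator_one hA] at h
  rw [← h, ← lintegral_indicator_one]
  · refine lintegral_congr fun x => ?_
    by_cases h1 : u < x <;> by_cases h2 : x - u ∈ A <;> simp [h1, h2]
  · exact (measurableSet_Ioi (a := u)).inter ((measurable_id.sub_const u) hA)

theorem integrable_pow_expMeasure {r : ℝ} (hr : 0 < r) (n : ℕ) :
    Integrable (fun x : ℝ => x ^ n) (expMeasure r) ∧
      ∫ x, x ^ n ∂(expMeasure r) = n.factorial / r ^ n := by
  have hI : ∫ x in Set.Ioi (0 : ℝ), x ^ n * Real.exp (-(r * x)) = n.factorial / r ^ (n + 1) := by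
    have := Real.integral_rpow_mul_exp_neg_mul_Ioi (a := n + 1) (r := r) (by positivity) hr
    simp only [add_sub_cancel_right, Real.rpow_natCast] at this
    rw [this, Real.Gamma_nat_eq_factorial]
    norm_cast
    rw [one_div, inv_pow, mul_comm, div_eq_mul_inv]
  have hi : IntegrableOn (fun x : ℝ => x ^ n * Real.exp (-(r * x))) (Set.Ioi 0) := by
    refine not_imp_comm.1 integral_undef ?_
    rw [hI]
    positivity
  have hm : Measurable (exponentialPDF r) := (measurable_exponentialPDFReal r).ennreal_ofReal
  have hlt : ∀ᵐ x : ℝ, exponentialPDF r x < ⊤ := Eventually.of_forall fun _ => ENNReal.ofReal_lt_top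
  have hfun : (fun x : ℝ => (exponentialPDF r x).toReal • x ^ n) =ᵐ[volume]
      (Set.Ioi 0).indicator (fun x => r * (x ^ n * Real.exp (-(r * x)))) := by
    have h0 : ∀ᵐ x : ℝ, x ≠ 0 := by simp [ae_iff]
    filter_upwards [h0] with x hx
    rcases lt_or_gt_of_ne hx with hx | hx
    · rw [exponentialPDF_of_neg hx, Set.indicator_of_notMem (by simpa using hx.le)]
      simp
    · rw [exponentialPDF_of_nonneg hx.le, Set.indicator_of_mem (Set.mem_Ioi.2 hx),
        ENNReal.toReal_ofReal (by positivity), smul_eq_mul]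
      ring
  have hi2 : Integrable ((Set.Ioi 0).indicator (fun x => r * (x ^ n * Real.exp (-(r * x))))) :=
    (integrable_indicator_iff measurableSet_Ioi).2 (hi.const_mul r)
  constructor
  · exact (integrable_withDensity_iff_integrable_smul' hm hlt).2 (hi2.congr hfun.symm)
  · have : ∫ x, x ^ n ∂(expMeasure r) = ∫ x, (exponentialPDF r x).toReal • x ^ n :=
      integral_withDensity_eq_integral_toReal_smul hm hlt _
    rw [this, integral_congr_ae hfun, integral_indicator measurableSet_Ioi, integral_const_mul, hI]
    field_simp
    ring

/-! ### The space of inputs -/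

/-- The data that drive the system: coordinate `inl n` is the `n`-th inter-arrival time and
coordinate `inr n` is the transfer time of packet `n`. -/
abbrev Input := ℕ ⊕ ℕ → ℝ

/-- Inter-arrival times of an input. -/
def gaps (s : Input) : ℕ → ℝ := fun n => s (Sum.inl n)

/-- Transfer times of an input. -/
def transfers (s : Input) : ℕ → ℝ := fun n => s (Sum.inr n)

/-- The input without its first `j` inter-arrival times and its first `j` transfer times. -/
def shift (j : ℕ) (s : Input) : Input := fun i => s (Sum.map (· + j) (· + j) i)

/-- The first `j` inter-arrival and transfer times of an input, padded by zeros. -/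
def past (j : ℕ) (s : Input) : Input := fun i => if Sum.elim id id i < j then s i else 0

/-- The law of an input with independent coordinates: inter-arrival times of law `ε`, transfer
times of law `τ`. -/
noncomputable def inputLaw (ε τ : Measure ℝ) [IsProbabilityMeasure ε] [IsProbabilityMeasure τ] :
    Measure Input :=
  haveI : ∀ i : ℕ ⊕ ℕ, IsProbabilityMeasure
      (Sum.elim (fun _ => ε) (fun _ => τ) i : Measure ℝ) := by
    rintro (i | i)
    exacts [‹IsProbabilityMeasure ε›, ‹IsProbabilityMeasure τ›]
  Measure.infinitePi (fun i : ℕ ⊕ ℕ => (Sum.elim (fun _ => ε) (fun _ => τ) i : Measure ℝ))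

section Law

variable {ε τ : Measure ℝ} [IsProbabilityMeasure ε] [IsProbabilityMeasure τ]

instance isProbabilityMeasure_elim (i : ℕ ⊕ ℕ) : IsProbabilityMeasure
    (Sum.elim (fun _ => ε) (fun _ => τ) i : Measure ℝ) := by
  rcases i with i | i
  exacts [‹IsProbabilityMeasure ε›, ‹IsProbabilityMeasure τ›]

instance isProbabilityMeasure_inputLaw : IsProbabilityMeasure (inputLaw ε τ) := by
  unfold inputLaw
  infer_instance

theorem measurable_shift (j : ℕ) : Measurable (shift j) := by
  unfold shift
  fun_prop

theorem measurable_past (j : ℕ) : Measurable (past j) := by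
  refine measurable_pi_iff.2 fun i => ?_
  unfold past
  split_ifs <;> fun_prop

/-- Dropping coordinates does not change the law. -/
theorem map_relabel_inputLaw {a b : ℕ → ℕ} (ha : a.Injective) (hb : b.Injective) :
    (inputLaw ε τ).map (fun s i => s (Sum.map a b i)) = inputLaw ε τ := by
  unfold inputLaw
  rw [Measure.map_infinitePi_infinitePi_of_inj
    (P := fun i : ℕ ⊕ ℕ => (Sum.elim (fun _ => ε) (fun _ => τ) i : Measure ℝ))
    (ha.sumMap hb)]
  congr 1
  ext1 i
  rcases i with i | i <;> rfl

theorem map_shift_inputLaw (j : ℕ) : (inputLaw ε τ).map (shift j) = inputLaw ε τ :=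
  map_relabel_inputLaw (add_left_injective j) (add_left_injective j)

theorem map_inl_inputLaw (n : ℕ) : (inputLaw ε τ).map (fun s => s (Sum.inl n)) = ε :=
  Measure.infinitePi_map_eval
    (fun i : ℕ ⊕ ℕ => (Sum.elim (fun _ => ε) (fun _ => τ) i : Measure ℝ)) (Sum.inl n)

theorem map_inr_inputLaw (n : ℕ) : (inputLaw ε τ).map (fun s => s (Sum.inr n)) = τ :=
  Measure.infinitePi_map_eval
    (fun i : ℕ ⊕ ℕ => (Sum.elim (fun _ => ε) (fun _ => τ) i : Measure ℝ)) (Sum.inr n)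

theorem iIndepFun_eval_inputLaw :
    iIndepFun (fun (i : ℕ ⊕ ℕ) (s : Input) => s i) (inputLaw ε τ) :=
  iIndepFun_infinitePi (X := fun _ x => x)
    (P := fun i : ℕ ⊕ ℕ => (Sum.elim (fun _ => ε) (fun _ => τ) i : Measure ℝ)) (by fun_prop)

/-- Functions of disjoint sets of coordinates are independent. -/
theorem indepFun_coordinates {ι κ : Type*} {a : ι → ℕ ⊕ ℕ} {b : κ → ℕ ⊕ ℕ}
    (hab : ∀ i j, a i ≠ b j) :
    IndepFun (fun (s : Input) i => s (a i)) (fun (s : Input) j => s (b j)) (inputLaw ε τ) := by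
  have hdisj : Disjoint (Set.range a) (Set.range b) := by
    rw [Set.disjoint_left]
    rintro _ ⟨i, rfl⟩ ⟨j, hj⟩
    exact hab i j hj.symm
  have h := indep_iSup_of_disjoint
    (m := fun i : ℕ ⊕ ℕ => MeasurableSpace.comap (fun s : Input => s i) inferInstance)
    (fun i => (measurable_pi_apply i).comap_le)
    (iIndepFun_eval_inputLaw (ε := ε) (τ := τ)).iIndep hdisj
  rw [IndepFun_iff_Indep]
  refine indep_of_indep_of_le_left (indep_of_indep_of_le_right h ?_) ?_
  all_goals
    rw [MeasurableSpace.pi, MeasurableSpace.comap_iSup]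
    refine iSup_le fun i => ?_
    rw [MeasurableSpace.comap_comp]
    exact le_iSup₂_of_le _ ⟨i, rfl⟩ le_rfl

theorem indepFun_past_shift (j : ℕ) : IndepFun (past j) (shift j) (inputLaw ε τ) := by
  have h := indepFun_coordinates (ε := ε) (τ := τ)
    (a := fun i : {i : ℕ ⊕ ℕ // Sum.elim id id i < j} => (i : ℕ ⊕ ℕ))
    (b := Sum.map (· + j) (· + j)) (by
      rintro ⟨i, hi⟩ (n | n) rfl <;> simp at hi)
  have hm : Measurable fun (v : {i : ℕ ⊕ ℕ // Sum.elim id id i < j} → ℝ) (i : ℕ ⊕ ℕ) =>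
      if hi : Sum.elim id id i < j then v ⟨i, hi⟩ else 0 := by
    refine measurable_pi_iff.2 fun i => ?_
    split_ifs
    · exact measurable_pi_apply _
    · exact measurable_const
  have h' := h.comp (ψ := id) hm measurable_id
  have e : past j = (fun (v : {i : ℕ ⊕ ℕ // Sum.elim id id i < j} → ℝ) (i : ℕ ⊕ ℕ) =>
      if hi : Sum.elim id id i < j then v ⟨i, hi⟩ else 0) ∘
      fun (s : Input) (i : {i : ℕ ⊕ ℕ // Sum.elim id id i < j}) => s i := by
    ext s i
    simp [past]
  rw [e]
  exact h'

theorem map_past_shift (j : ℕ) : (inputLaw ε τ).map (fun s => (past j s, shift j s)) =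
    ((inputLaw ε τ).map (past j)).prod (inputLaw ε τ) := by
  rw [(indepFun_iff_map_prod_eq_prod_map_map (measurable_past j).aemeasurable
    (measurable_shift j).aemeasurable).1 (indepFun_past_shift j), map_shift_inputLaw]

end Law

/-- The input in which the first inter-arrival time is replaced by `x`. -/
noncomputable def setFirst (s : Input) (x : ℝ) : Input := Function.update s (Sum.inl 0) x

theorem measurable_setFirst : Measurable (fun q : Input × ℝ => setFirst q.1 q.2) := by
  refine measurable_pi_iff.2 fun i => ?_
  by_cases hi : i = Sum.inl 0
  · subst hi
    simp only [setFirst, Function.update_self]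
    fun_prop
  · simp only [setFirst, Function.update_of_ne hi]
    fun_prop

section Memoryless

variable {r : ℝ} {ε τ : Measure ℝ} [IsProbabilityMeasure ε] [IsProbabilityMeasure τ]

/-- If no packet has arrived by time `u`, then what follows after time `u` is distributed as the
original input. -/
theorem inputLaw_memoryless (hε : ε = expMeasure r) {u : ℝ} (hu : 0 ≤ u)
    {C : Set Input} (hC : MeasurableSet C) :
    inputLaw ε τ {s | u < s (Sum.inl 0) ∧ setFirst s (s (Sum.inl 0) - u) ∈ C} =
      ENNReal.ofReal (Real.exp (-(r * u))) * inputLaw ε τ C := by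
  have hg : Measurable fun s : Input => setFirst s (s (Sum.inl 0) - u) :=
    measurable_setFirst.comp (by fun_prop : Measurable fun s : Input => (s, s (Sum.inl 0) - u))
  have hU : MeasurableSet {s : Input | u < s (Sum.inl 0)} :=
    measurableSet_lt measurable_const (measurable_pi_apply _)
  set e := ENNReal.ofReal (Real.exp (-(r * u))) with he
  have he0 : e ≠ 0 := by simp [he, Real.exp_pos]
  have het : e ≠ ⊤ := ENNReal.ofReal_ne_top
  set κ : Measure Input := e⁻¹ • ((inputLaw ε τ).restrict {s | u < s (Sum.inl 0)}).map
    (fun s => setFirst s (s (Sum.inl 0) - u)) with hκ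
  have hκC : ∀ D : Set Input, MeasurableSet D → κ D = e⁻¹ * inputLaw ε τ
      {s | u < s (Sum.inl 0) ∧ setFirst s (s (Sum.inl 0) - u) ∈ D} := by
    intro D hD
    rw [hκ, Measure.smul_apply, Measure.map_apply hg hD, Measure.restrict_apply (hg hD),
      smul_eq_mul, Set.inter_comm]
    rfl
  have key : κ = inputLaw ε τ := by
    refine Measure.eq_infinitePi
      (μ := fun i : ℕ ⊕ ℕ => (Sum.elim (fun _ => ε) (fun _ => τ) i : Measure ℝ)) fun F t ht => ?_
    classical
    set t' : ℕ ⊕ ℕ → Set ℝ := fun i => if i = Sum.inl 0 then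
      {x | u < x ∧ x - u ∈ (if Sum.inl 0 ∈ F then t (Sum.inl 0) else Set.univ)} else t i with ht'
    have hA : MeasurableSet (if Sum.inl 0 ∈ F then t (Sum.inl 0) else Set.univ : Set ℝ) := by
      split_ifs
      exacts [ht _, MeasurableSet.univ]
    have ht'm : ∀ i, MeasurableSet (t' i) := by
      intro i
      simp only [ht']
      split_ifs with h1 h2
      · exact measurableSet_Ioi.inter ((measurable_id.sub_const u) (ht _))
      · exact measurableSet_Ioi.inter ((measurable_id.sub_const u) MeasurableSet.univ)
      · exact ht i
    have hset : {s : Input | u < s (Sum.inl 0) ∧ setFirst s (s (Sum.inl 0) - u) ∈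
        Set.pi (F : Set (ℕ ⊕ ℕ)) t} =
        Set.pi ((insert (Sum.inl 0) (F.erase (Sum.inl 0)) : Finset (ℕ ⊕ ℕ)) : Set (ℕ ⊕ ℕ)) t' := by
      ext s
      simp only [Set.mem_ofPred_eq, Set.mem_pi, Finset.mem_coe, Finset.mem_insert, Finset.mem_erase]
      constructor
      · rintro ⟨h1, h2⟩ i hi
        by_cases hi0 : i = Sum.inl 0
        · subst hi0
          simp only [ht', if_true, Set.mem_ofPred_eq]
          refine ⟨h1, ?_⟩
          split_ifs with hF
          · simpa [setFirst] using h2 _ hF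
          · trivial
        · simp only [ht', if_neg hi0]
          have := h2 i ((hi.resolve_left hi0).2)
          rwa [setFirst, Function.update_of_ne hi0] at this
      · intro h
        have h0 := h (Sum.inl 0) (Or.inl rfl)
        simp only [ht', if_true, Set.mem_ofPred_eq] at h0
        refine ⟨h0.1, fun i hi => ?_⟩
        by_cases hi0 : i = Sum.inl 0
        · subst hi0
          simpa [setFirst, hi] using h0.2
        · rw [setFirst, Function.update_of_ne hi0]
          simpa only [ht', if_neg hi0] using h i (Or.inr ⟨hi0, hi⟩)
    rw [hκC _ (MeasurableSet.pi F.countable_toSet fun i _ => ht i), hset]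
    unfold inputLaw
    rw [Measure.infinitePi_pi _ (fun i _ => ht'm i), Finset.prod_insert (by simp)]
    have h0 : (Sum.elim (fun _ => ε) (fun _ => τ) (Sum.inl 0 : ℕ ⊕ ℕ) : Measure ℝ) (t' (Sum.inl 0))
        = e * ε (if Sum.inl 0 ∈ F then t (Sum.inl 0) else Set.univ) := by
      simp only [Sum.elim_inl, ht', if_true]
      rw [hε, he]
      exact expMeasure_memoryless hu hA
    have h1 : ∏ i ∈ F.erase (Sum.inl 0), (Sum.elim (fun _ => ε) (fun _ => τ) i : Measure ℝ) (t' i)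
        = ∏ i ∈ F.erase (Sum.inl 0), (Sum.elim (fun _ => ε) (fun _ => τ) i : Measure ℝ) (t i) := by
      refine Finset.prod_congr rfl fun i hi => ?_
      simp only [ht', if_neg (Finset.ne_of_mem_erase hi)]
    rw [h0, h1, mul_assoc, ← mul_assoc, ENNReal.inv_mul_cancel he0 het, one_mul]
    by_cases hF : Sum.inl 0 ∈ F
    · rw [if_pos hF, ← Finset.mul_prod_erase F _ hF]
      rfl
    · rw [if_neg hF, measure_univ, one_mul, Finset.erase_eq_of_notMem hF]
  have := hκC C hC
  rw [key] at this
  rw [this, ← mul_assoc, ENNReal.mul_inv_cancel he0 het, one_mul]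

/-- The strong Markov property for a time `u` after the `j`-th arrival that is determined by the
past: on the event that the next packet arrives after `u`, the input seen from that time is
distributed as the original input and independent of the past. -/
theorem inputLaw_strongMarkov (hε : ε = expMeasure r) (j : ℕ) {A : Set Input}
    (hA : MeasurableSet A) {u : Input → ℝ} (hum : Measurable u) (hu : ∀ s ∈ A, 0 ≤ u s)
    {C : Set Input} (hC : MeasurableSet C) :
    inputLaw ε τ {s | past j s ∈ A ∧ u (past j s) < s (Sum.inl j) ∧
        setFirst (shift j s) (s (Sum.inl j) - u (past j s)) ∈ C} =
      inputLaw ε τ {s | past j s ∈ A ∧ u (past j s) < s (Sum.inl j)} * inputLaw ε τ C := by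
  have main : ∀ D : Set Input, MeasurableSet D →
      inputLaw ε τ {s | past j s ∈ A ∧ u (past j s) < s (Sum.inl j) ∧
        setFirst (shift j s) (s (Sum.inl j) - u (past j s)) ∈ D} =
      (∫⁻ v, A.indicator (fun v => ENNReal.ofReal (Real.exp (-(r * u v)))) v
        ∂((inputLaw ε τ).map (past j))) * inputLaw ε τ D := by
    intro D hD
    set S : Set (Input × Input) := {q | q.1 ∈ A ∧ u q.1 < q.2 (Sum.inl 0) ∧
      setFirst q.2 (q.2 (Sum.inl 0) - u q.1) ∈ D} with hS
    have hSm : MeasurableSet S := by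
      refine (measurable_fst hA).inter (MeasurableSet.inter ?_ ?_)
      · exact measurableSet_lt (f := fun q : Input × Input => u q.1)
          (g := fun q : Input × Input => q.2 (Sum.inl 0)) (by fun_prop) (by fun_prop)
      · exact (measurable_setFirst.comp
          (by fun_prop : Measurable fun q : Input × Input => (q.2, q.2 (Sum.inl 0) - u q.1))) hD
    have e1 : {s | past j s ∈ A ∧ u (past j s) < s (Sum.inl j) ∧
        setFirst (shift j s) (s (Sum.inl j) - u (past j s)) ∈ D} =
        (fun s => (past j s, shift j s)) ⁻¹' S := by
      ext s
      simp [hS, shift]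
    rw [e1, ← Measure.map_apply ((measurable_past j).prodMk (measurable_shift j)) hSm,
      map_past_shift, Measure.prod_apply hSm, ← lintegral_mul_const _
        ((Measurable.ennreal_ofReal (by fun_prop)).indicator hA)]
    refine lintegral_congr fun v => ?_
    by_cases hv : v ∈ A
    · rw [Set.indicator_of_mem hv, ← inputLaw_memoryless hε (hu v hv) hD]
      congr 1
      ext s
      simp [hS, hv]
    · rw [Set.indicator_of_notMem hv, zero_mul]
      have : Prod.mk v ⁻¹' S = ∅ := by
        ext s
        simp [hS, hv]
      rw [this, measure_empty]
  have h1 := main Set.univ MeasurableSet.univ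
  simp only [Set.mem_univ, and_true, measure_univ, mul_one] at h1
  rw [main C hC, h1]

end Memoryless

/-! ### Regular inputs and the input seen from a later time -/

/-- The sample paths on which nothing degenerate happens: all inter-arrival times are positive,
transfer times are nonnegative, arrivals do not accumulate, and under permanent interruptions there
is always a later transfer that is completed. -/
structure IsRegular (s : Input) : Prop where
  gap_pos : ∀ n, 0 < gaps s n
  transfer_nonneg : ∀ n, 0 ≤ transfers s n
  tendsto_arrivalTime : Tendsto (arrivalTime (gaps s)) atTop atTop
  exists_completed : ∀ n, ∃ i, transfers s (n + i) < gaps s (n + i + 1)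

theorem input_ext {s s' : Input} (h : ∀ n, gaps s n = gaps s' n)
    (h' : ∀ n, transfers s n = transfers s' n) : s = s' := by
  ext i
  rcases i with n | n
  exacts [h n, h' n]

theorem arrivalTime_succ (ξ : ℕ → ℝ) (n : ℕ) :
    arrivalTime ξ (n + 1) = arrivalTime ξ n + ξ (n + 1) := by
  simp [arrivalTime, Finset.sum_range_succ _ (n + 1)]

theorem arrivalTime_zero (ξ : ℕ → ℝ) : arrivalTime ξ 0 = ξ 0 := by
  simp [arrivalTime]

theorem firstArrivalAfter_eq {ξ : ℕ → ℝ} {t : ℝ} {n : ℕ} (h : t < arrivalTime ξ n)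
    (h' : ∀ k < n, arrivalTime ξ k ≤ t) : firstArrivalAfter ξ t = n := by
  refine le_antisymm (Nat.sInf_le h) ?_
  by_contra hlt
  have hmem : firstArrivalAfter ξ t ∈ {n | t < arrivalTime ξ n} := Nat.sInf_mem ⟨n, h⟩
  exact absurd (h' _ (not_le.1 hlt)) (not_le.2 hmem)

theorem arrivalTime_le_of_lt_firstArrivalAfter {ξ : ℕ → ℝ} {t : ℝ} {n : ℕ}
    (h : n < firstArrivalAfter ξ t) : arrivalTime ξ n ≤ t :=
  not_lt.1 (Nat.notMem_of_lt_sInf h)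

theorem interruptions_spec {ξ T : ℕ → ℝ} {n : ℕ} (h : ∃ i, T (n + i) < ξ (n + i + 1)) :
    T (n + interruptions ξ T n) < ξ (n + interruptions ξ T n + 1) :=
  Nat.sInf_mem (s := {i | T (n + i) < ξ (n + i + 1)}) h

theorem interruptions_eq_iff {ξ T : ℕ → ℝ} {n m : ℕ} (h : ∃ i, T (n + i) < ξ (n + i + 1)) :
    interruptions ξ T n = m ↔
      (∀ i < m, ¬ T (n + i) < ξ (n + i + 1)) ∧ T (n + m) < ξ (n + m + 1) := by
  constructor
  · rintro rfl
    exact ⟨fun i hi => Nat.notMem_of_lt_sInf hi, interruptions_spec h⟩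
  · rintro ⟨h1, h2⟩
    refine le_antisymm (Nat.sInf_le h2) ?_
    by_contra hlt
    exact h1 _ (not_le.1 hlt) (interruptions_spec h)

/-- The input seen from time `r` on: the first inter-arrival time is the time from `r` to the next
arrival, all later data are those of the following packets. -/
noncomputable def residual (s : Input) (r : ℝ) : Input :=
  setFirst (shift (firstArrivalAfter (gaps s) r) s)
    (arrivalTime (gaps s) (firstArrivalAfter (gaps s) r) - r)

theorem transfers_residual (s : Input) (r : ℝ) (n : ℕ) :
    transfers (residual s r) n = transfers s (firstArrivalAfter (gaps s) r + n) := by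
  simp [transfers, residual, setFirst, shift, add_comm]

theorem gaps_residual_zero (s : Input) (r : ℝ) : gaps (residual s r) 0 =
    arrivalTime (gaps s) (firstArrivalAfter (gaps s) r) - r := by
  simp [gaps, residual, setFirst]

theorem gaps_residual_succ (s : Input) (r : ℝ) (n : ℕ) :
    gaps (residual s r) (n + 1) = gaps s (firstArrivalAfter (gaps s) r + n + 1) := by
  simp only [gaps, residual, setFirst]
  rw [Function.update_of_ne (by simp)]
  simp only [shift, Sum.map_inl]
  congr 2
  omega

theorem arrivalTime_residual (s : Input) (r : ℝ) (n : ℕ) :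
    arrivalTime (gaps (residual s r)) n =
      arrivalTime (gaps s) (firstArrivalAfter (gaps s) r + n) - r := by
  induction n with
  | zero => rw [arrivalTime_zero, gaps_residual_zero, add_zero]
  | succ n ih =>
    rw [arrivalTime_succ, ih, gaps_residual_succ, ← add_assoc, arrivalTime_succ]
    ring

theorem interruptions_residual (s : Input) (r : ℝ) :
    interruptions (gaps (residual s r)) (transfers (residual s r)) 0 =
      interruptions (gaps s) (transfers s) (firstArrivalAfter (gaps s) r) := by
  simp only [interruptions, transfers_residual, gaps_residual_succ, zero_add]

namespace IsRegular

variable {s : Input}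

theorem strictMono_arrivalTime (hs : IsRegular s) : StrictMono (arrivalTime (gaps s)) :=
  strictMono_nat_of_lt_succ fun n => by
    rw [arrivalTime_succ]
    linarith [hs.gap_pos (n + 1)]

theorem lt_firstArrivalAfter (hs : IsRegular s) (r : ℝ) :
    r < arrivalTime (gaps s) (firstArrivalAfter (gaps s) r) := by
  obtain ⟨n, hn⟩ := (hs.tendsto_arrivalTime.eventually_gt_atTop r).exists
  exact Nat.sInf_mem (s := {n | r < arrivalTime (gaps s) n}) ⟨n, hn⟩

theorem firstArrivalAfter_eq_succ_iff (hs : IsRegular s) {r : ℝ} {m : ℕ} :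
    firstArrivalAfter (gaps s) r = m + 1 ↔
      arrivalTime (gaps s) m ≤ r ∧ r < arrivalTime (gaps s) (m + 1) := by
  constructor
  · intro h
    refine ⟨arrivalTime_le_of_lt_firstArrivalAfter (by omega), ?_⟩
    rw [← h]
    exact hs.lt_firstArrivalAfter r
  · rintro ⟨h1, h2⟩
    refine firstArrivalAfter_eq h2 fun k hk => le_trans ?_ h1
    exact hs.strictMono_arrivalTime.monotone (by omega)

theorem firstArrivalAfter_zero (hs : IsRegular s) : firstArrivalAfter (gaps s) 0 = 0 := by
  refine firstArrivalAfter_eq ?_ (by simp)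
  rw [arrivalTime_zero]
  exact hs.gap_pos 0

theorem residual_zero (hs : IsRegular s) : residual s 0 = s := by
  rw [residual, hs.firstArrivalAfter_zero, arrivalTime_zero, sub_zero]
  have : shift 0 s = s := by
    ext i
    rcases i with i | i <;> simp [shift]
  rw [this, setFirst, gaps, Function.update_eq_self]

theorem isRegular_residual (hs : IsRegular s) (r : ℝ) : IsRegular (residual s r) where
  gap_pos n := by
    rcases n with _ | n
    · rw [gaps_residual_zero]
      linarith [hs.lt_firstArrivalAfter r]
    · rw [gaps_residual_succ]
      exact hs.gap_pos _
  transfer_nonneg n := by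
    rw [transfers_residual]
    exact hs.transfer_nonneg _
  tendsto_arrivalTime := by
    simp only [funext (arrivalTime_residual s r), sub_eq_add_neg]
    refine tendsto_atTop_add_const_right _ _ (hs.tendsto_arrivalTime.comp ?_)
    exact tendsto_atTop_mono (fun n => Nat.le_add_left n _) tendsto_id
  exists_completed n := by
    obtain ⟨i, hi⟩ := hs.exists_completed (firstArrivalAfter (gaps s) r + n)
    refine ⟨i, ?_⟩
    rwa [transfers_residual, gaps_residual_succ, ← add_assoc]

theorem firstArrivalAfter_residual (hs : IsRegular s) (r : ℝ) {l : ℝ} (hl : 0 ≤ l) :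
    firstArrivalAfter (gaps s) (r + l) = firstArrivalAfter (gaps s) r +
      firstArrivalAfter (gaps (residual s r)) l := by
  have h := (hs.isRegular_residual r).lt_firstArrivalAfter l
  rw [arrivalTime_residual] at h
  refine firstArrivalAfter_eq (by linarith) fun k hk => ?_
  rcases lt_or_ge k (firstArrivalAfter (gaps s) r) with hk' | hk'
  · linarith [arrivalTime_le_of_lt_firstArrivalAfter hk']
  · obtain ⟨n, rfl⟩ := Nat.exists_eq_add_of_le hk'
    have := arrivalTime_le_of_lt_firstArrivalAfter (Nat.lt_of_add_lt_add_left hk)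
    rw [arrivalTime_residual] at this
    linarith

/-- Looking at the input from time `r` and then from `l` time units later is the same as looking at
it from time `r + l`. -/
theorem residual_residual (hs : IsRegular s) (r : ℝ) {l : ℝ} (hl : 0 ≤ l) :
    residual (residual s r) l =
      residual s (r + l) := by
  have hJ := hs.firstArrivalAfter_residual r hl
  refine input_ext (fun n => ?_) fun n => ?_
  · rcases n with _ | n
    · rw [gaps_residual_zero, gaps_residual_zero, arrivalTime_residual, hJ]
      ring
    · rw [gaps_residual_succ, add_assoc, ← add_assoc, gaps_residual_succ, gaps_residual_succ, hJ]
      congr 1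
      omega
  · rw [transfers_residual, transfers_residual, transfers_residual, hJ, add_assoc]

end IsRegular

/-! ### Cycles and epochs -/

/-- Length of a cycle in which new packets are dropped, and the age at its end, when the source is
idle at time `0`. -/
def dnpCycle (s : Input) : ℝ × ℝ := (s (Sum.inl 0) + s (Sum.inr 0), s (Sum.inr 0))

/-- Length of a cycle in which old packets are dropped, and the age at its end, when the source is
idle at time `0`. -/
noncomputable def dopCycle (s : Input) : ℝ × ℝ :=
  (arrivalTime (gaps s) (interruptions (gaps s) (transfers s) 0) +
    transfers s (interruptions (gaps s) (transfers s) 0),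
    transfers s (interruptions (gaps s) (transfers s) 0))

open scoped Classical in
/-- Length and final age of the cycle that starts with age `g` under the policy `D`. -/
noncomputable def cycle (D : Set ℝ) (g : ℝ) (s : Input) : ℝ × ℝ :=
  if g ∈ D then dopCycle s else dnpCycle s

/-- The age at the `k`-th epoch together with the input seen from this epoch. -/
noncomputable def state (D : Set ℝ) (g₀ : ℝ) (s : Input) : ℕ → ℝ × Input
  | 0 => (g₀, s)
  | k + 1 =>
    let q := state D g₀ s k
    ((cycle D q.1 q.2).2, residual q.2 (cycle D q.1 q.2).1)

/-- Length and final age of the `k`-th cycle. -/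
noncomputable def cycleAt (D : Set ℝ) (g₀ : ℝ) (s : Input) (k : ℕ) : ℝ × ℝ :=
  cycle D (state D g₀ s k).1 (state D g₀ s k).2

theorem state_succ (D : Set ℝ) (g₀ : ℝ) (s : Input) (k : ℕ) : state D g₀ s (k + 1) =
    ((cycleAt D g₀ s k).2, residual (state D g₀ s k).2 (cycleAt D g₀ s k).1) := rfl

namespace IsRegular

variable {s : Input}

theorem le_dopCycle_fst (hs : IsRegular s) : gaps s 0 ≤ (dopCycle s).1 := by
  have h1 := hs.strictMono_arrivalTime.monotone
    (Nat.zero_le (interruptions (gaps s) (transfers s) 0))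
  rw [arrivalTime_zero] at h1
  have h2 := hs.transfer_nonneg (interruptions (gaps s) (transfers s) 0)
  simp only [dopCycle]
  linarith

theorem le_dnpCycle_fst (hs : IsRegular s) : gaps s 0 ≤ (dnpCycle s).1 := by
  have h2 := hs.transfer_nonneg 0
  simp only [dnpCycle, gaps, transfers] at *
  linarith

theorem dopCycle_snd_nonneg (hs : IsRegular s) : 0 ≤ (dopCycle s).2 := hs.transfer_nonneg _

theorem dnpCycle_snd_nonneg (hs : IsRegular s) : 0 ≤ (dnpCycle s).2 := hs.transfer_nonneg 0

theorem le_cycle_fst (hs : IsRegular s) (D : Set ℝ) (g : ℝ) : gaps s 0 ≤ (cycle D g s).1 := by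
  unfold cycle
  split_ifs
  exacts [hs.le_dopCycle_fst, hs.le_dnpCycle_fst]

theorem cycle_snd_nonneg (hs : IsRegular s) (D : Set ℝ) (g : ℝ) : 0 ≤ (cycle D g s).2 := by
  unfold cycle
  split_ifs
  exacts [hs.dopCycle_snd_nonneg, hs.dnpCycle_snd_nonneg]

theorem cycle_fst_pos (hs : IsRegular s) (D : Set ℝ) (g : ℝ) : 0 < (cycle D g s).1 :=
  (hs.gap_pos 0).trans_le (hs.le_cycle_fst D g)

/-- One step of the recursion for the epochs, in terms of the input seen from the current epoch. -/
theorem epoch_succ (D : Set ℝ) (g₀ : ℝ) (k : ℕ) :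
    let e := epoch D (gaps s) (transfers s) g₀ k
    let e' := epoch D (gaps s) (transfers s) g₀ (k + 1)
    let c := cycle D (e.1 - e.2) (residual s e.1)
    e'.1 = e.1 + c.1 ∧ e'.1 - e'.2 = c.2 := by
  intro e e' c
  have he' : e' = (arrivalTime (gaps s) (deliveredPacket D (gaps s) (transfers s) e.1 (e.1 - e.2)) +
    transfers s (deliveredPacket D (gaps s) (transfers s) e.1 (e.1 - e.2)),
    arrivalTime (gaps s) (deliveredPacket D (gaps s) (transfers s) e.1 (e.1 - e.2))) := rfl
  rw [he']
  simp only [c, cycle, deliveredPacket]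
  split_ifs with h
  · simp only [dopCycle, interruptions_residual, arrivalTime_residual, transfers_residual]
    constructor <;> ring
  · have h1 : residual s e.1 (Sum.inl 0) = _ := gaps_residual_zero s e.1
    have h2 : residual s e.1 (Sum.inr 0) = _ := transfers_residual s e.1 0
    simp only [dnpCycle, h1, h2, add_zero]
    constructor <;> ring

theorem state_eq (hs : IsRegular s) (D : Set ℝ) (g₀ : ℝ) (k : ℕ) :
    state D g₀ s k = ((epoch D (gaps s) (transfers s) g₀ k).1 -
      (epoch D (gaps s) (transfers s) g₀ k).2,
      residual s (epoch D (gaps s) (transfers s) g₀ k).1) := by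
  induction k with
  | zero => simp [state, epoch, hs.residual_zero]
  | succ k ih =>
    have h := epoch_succ (s := s) D g₀ k
    rw [state_succ, cycleAt, ih, h.2, h.1, hs.residual_residual]
    exact ((hs.isRegular_residual _).cycle_fst_pos D _).le

theorem state_snd (hs : IsRegular s) (D : Set ℝ) (g₀ : ℝ) (k : ℕ) :
    IsRegular (state D g₀ s k).2 := by
  rw [hs.state_eq]
  exact hs.isRegular_residual _

theorem epoch_fst_succ (hs : IsRegular s) (D : Set ℝ) (g₀ : ℝ) (k : ℕ) :
    (epoch D (gaps s) (transfers s) g₀ (k + 1)).1 =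
      (epoch D (gaps s) (transfers s) g₀ k).1 + (cycleAt D g₀ s k).1 := by
  rw [cycleAt, hs.state_eq]
  exact (epoch_succ (s := s) D g₀ k).1

end IsRegular

/-! ### Measurability -/

theorem measurable_nat_sInf {α : Type*} [MeasurableSpace α] {p : ℕ → α → Prop}
    (hp : ∀ n, MeasurableSet {a | p n a}) : Measurable fun a => sInf {n | p n a} := by
  classical
  refine measurable_to_countable' fun k => ?_
  have : (fun a => sInf {n | p n a}) ⁻¹' {k} =
      ({a | p k a} ∩ ⋂ i, ⋂ (_ : i < k), {a | p i a}ᶜ) ∪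
        (if k = 0 then ⋂ i, {a | p i a}ᶜ else ∅) := by
    ext a
    simp only [Set.mem_preimage, Set.mem_singleton_iff, Set.mem_union, Set.mem_inter_iff,
      Set.mem_iInter, Set.mem_compl_iff, Set.mem_ofPred_eq]
    by_cases h : ∃ n, p n a
    · have hm : p (sInf {n | p n a}) a := Nat.sInf_mem (s := {n | p n a}) h
      constructor
      · rintro rfl
        exact Or.inl ⟨hm, fun i hi => Nat.notMem_of_lt_sInf hi⟩
      · rintro (⟨h1, h2⟩ | h1)
        · refine le_antisymm (Nat.sInf_le h1) ?_
          by_contra hlt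
          exact h2 _ (not_le.1 hlt) hm
        · split_ifs at h1 with hk
          · obtain ⟨n, hn⟩ := h
            exact absurd hn (by simpa using Set.mem_iInter.1 h1 n)
          · exact h1.elim
    · have h0 : {n | p n a} = ∅ := by
        ext n
        simpa using not_exists.1 h n
      rw [h0, Nat.sInf_empty]
      constructor
      · rintro rfl
        right
        simpa using not_exists.1 h
      · rintro (⟨h1, -⟩ | h1)
        · exact absurd ⟨k, h1⟩ h
        · split_ifs at h1 with hk
          · exact hk.symm
          · exact h1.elim
  rw [this]
  refine MeasurableSet.union ((hp k).inter ?_) ?_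
  · exact MeasurableSet.iInter fun i => MeasurableSet.iInter fun _ => (hp i).compl
  · split_ifs
    · exact MeasurableSet.iInter fun i => (hp i).compl
    · exact MeasurableSet.empty

theorem measurable_apply_nat {α β : Type*} [MeasurableSpace α] [MeasurableSpace β]
    {f : ℕ → α → β} (hf : ∀ n, Measurable (f n)) {N : α → ℕ} (hN : Measurable N) :
    Measurable fun a => f (N a) a :=
  (measurable_from_prod_countable_right (f := fun q : ℕ × α => f q.1 q.2) hf).comp
    (hN.prodMk measurable_id)

@[fun_prop]
theorem measurable_gaps (n : ℕ) : Measurable fun s : Input => gaps s n :=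
  measurable_pi_apply (Sum.inl n)

@[fun_prop]
theorem measurable_transfers (n : ℕ) : Measurable fun s : Input => transfers s n :=
  measurable_pi_apply (Sum.inr n)

@[fun_prop]
theorem measurable_arrivalTime (n : ℕ) : Measurable fun s : Input => arrivalTime (gaps s) n := by
  unfold arrivalTime
  fun_prop

theorem measurable_interruptions (n : ℕ) :
    Measurable fun s : Input => interruptions (gaps s) (transfers s) n :=
  measurable_nat_sInf fun _ => measurableSet_lt (by fun_prop) (by fun_prop)

theorem measurable_firstArrivalAfter :
    Measurable fun q : Input × ℝ => firstArrivalAfter (gaps q.1) q.2 :=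
  measurable_nat_sInf fun n => measurableSet_lt measurable_snd
    ((measurable_arrivalTime n).comp measurable_fst)

theorem measurable_residual : Measurable fun q : Input × ℝ => residual q.1 q.2 := by
  have h1 : Measurable fun q : Input × ℝ => shift (firstArrivalAfter (gaps q.1) q.2) q.1 :=
    measurable_apply_nat (f := fun n (q : Input × ℝ) => shift n q.1)
      (fun n => (measurable_shift n).comp measurable_fst) measurable_firstArrivalAfter
  have h2 : Measurable fun q : Input × ℝ =>
      arrivalTime (gaps q.1) (firstArrivalAfter (gaps q.1) q.2) - q.2 :=
    measurable_apply_nat (f := fun n (q : Input × ℝ) => arrivalTime (gaps q.1) n - q.2)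
      (fun n => ((measurable_arrivalTime n).comp measurable_fst).sub measurable_snd)
      measurable_firstArrivalAfter
  exact measurable_setFirst.comp (h1.prodMk h2)

theorem measurable_dnpCycle : Measurable dnpCycle := by
  unfold dnpCycle
  fun_prop

theorem measurable_dopCycle : Measurable dopCycle :=
  measurable_apply_nat
    (f := fun n (s : Input) => (arrivalTime (gaps s) n + transfers s n, transfers s n))
    (fun n => ((measurable_arrivalTime n).add (measurable_transfers n)).prodMk
      (measurable_transfers n)) (measurable_interruptions 0)

theorem measurable_cycle {D : Set ℝ} (hD : MeasurableSet D) :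
    Measurable fun q : ℝ × Input => cycle D q.1 q.2 := by
  classical
  exact Measurable.ite (measurable_fst hD) (measurable_dopCycle.comp measurable_snd)
    (measurable_dnpCycle.comp measurable_snd)

theorem measurable_state {D : Set ℝ} (hD : MeasurableSet D) (g₀ : ℝ) (k : ℕ) :
    Measurable fun s => state D g₀ s k := by
  induction k with
  | zero => exact measurable_const.prodMk measurable_id
  | succ k ih =>
    have hc : Measurable fun s => cycleAt D g₀ s k := (measurable_cycle hD).comp ih
    simp only [state_succ]
    have h2 : Measurable fun s => (state D g₀ s k).2 := measurable_snd.comp ih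
    have h1 : Measurable fun s => (cycleAt D g₀ s k).1 := measurable_fst.comp hc
    have h3 : Measurable fun s => ((state D g₀ s k).2, (cycleAt D g₀ s k).1) := h2.prodMk h1
    have h4 := measurable_residual.comp h3
    rw [Function.comp_def] at h4
    exact (measurable_snd.comp hc).prodMk h4

theorem measurable_cycleAt {D : Set ℝ} (hD : MeasurableSet D) (g₀ : ℝ) (k : ℕ) :
    Measurable fun s => cycleAt D g₀ s k :=
  (measurable_cycle hD).comp (measurable_state hD g₀ k)

/-! ### Almost every input is regular -/

section Regular

variable {r : ℝ} {ε τ : Measure ℝ} [IsProbabilityMeasure ε] [IsProbabilityMeasure τ]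

theorem measure_Ioi_expMeasure {u : ℝ} (hu : 0 ≤ u) (hε : ε = expMeasure r) :
    ε (Set.Ioi u) = ENNReal.ofReal (Real.exp (-(r * u))) := by
  have h := expMeasure_memoryless (r := r) hu MeasurableSet.univ
  rw [← hε, measure_univ, mul_one] at h
  rw [← h]
  congr 1
  ext x
  simp

theorem map_inr_inl_inputLaw (m n : ℕ) :
    (inputLaw ε τ).map (fun s => (s (Sum.inr m), s (Sum.inl n))) = τ.prod ε :=
  Measure.infinitePi_map_eval_prod
    (P := fun i : ℕ ⊕ ℕ => (Sum.elim (fun _ => ε) (fun _ => τ) i : Measure ℝ))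
    (by simp : (Sum.inr m : ℕ ⊕ ℕ) ≠ Sum.inl n)

theorem ae_transfer_nonneg (hτ : ∀ᵐ x ∂τ, 0 ≤ x) (n : ℕ) :
    ∀ᵐ s ∂(inputLaw ε τ), 0 ≤ transfers s n := by
  rw [← map_inr_inputLaw (ε := ε) (τ := τ) n] at hτ
  exact ae_of_ae_map (measurable_pi_apply _).aemeasurable hτ

theorem ae_gap_pos (hε : ε = expMeasure r) (n : ℕ) : ∀ᵐ s ∂(inputLaw ε τ), 0 < gaps s n := by
  have h : ∀ᵐ x ∂ε, 0 < x := by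
    refine (prob_compl_eq_zero_iff measurableSet_Ioi).2 ?_
    rw [measure_Ioi_expMeasure le_rfl hε]
    simp
  rw [← map_inl_inputLaw (ε := ε) (τ := τ) n] at h
  exact ae_of_ae_map (measurable_pi_apply _).aemeasurable h

/-- The probability `E[exp (-r T)]` that a transfer is not interrupted is positive. -/
theorem measure_completed_pos (hε : ε = expMeasure r) (hτ : ∀ᵐ x ∂τ, 0 ≤ x) :
    0 < inputLaw ε τ {s | transfers s 0 < gaps s 0} := by
  have hm : MeasurableSet {q : ℝ × ℝ | q.1 < q.2} := measurableSet_lt measurable_fst measurable_snd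
  have h : inputLaw ε τ {s | transfers s 0 < gaps s 0} =
      ((inputLaw ε τ).map (fun s => (s (Sum.inr 0), s (Sum.inl 0)))) {q | q.1 < q.2} := by
    rw [Measure.map_apply (by fun_prop) hm]
    rfl
  rw [h, map_inr_inl_inputLaw, Measure.prod_apply hm, lintegral_pos_iff_support
    (measurable_measure_prodMk_left hm)]
  have hsupp : τ (Function.support fun x => ε (Prod.mk x ⁻¹' {q : ℝ × ℝ | q.1 < q.2})) = 1 := by
    rw [← measure_univ (μ := τ)]
    refine measure_congr ?_
    filter_upwards [hτ] with x hx
    refine propext ⟨fun _ => trivial, fun _ => ?_⟩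
    have : Prod.mk x ⁻¹' {q : ℝ × ℝ | q.1 < q.2} = Set.Ioi x := by
      ext y
      simp
    change ε _ ≠ 0
    rw [this, measure_Ioi_expMeasure hx hε]
    simp [Real.exp_pos]
  rw [hsupp]
  exact one_pos

theorem ae_exists_completed (hε : ε = expMeasure r) (hτ : ∀ᵐ x ∂τ, 0 ≤ x) (n : ℕ) :
    ∀ᵐ s ∂(inputLaw ε τ), ∃ i, transfers s (n + i) < gaps s (n + i + 1) := by
  set N : Set Input := {s | ∀ i, ¬ transfers s i < gaps s i} with hN
  have hNm : MeasurableSet N := by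
    simp only [hN, Set.ofPred_forall]
    exact MeasurableSet.iInter fun i =>
      (measurableSet_lt (measurable_transfers i) (measurable_gaps i)).compl
  have hFm : MeasurableSet {s : Input | transfers s 0 < gaps s 0} :=
    measurableSet_lt (by fun_prop) (by fun_prop)
  have h1 : inputLaw ε τ N = inputLaw ε τ {s | transfers s 0 < gaps s 0}ᶜ * inputLaw ε τ N := by
    have hind := (indepFun_past_shift (ε := ε) (τ := τ) 1).measure_inter_preimage_eq_mul
      {s | transfers s 0 < gaps s 0}ᶜ N hFm.compl hNm
    have e1 : past 1 ⁻¹' {s | transfers s 0 < gaps s 0}ᶜ = {s | transfers s 0 < gaps s 0}ᶜ := by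
      ext s
      simp [past, transfers, gaps]
    have e2 : N = {s | transfers s 0 < gaps s 0}ᶜ ∩ shift 1 ⁻¹' N := by
      ext s
      simp only [hN, Set.mem_ofPred_eq, Set.mem_inter_iff, Set.mem_compl_iff, Set.mem_preimage]
      constructor
      · exact fun h => ⟨h 0, fun i => h (i + 1)⟩
      · rintro ⟨h0, h⟩ (_ | i)
        exacts [h0, h i]
    have e3 : inputLaw ε τ (shift 1 ⁻¹' N) = inputLaw ε τ N := by
      rw [← Measure.map_apply (measurable_shift 1) hNm, map_shift_inputLaw]
    rw [e1, e3] at hind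
    rw [← hind, ← e2]
  have h0 : inputLaw ε τ N = 0 := by
    by_contra hne
    have hlt : inputLaw ε τ {s | transfers s 0 < gaps s 0}ᶜ < 1 := by
      rw [prob_compl_eq_one_sub hFm]
      exact ENNReal.sub_lt_self ENNReal.one_ne_top one_ne_zero (measure_completed_pos hε hτ).ne'
    have := ENNReal.mul_lt_mul_left hne (measure_ne_top _ _) hlt
    rw [one_mul, ← h1] at this
    exact lt_irrefl _ this
  have hae : ∀ᵐ s ∂(inputLaw ε τ), s ∉ N := measure_eq_zero_iff_ae_notMem.1 h0
  have ha : (fun i : ℕ => n + i + 1).Injective := fun i j h => by simpa using h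
  have hb : (fun i : ℕ => n + i).Injective := fun i j h => by simpa using h
  rw [← map_relabel_inputLaw (ε := ε) (τ := τ) ha hb] at hae
  filter_upwards [ae_of_ae_map (measurable_pi_iff.2 fun i => measurable_pi_apply _).aemeasurable
    hae] with s hs
  simpa [hN, transfers, gaps] using hs

theorem integral_inl_inputLaw (hr : 0 < r) (hε : ε = expMeasure r) (n : ℕ) :
    Integrable (fun s => s (Sum.inl n)) (inputLaw ε τ) ∧
      ∫ s, s (Sum.inl n) ∂(inputLaw ε τ) = 1 / r := by
  obtain ⟨h1, h2⟩ := integrable_pow_expMeasure hr 1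
  simp only [pow_one, Nat.factorial_one, Nat.cast_one, ← hε] at h1 h2
  rw [← map_inl_inputLaw (ε := ε) (τ := τ) n] at h1 h2
  refine ⟨h1.comp_measurable (measurable_pi_apply _), ?_⟩
  rw [integral_map (measurable_pi_apply _).aemeasurable (by fun_prop)] at h2
  exact h2

theorem ae_tendsto_arrivalTime (hr : 0 < r) (hε : ε = expMeasure r) :
    ∀ᵐ s ∂(inputLaw ε τ), Tendsto (arrivalTime (gaps s)) atTop atTop := by
  have h := strong_law_ae_real (μ := inputLaw ε τ) (fun n s => s (Sum.inl n))
    (integral_inl_inputLaw hr hε 0).1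
    (fun i j hij => iIndepFun_eval_inputLaw.indepFun (by simpa using hij))
    (fun i => ⟨(measurable_pi_apply _).aemeasurable, (measurable_pi_apply _).aemeasurable, by
      rw [map_inl_inputLaw, map_inl_inputLaw]⟩)
  rw [(integral_inl_inputLaw hr hε 0).2] at h
  filter_upwards [h] with s hs
  have h1 : Tendsto (fun n : ℕ => (∑ i ∈ Finset.range n, s (Sum.inl i)) / n * (n : ℝ)) atTop
      atTop := hs.pos_mul_atTop (by positivity) tendsto_natCast_atTop_atTop
  refine (h1.comp (tendsto_add_atTop_nat 1)).congr fun n => ?_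
  simp only [Function.comp_apply, arrivalTime, gaps]
  rw [div_mul_cancel₀]
  positivity

theorem ae_isRegular (hr : 0 < r) (hε : ε = expMeasure r) (hτ : ∀ᵐ x ∂τ, 0 ≤ x) :
    ∀ᵐ s ∂(inputLaw ε τ), IsRegular s := by
  filter_upwards [ae_all_iff.2 (ae_gap_pos (τ := τ) hε), ae_all_iff.2 (ae_transfer_nonneg hτ),
    ae_tendsto_arrivalTime hr hε, ae_all_iff.2 (ae_exists_completed hε hτ)] with s h1 h2 h3 h4
  exact ⟨h1, h2, h3, h4⟩

end Regular

/-! ### Regeneration at the end of a cycle -/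

theorem gaps_past {s : Input} {n j : ℕ} (h : n < j) : gaps (past j s) n = gaps s n := by
  simp [gaps, past, h]

theorem transfers_past {s : Input} {n j : ℕ} (h : n < j) :
    transfers (past j s) n = transfers s n := by
  simp [transfers, past, h]

theorem arrivalTime_past {s : Input} {n j : ℕ} (h : n < j) :
    arrivalTime (gaps (past j s)) n = arrivalTime (gaps s) n :=
  Finset.sum_congr rfl fun i hi => gaps_past (by
    have := Finset.mem_range.1 hi
    omega)

section Regeneration

variable {r : ℝ} {ε τ : Measure ℝ} [IsProbabilityMeasure ε] [IsProbabilityMeasure τ]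

/-- A criterion for the input seen from the random time `L` to be a fresh copy that is independent
of the event `E`: if exactly `m + 1` packets have arrived by time `L`, then whether this is so,
whether `E` occurs, and how long after the last arrival `L` is, are determined by the data of these
packets, apart from the fact that the next arrival is later. -/
theorem measure_inter_residual_mem (hε : ε = expMeasure r)
    (hreg : ∀ᵐ s ∂(inputLaw ε τ), IsRegular s) {E : Set Input} (hE : MeasurableSet E)
    {L : Input → ℝ} (hLm : Measurable L) (hL : ∀ s, IsRegular s → gaps s 0 ≤ L s)
    {A : ℕ → Set Input} (hA : ∀ m, MeasurableSet (A m)) {u : ℕ → Input → ℝ}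
    (hum : ∀ m, Measurable (u m)) (hu : ∀ m, ∀ s ∈ A m, 0 ≤ u m s)
    (h : ∀ s, IsRegular s → ∀ m, (s ∈ E ∧ firstArrivalAfter (gaps s) (L s) = m + 1) ↔
      (past (m + 1) s ∈ A m ∧ u m (past (m + 1) s) < s (Sum.inl (m + 1))))
    (hres : ∀ s, IsRegular s → ∀ m, firstArrivalAfter (gaps s) (L s) = m + 1 →
      arrivalTime (gaps s) (m + 1) - L s = s (Sum.inl (m + 1)) - u m (past (m + 1) s))
    {C : Set Input} (hC : MeasurableSet C) :
    inputLaw ε τ (E ∩ {s | residual s (L s) ∈ C}) = inputLaw ε τ E * inputLaw ε τ C := by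
  set K : Input → ℕ := fun s => firstArrivalAfter (gaps s) (L s) with hK
  have hKm : Measurable K := by
    have := measurable_firstArrivalAfter.comp (measurable_id.prodMk hLm)
    rwa [Function.comp_def] at this
  have hRm : Measurable fun s => residual s (L s) := by
    have := measurable_residual.comp (measurable_id.prodMk hLm)
    rwa [Function.comp_def] at this
  have hsum : ∀ F : Set Input, MeasurableSet F →
      inputLaw ε τ F = ∑' m, inputLaw ε τ (F ∩ K ⁻¹' {m + 1}) := by
    intro F hF
    rw [← measure_iUnion]
    · refine measure_congr ?_
      filter_upwards [hreg] with s hs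
      refine propext ⟨fun hsF => ?_, fun hsF => ?_⟩
      · have hpos : K s ≠ 0 := by
          intro h0
          have h1 := hs.lt_firstArrivalAfter (L s)
          rw [show firstArrivalAfter (gaps s) (L s) = 0 from h0, arrivalTime_zero] at h1
          exact absurd (hL s hs) (not_le.2 h1)
        obtain ⟨m, hm⟩ := Nat.exists_eq_succ_of_ne_zero hpos
        exact Set.mem_iUnion.2 ⟨m, hsF, hm⟩
      · obtain ⟨m, hm⟩ := Set.mem_iUnion.1 hsF
        exact hm.1
    · intro i j hij
      refine Set.disjoint_left.2 fun s hi hj => hij ?_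
      have e1 : K s = i + 1 := hi.2
      have e2 : K s = j + 1 := hj.2
      omega
    · exact fun m => hF.inter (hKm (measurableSet_singleton _))
  have hEC : MeasurableSet (E ∩ {s | residual s (L s) ∈ C}) := hE.inter (hRm hC)
  rw [hsum _ hEC, hsum E hE, ← ENNReal.tsum_mul_right]
  refine tsum_congr fun m => ?_
  have e1 : inputLaw ε τ (E ∩ K ⁻¹' {m + 1}) = inputLaw ε τ
      {s | past (m + 1) s ∈ A m ∧ u m (past (m + 1) s) < s (Sum.inl (m + 1))} := by
    refine measure_congr ?_
    filter_upwards [hreg] with s hs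
    exact propext (h s hs m)
  rw [e1, ← inputLaw_strongMarkov hε (m + 1) (hA m) (hum m) (hu m) hC]
  refine measure_congr ?_
  filter_upwards [hreg] with s hs
  have hR : K s = m + 1 → setFirst (shift (m + 1) s)
      (s (Sum.inl (m + 1)) - u m (past (m + 1) s)) = residual s (L s) := by
    intro hm
    rw [residual, show firstArrivalAfter (gaps s) (L s) = m + 1 from hm, hres s hs m hm]
  refine propext ⟨?_, ?_⟩
  · rintro ⟨⟨h1, h2⟩, h3⟩
    have h4 := (h s hs m).1 ⟨h1, h3⟩
    refine ⟨h4.1, h4.2, ?_⟩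
    rw [hR h3]
    exact h2
  · rintro ⟨h1, h2, h3⟩
    have h4 := (h s hs m).2 ⟨h1, h2⟩
    rw [hR h4.2] at h3
    exact ⟨⟨h4.1, h3⟩, h4.2⟩

/-- After a cycle in which new packets are dropped the system starts afresh. -/
theorem dnpCycle_regeneration (hε : ε = expMeasure r)
    (hreg : ∀ᵐ s ∂(inputLaw ε τ), IsRegular s) {B : Set (ℝ × ℝ)} (hB : MeasurableSet B)
    {C : Set Input} (hC : MeasurableSet C) :
    inputLaw ε τ (dnpCycle ⁻¹' B ∩ {s | residual s (dnpCycle s).1 ∈ C}) =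
      inputLaw ε τ (dnpCycle ⁻¹' B) * inputLaw ε τ C := by
  have hc : ∀ (s : Input) (m : ℕ), dnpCycle (past (m + 1) s) = dnpCycle s := by
    intro s m
    simp [dnpCycle, past]
  refine measure_inter_residual_mem hε hreg (measurable_dnpCycle hB) measurable_dnpCycle.fst
    (fun s hs => hs.le_dnpCycle_fst)
    (A := fun m => {v | arrivalTime (gaps v) m ≤ (dnpCycle v).1} ∩ dnpCycle ⁻¹' B)
    (u := fun m v => (dnpCycle v).1 - arrivalTime (gaps v) m)
    (fun m => (measurableSet_le (by fun_prop) measurable_dnpCycle.fst).inter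
      (measurable_dnpCycle hB))
    (fun m => measurable_dnpCycle.fst.sub (by fun_prop)) ?_ ?_ ?_ hC
  · exact fun m s hs => sub_nonneg.2 hs.1
  · intro s hs m
    simp only [hs.firstArrivalAfter_eq_succ_iff, Set.mem_inter_iff, Set.mem_preimage,
      Set.mem_ofPred_eq, hc, arrivalTime_past (Nat.lt_succ_self m), arrivalTime_succ,
      sub_lt_iff_lt_add', gaps]
    tauto
  · intro s hs m _
    simp only [hc, arrivalTime_past (Nat.lt_succ_self m), arrivalTime_succ, gaps]
    ring

/-- After a cycle in which old packets are dropped the system starts afresh. -/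
theorem dopCycle_regeneration (hε : ε = expMeasure r)
    (hreg : ∀ᵐ s ∂(inputLaw ε τ), IsRegular s) {B : Set (ℝ × ℝ)} (hB : MeasurableSet B)
    {C : Set Input} (hC : MeasurableSet C) :
    inputLaw ε τ (dopCycle ⁻¹' B ∩ {s | residual s (dopCycle s).1 ∈ C}) =
      inputLaw ε τ (dopCycle ⁻¹' B) * inputLaw ε τ C := by
  have hK : ∀ s : Input, IsRegular s → firstArrivalAfter (gaps s) (dopCycle s).1 =
      interruptions (gaps s) (transfers s) 0 + 1 := by
    intro s hs
    have h1 := interruptions_spec (hs.exists_completed 0)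
    have h2 := hs.transfer_nonneg (interruptions (gaps s) (transfers s) 0)
    simp only [zero_add] at h1
    rw [hs.firstArrivalAfter_eq_succ_iff, arrivalTime_succ]
    simp only [dopCycle]
    exact ⟨by linarith, by linarith⟩
  refine measure_inter_residual_mem hε hreg (measurable_dopCycle hB) measurable_dopCycle.fst
    (fun s hs => hs.le_dopCycle_fst)
    (A := fun m => {v | ∀ i < m, ¬ transfers v (0 + i) < gaps v (0 + i + 1)} ∩
      {v | 0 ≤ transfers v m} ∩
      (fun v => (arrivalTime (gaps v) m + transfers v m, transfers v m)) ⁻¹' B)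
    (u := fun m v => transfers v m) (fun m => ?_) (fun m => by fun_prop) ?_ ?_ ?_ hC
  · refine MeasurableSet.inter (MeasurableSet.inter ?_ ?_) ?_
    · simp only [Set.ofPred_forall]
      exact MeasurableSet.iInter fun i => MeasurableSet.iInter fun _ =>
        (measurableSet_lt (measurable_transfers _) (measurable_gaps _)).compl
    · exact measurableSet_le measurable_const (measurable_transfers m)
    · exact ((measurable_arrivalTime m).add (measurable_transfers m)).prodMk
        (measurable_transfers m) hB
  · exact fun m s hs => hs.1.2
  · intro s hs m
    rw [hK s hs, Nat.add_left_inj, interruptions_eq_iff (hs.exists_completed 0)]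
    have e1 : (∀ i < m, ¬ transfers (past (m + 1) s) (0 + i) < gaps (past (m + 1) s) (0 + i + 1)) ↔
        ∀ i < m, ¬ transfers s (0 + i) < gaps s (0 + i + 1) := by
      refine forall₂_congr fun i hi => ?_
      rw [transfers_past (by omega), gaps_past (by omega)]
    simp only [Set.mem_inter_iff, Set.mem_preimage, Set.mem_ofPred_eq, e1,
      arrivalTime_past (Nat.lt_succ_self m), transfers_past (Nat.lt_succ_self m)]
    have e2 : s (Sum.inl (m + 1)) = gaps s (0 + m + 1) := by simp [gaps]
    rw [e2, zero_add]
    have e3 := hs.transfer_nonneg m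
    constructor
    · rintro ⟨h1, h2, h3⟩
      have hI := (interruptions_eq_iff (hs.exists_completed 0)).2 ⟨h2, by simpa using h3⟩
      rw [dopCycle, hI] at h1
      exact ⟨⟨⟨h2, e3⟩, h1⟩, h3⟩
    · rintro ⟨⟨⟨h2, -⟩, h1⟩, h3⟩
      have hI := (interruptions_eq_iff (hs.exists_completed 0)).2 ⟨h2, by simpa using h3⟩
      refine ⟨?_, h2, h3⟩
      rwa [dopCycle, hI]
  · intro s hs m hm
    rw [hK s hs, Nat.add_left_inj] at hm
    rw [arrivalTime_succ, transfers_past (Nat.lt_succ_self m), dopCycle, hm, gaps]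
    ring

end Regeneration

/-! ### The history of the cycles -/

/-- Lengths and final ages of the first `k` cycles, padded by zeros. -/
noncomputable def history (D : Set ℝ) (g₀ : ℝ) (k : ℕ) (s : Input) : ℕ → ℝ × ℝ :=
  fun i => if i < k then cycleAt D g₀ s i else 0

/-- The age at the `k`-th epoch as a function of the history. -/
def ageOfHistory (g₀ : ℝ) : ℕ → (ℕ → ℝ × ℝ) → ℝ
  | 0, _ => g₀
  | k + 1, h => (h k).2

theorem measurable_ageOfHistory (g₀ : ℝ) (k : ℕ) : Measurable (ageOfHistory g₀ k) := by
  rcases k with _ | k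
  · exact measurable_const
  · exact (measurable_pi_apply k).snd

theorem ageOfHistory_history (D : Set ℝ) (g₀ : ℝ) (k : ℕ) (s : Input) :
    ageOfHistory g₀ k (history D g₀ k s) = (state D g₀ s k).1 := by
  rcases k with _ | k
  · rfl
  · simp [ageOfHistory, history, state_succ]

theorem history_succ (D : Set ℝ) (g₀ : ℝ) (k : ℕ) (s : Input) :
    history D g₀ (k + 1) s = Function.update (history D g₀ k s) k (cycleAt D g₀ s k) := by
  ext1 i
  by_cases h : i = k
  · subst h
    simp [history]
  · rw [Function.update_of_ne h]
    have : i < k + 1 ↔ i < k := by omega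
    simp only [history, this]

section History

variable {D : Set ℝ} {g₀ : ℝ}

theorem measurable_history (hD : MeasurableSet D) (k : ℕ) : Measurable (history D g₀ k) := by
  refine measurable_pi_iff.2 fun i => ?_
  unfold history
  by_cases h : i < k
  · simpa only [h, if_true] using measurable_cycleAt hD g₀ i
  · simpa only [h, if_false] using measurable_const

/-- The filtration generated by the cycles. -/
noncomputable def cycleFiltration (hD : MeasurableSet D) (g₀ : ℝ) :
    Filtration ℕ (inferInstance : MeasurableSpace Input) where
  seq k := MeasurableSpace.comap (history D g₀ k) inferInstance
  mono' := by
    intro k l hkl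
    have : history D g₀ k = (fun h i => if i < k then h i else 0) ∘ history D g₀ l := by
      ext1 s
      ext1 i
      by_cases h : i < k
      · simp [history, h, h.trans_le hkl]
      · simp [history, h]
    simp only
    rw [this, ← MeasurableSpace.comap_comp]
    refine MeasurableSpace.comap_mono (Measurable.comap_le (measurable_pi_iff.2 fun i => ?_))
    split_ifs
    · exact measurable_pi_apply i
    · exact measurable_const
  le' k := (measurable_history hD k).comap_le

theorem measurable_state_fst_filtration (hD : MeasurableSet D) (k : ℕ) :
    Measurable[cycleFiltration hD g₀ k] fun s => (state D g₀ s k).1 := by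
  simp only [← ageOfHistory_history]
  exact (measurable_ageOfHistory g₀ k).comp (comap_measurable _)

theorem measurable_cycleAt_filtration (hD : MeasurableSet D) (k : ℕ) :
    Measurable[cycleFiltration hD g₀ (k + 1)] fun s => cycleAt D g₀ s k := by
  have h : (fun s => cycleAt D g₀ s k) = (fun h => h k) ∘ history D g₀ (k + 1) := by
    ext1 s
    simp [history]
  rw [h]
  exact (measurable_pi_apply k).comp (comap_measurable _)

variable {r : ℝ} {ε τ : Measure ℝ} [IsProbabilityMeasure ε] [IsProbabilityMeasure τ]

/-- At every epoch, the input seen from there is a copy of the original input that is independent of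
the history. -/
theorem law_state_snd (hε : ε = expMeasure r) (hreg : ∀ᵐ s ∂(inputLaw ε τ), IsRegular s)
    (hD : MeasurableSet D) (k : ℕ) :
    (inputLaw ε τ).map (fun s => (state D g₀ s k).2) = inputLaw ε τ ∧
      IndepFun (history D g₀ k) (fun s => (state D g₀ s k).2) (inputLaw ε τ) := by
  induction k with
  | zero =>
    have h0 : history D g₀ 0 = fun _ _ => 0 := by
      ext1 s
      ext1 i
      simp [history]
    rw [h0]
    exact ⟨Measure.map_id, indepFun_const_left _ _⟩
  | succ k ih =>
    obtain ⟨hlaw, hind⟩ := ih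
    have hsm : ∀ k, Measurable fun s => (state D g₀ s k).2 := fun k =>
      (measurable_state hD g₀ k).snd
    have hHm := measurable_history (g₀ := g₀) hD k
    have hYm := measurable_cycleAt hD g₀ k
    -- independence of the present input from the history, with its law inserted
    have hmul : ∀ (H : Set (ℕ → ℝ × ℝ)) (S : Set Input), MeasurableSet H → MeasurableSet S →
        inputLaw ε τ {s | history D g₀ k s ∈ H ∧ (state D g₀ s k).2 ∈ S} =
          inputLaw ε τ (history D g₀ k ⁻¹' H) * inputLaw ε τ S := by
      intro H S hH hS
      have e : inputLaw ε τ S = inputLaw ε τ ((fun s => (state D g₀ s k).2) ⁻¹' S) := by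
        conv_lhs => rw [← hlaw, Measure.map_apply (hsm k) hS]
      rw [e]
      exact hind.measure_inter_preimage_eq_mul H S hH hS
    -- one of the two actions
    have haction : ∀ (Y : Input → ℝ × ℝ) (E : Set ℝ), Measurable Y → MeasurableSet E →
        (∀ g ∈ E, ∀ s, cycle D g s = Y s) →
        (∀ (B : Set (ℝ × ℝ)) (C : Set Input), MeasurableSet B → MeasurableSet C →
          inputLaw ε τ (Y ⁻¹' B ∩ {s | residual s (Y s).1 ∈ C}) =
            inputLaw ε τ (Y ⁻¹' B) * inputLaw ε τ C) →
        ∀ (H : Set (ℕ → ℝ × ℝ)) (B : Set (ℝ × ℝ)) (C : Set Input), MeasurableSet H →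
          MeasurableSet B → MeasurableSet C →
          inputLaw ε τ {s | (state D g₀ s k).1 ∈ E ∧ history D g₀ k s ∈ H ∧
            cycleAt D g₀ s k ∈ B ∧ (state D g₀ s (k + 1)).2 ∈ C} =
          inputLaw ε τ {s | (state D g₀ s k).1 ∈ E ∧ history D g₀ k s ∈ H ∧
            cycleAt D g₀ s k ∈ B} * inputLaw ε τ C := by
      intro Y E hYm' hE hYE hregen H B C hH hB hC
      have hH' : MeasurableSet (H ∩ ageOfHistory g₀ k ⁻¹' E) :=
        hH.inter (measurable_ageOfHistory g₀ k hE)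
      have hRm : Measurable fun s => residual s (Y s).1 := by
        have := measurable_residual.comp (measurable_id.prodMk hYm'.fst)
        rwa [Function.comp_def] at this
      have e1 : {s | (state D g₀ s k).1 ∈ E ∧ history D g₀ k s ∈ H ∧
          cycleAt D g₀ s k ∈ B ∧ (state D g₀ s (k + 1)).2 ∈ C} =
          {s | history D g₀ k s ∈ H ∩ ageOfHistory g₀ k ⁻¹' E ∧
            (state D g₀ s k).2 ∈ Y ⁻¹' B ∩ {s | residual s (Y s).1 ∈ C}} := by
        ext s
        simp only [Set.mem_ofPred_eq, Set.mem_inter_iff, Set.mem_preimage, ageOfHistory_history,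
          state_succ]
        constructor
        · rintro ⟨h1, h2, h3, h4⟩
          rw [cycleAt, hYE _ h1] at h3 h4
          exact ⟨⟨h2, h1⟩, h3, h4⟩
        · rintro ⟨⟨h2, h1⟩, h3, h4⟩
          rw [cycleAt, hYE _ h1]
          exact ⟨h1, h2, h3, h4⟩
      have e2 : {s | (state D g₀ s k).1 ∈ E ∧ history D g₀ k s ∈ H ∧ cycleAt D g₀ s k ∈ B} =
          {s | history D g₀ k s ∈ H ∩ ageOfHistory g₀ k ⁻¹' E ∧
            (state D g₀ s k).2 ∈ Y ⁻¹' B} := by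
        ext s
        simp only [Set.mem_ofPred_eq, Set.mem_inter_iff, Set.mem_preimage, ageOfHistory_history]
        constructor
        · rintro ⟨h1, h2, h3⟩
          rw [cycleAt, hYE _ h1] at h3
          exact ⟨⟨h2, h1⟩, h3⟩
        · rintro ⟨⟨h2, h1⟩, h3⟩
          rw [cycleAt, hYE _ h1]
          exact ⟨h1, h2, h3⟩
      have hBC : MeasurableSet (Y ⁻¹' B ∩ {s | residual s (Y s).1 ∈ C}) :=
        (hYm' hB).inter (hRm hC)
      rw [e1, e2, hmul _ _ hH' hBC, hmul _ _ hH' (hYm' hB),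
        hregen B C hB hC, mul_assoc]
    have hfac : ∀ (H : Set (ℕ → ℝ × ℝ)) (B : Set (ℝ × ℝ)) (C : Set Input), MeasurableSet H →
        MeasurableSet B → MeasurableSet C →
        inputLaw ε τ {s | history D g₀ k s ∈ H ∧ cycleAt D g₀ s k ∈ B ∧
          (state D g₀ s (k + 1)).2 ∈ C} =
        inputLaw ε τ {s | history D g₀ k s ∈ H ∧ cycleAt D g₀ s k ∈ B} * inputLaw ε τ C := by
      intro H B C hH hB hC
      have h1 := haction dopCycle D measurable_dopCycle hD (fun g hg s => if_pos hg)
        (fun B C hB hC => dopCycle_regeneration hε hreg hB hC) H B C hH hB hC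
      have h2 := haction dnpCycle Dᶜ measurable_dnpCycle hD.compl (fun g hg s => if_neg hg)
        (fun B C hB hC => dnpCycle_regeneration hε hreg hB hC) H B C hH hB hC
      have hGm : MeasurableSet {s | (state D g₀ s k).1 ∈ D} := (measurable_state hD g₀ k).fst hD
      rw [← measure_inter_add_sdiff {s | history D g₀ k s ∈ H ∧ cycleAt D g₀ s k ∈ B} hGm,
        ← measure_inter_add_sdiff {s | history D g₀ k s ∈ H ∧ cycleAt D g₀ s k ∈ B ∧
          (state D g₀ s (k + 1)).2 ∈ C} hGm, add_mul]
      refine congr_arg₂ _ ?_ ?_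
      · refine Eq.trans ?_ (h1.trans ?_)
        · congr 1
          ext s
          exact and_comm
        · congr 2
          ext s
          exact and_comm
      · refine Eq.trans ?_ (h2.trans ?_)
        · congr 1
          ext s
          exact and_comm
        · congr 2
          ext s
          exact and_comm
    have hlaw' : (inputLaw ε τ).map (fun s => (state D g₀ s (k + 1)).2) = inputLaw ε τ := by
      ext C hC
      have := hfac Set.univ Set.univ C MeasurableSet.univ MeasurableSet.univ hC
      simp only [Set.mem_univ, true_and, Set.ofPred_true, measure_univ, one_mul] at this
      rw [Measure.map_apply (hsm (k + 1)) hC]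
      exact this
    refine ⟨hlaw', ?_⟩
    have hpair : IndepFun (fun s => (history D g₀ k s, cycleAt D g₀ s k))
        (fun s => (state D g₀ s (k + 1)).2) (inputLaw ε τ) := by
      rw [indepFun_iff_map_prod_eq_prod_map_map (hHm.prodMk hYm).aemeasurable
        (hsm (k + 1)).aemeasurable, hlaw']
      refine Measure.ext_prod₃_iff'.2 fun {H B C} hH hB hC => ?_
      rw [Measure.map_apply ((hHm.prodMk hYm).prodMk (hsm (k + 1))) ((hH.prod hB).prod hC),
        Measure.prod_prod, Measure.map_apply (hHm.prodMk hYm) (hH.prod hB)]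
      refine Eq.trans ?_ (hfac H B C hH hB hC)
      congr 1
      ext s
      exact and_assoc
    have hup : Measurable fun q : (ℕ → ℝ × ℝ) × (ℝ × ℝ) => Function.update q.1 k q.2 := by
      refine measurable_pi_iff.2 fun i => ?_
      by_cases h : i = k
      · subst h
        simpa only [Function.update_self] using measurable_snd
      · simp only [Function.update_of_ne h]
        exact (measurable_pi_apply i).comp measurable_fst
    have hh : history D g₀ (k + 1) = (fun q : (ℕ → ℝ × ℝ) × (ℝ × ℝ) => Function.update q.1 k q.2) ∘
        fun s => (history D g₀ k s, cycleAt D g₀ s k) := by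
      ext1 s
      exact history_succ D g₀ k s
    rw [hh]
    exact hpair.comp (ψ := id) hup measurable_id

/-! ### Strong laws along the cycles -/

/-- The strong law for the cycles that start with an age in `E`, where all cycles follow `Y`. -/
theorem ae_tendsto_average_cycles (hε : ε = expMeasure r)
    (hreg : ∀ᵐ s ∂(inputLaw ε τ), IsRegular s) (hD : MeasurableSet D) {Y : Input → ℝ × ℝ}
    (hY : Measurable Y) {E : Set ℝ} (hE : MeasurableSet E)
    (hYE : ∀ g ∈ E, ∀ s, cycle D g s = Y s) {f : ℝ × ℝ → ℝ} (hf : Measurable f)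
    (hf0 : ∀ c, 0 ≤ f c) (hint : Integrable (fun s => f (Y s)) (inputLaw ε τ)) :
    ∀ᵐ s ∂(inputLaw ε τ), Tendsto (fun n : ℕ => (∑ k ∈ Finset.range n,
      E.indicator 1 (state D g₀ s k).1 *
        (f (cycleAt D g₀ s k) - ∫ x, f (Y x) ∂(inputLaw ε τ))) / n) atTop (𝓝 0) := by
  have hsm : ∀ k, Measurable fun s => (state D g₀ s k).2 := fun k =>
    (measurable_state hD g₀ k).snd
  have hlaw := fun k => law_state_snd (g₀ := g₀) hε hreg hD k
  have hfY : Measurable fun s => f (Y s) := hf.comp hY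
  have h := ae_tendsto_average_thinned (μ := inputLaw ε τ) (cycleFiltration hD g₀)
    (E := fun k => {s | (state D g₀ s k).1 ∈ E}) (Z := fun k s => f (Y (state D g₀ s k).2))
    (fun k => measurable_state_fst_filtration hD k hE) (fun k => hfY.comp (hsm k))
    (fun k s => hf0 _) (fun k => ?_) hint (fun k => ?_) (fun k => ?_)
  · filter_upwards [h] with s hs
    refine hs.congr fun n => ?_
    congr 1
    refine Finset.sum_congr rfl fun k _ => ?_
    by_cases hk : (state D g₀ s k).1 ∈ E
    · have h1 : s ∈ {s | (state D g₀ s k).1 ∈ E} := hk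
      rw [Set.indicator_of_mem hk, Set.indicator_of_mem h1, cycleAt, hYE _ hk]
      rfl
    · have h1 : s ∉ {s | (state D g₀ s k).1 ∈ E} := hk
      rw [Set.indicator_of_notMem hk, Set.indicator_of_notMem h1, zero_mul, zero_mul]
  · refine ⟨(hfY.comp (hsm k)).aemeasurable, (hfY.comp (hsm 0)).aemeasurable, ?_⟩
    have e : ∀ k, (inputLaw ε τ).map (fun s => f (Y (state D g₀ s k).2)) =
        (inputLaw ε τ).map (fun s => f (Y s)) := by
      intro k
      conv_rhs => rw [← (hlaw k).1, Measure.map_map hfY (hsm k)]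
      rfl
    rw [e k, e 0]
  · refine indep_of_indep_of_le_right ((IndepFun_iff_Indep _ _ _).1 (hlaw k).2) ?_
    exact (hfY.comp (comap_measurable _)).comap_le
  · have e : {s | (state D g₀ s k).1 ∈ E}.indicator (fun s => f (Y (state D g₀ s k).2)) =
        {s | (state D g₀ s k).1 ∈ E}.indicator (fun s => f (cycleAt D g₀ s k)) := by
      ext s
      by_cases hk : (state D g₀ s k).1 ∈ E
      · have h1 : s ∈ {s | (state D g₀ s k).1 ∈ E} := hk
        rw [Set.indicator_of_mem h1, Set.indicator_of_mem h1, cycleAt, hYE _ hk]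
      · have h1 : s ∉ {s | (state D g₀ s k).1 ∈ E} := hk
        rw [Set.indicator_of_notMem h1, Set.indicator_of_notMem h1]
    rw [e]
    refine Measurable.indicator (hf.comp (measurable_cycleAt_filtration hD k)) ?_
    exact (cycleFiltration hD g₀).mono k.le_succ _ (measurable_state_fst_filtration hD k hE)

/-- The product of the initial age and the length of a cycle: on average the length may be replaced
by its mean, since it is independent of the initial age. -/
theorem ae_tendsto_average_age_mul_cycles (hε : ε = expMeasure r)
    (hreg : ∀ᵐ s ∂(inputLaw ε τ), IsRegular s) (hD : MeasurableSet D)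
    (ho : MemLp (fun s => (dopCycle s).2) 2 (inputLaw ε τ))
    (hn : MemLp (fun s => (dnpCycle s).2) 2 (inputLaw ε τ)) {Y : Input → ℝ × ℝ}
    (hY : Measurable Y) {E : Set ℝ} (hE : MeasurableSet E)
    (hYE : ∀ g ∈ E, ∀ s, cycle D g s = Y s)
    (hY2 : MemLp (fun s => (Y s).1) 2 (inputLaw ε τ)) :
    ∀ᵐ s ∂(inputLaw ε τ), Tendsto (fun n : ℕ => (∑ k ∈ Finset.range n,
      E.indicator id (state D g₀ s k).1 *
        ((cycleAt D g₀ s k).1 - ∫ x, (Y x).1 ∂(inputLaw ε τ))) / n) atTop (𝓝 0) := by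
  have hsm : ∀ k, Measurable fun s => (state D g₀ s k).2 := fun k =>
    (measurable_state hD g₀ k).snd
  have hlaw := fun k => law_state_snd (g₀ := g₀) hε hreg hD k
  set d := ∫ x, (Y x).1 ∂(inputLaw ε τ) with hd
  have hYi : Integrable (fun s => (Y s).1) (inputLaw ε τ) := hY2.integrable (by norm_num)
  have hpres : ∀ k, MeasurePreserving (fun s => (state D g₀ s k).2) (inputLaw ε τ)
      (inputLaw ε τ) := fun k => ⟨hsm k, (hlaw k).1⟩
  have hZ2' : MemLp (fun s => (Y s).1 - d) 2 (inputLaw ε τ) := hY2.sub (memLp_const _)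
  have hVm : ∀ k, Measurable[cycleFiltration hD g₀ k]
      (fun s => E.indicator id (state D g₀ s k).1) := fun k =>
    (measurable_id.indicator hE).comp (measurable_state_fst_filtration hD k)
  have hVm' : ∀ k, Measurable (fun s => E.indicator id (state D g₀ s k).1) := fun k =>
    (hVm k).mono ((cycleFiltration hD g₀).le k) le_rfl
  set c := g₀ ^ 2 + (∫ x, (dopCycle x).2 ^ 2 ∂(inputLaw ε τ) +
    ∫ x, (dnpCycle x).2 ^ 2 ∂(inputLaw ε τ)) with hc
  have ho0 : 0 ≤ ∫ x, (dopCycle x).2 ^ 2 ∂(inputLaw ε τ) := integral_nonneg fun _ => sq_nonneg _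
  have hn0 : 0 ≤ ∫ x, (dnpCycle x).2 ^ 2 ∂(inputLaw ε τ) := integral_nonneg fun _ => sq_nonneg _
  have hc0 : 0 ≤ c := by positivity
  have hind_le : ∀ x : ℝ, E.indicator id x ^ 2 ≤ x ^ 2 := by
    intro x
    by_cases hx : x ∈ E
    · simp [hx]
    · simp [hx, sq_nonneg]
  have hV : ∀ k, MemLp (fun s => E.indicator id (state D g₀ s k).1) 2 (inputLaw ε τ) ∧
      ∫ s, E.indicator id (state D g₀ s k).1 ^ 2 ∂(inputLaw ε τ) ≤ c := by
    intro k
    rw [memLp_two_iff_integrable_sq (hVm' k).aestronglyMeasurable]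
    have hsq : ∀ k, AEStronglyMeasurable (fun s => E.indicator id (state D g₀ s k).1 ^ 2)
      (inputLaw ε τ) := fun k => ((hVm' k).pow_const 2).aestronglyMeasurable
    rcases k with _ | k
    · have hle : ∀ s, E.indicator id (state D g₀ s 0).1 ^ 2 ≤ g₀ ^ 2 := fun s => hind_le _
      have hi : Integrable (fun s => E.indicator id (state D g₀ s 0).1 ^ 2) (inputLaw ε τ) :=
        (integrable_const (g₀ ^ 2)).mono' (hsq 0) (Eventually.of_forall fun s => by
          rw [Real.norm_of_nonneg (sq_nonneg _)]
          exact hle s)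
      refine ⟨hi, (integral_mono hi (integrable_const _) hle).trans ?_⟩
      simp only [integral_const, probReal_univ, one_smul, hc]
      linarith
    · have hle : ∀ s, E.indicator id (state D g₀ s (k + 1)).1 ^ 2 ≤
          (dopCycle (state D g₀ s k).2).2 ^ 2 + (dnpCycle (state D g₀ s k).2).2 ^ 2 := by
        intro s
        refine (hind_le _).trans ?_
        simp only [state_succ, cycleAt, cycle]
        split_ifs
        · exact le_add_of_nonneg_right (sq_nonneg _)
        · exact le_add_of_nonneg_left (sq_nonneg _)
      have hi1 : Integrable (fun s => (dopCycle (state D g₀ s k).2).2 ^ 2) (inputLaw ε τ) :=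
        (hpres k).integrable_comp_of_integrable ho.integrable_sq
      have hi2 : Integrable (fun s => (dnpCycle (state D g₀ s k).2).2 ^ 2) (inputLaw ε τ) :=
        (hpres k).integrable_comp_of_integrable hn.integrable_sq
      have hi3 : Integrable (fun s => (dopCycle (state D g₀ s k).2).2 ^ 2 +
        (dnpCycle (state D g₀ s k).2).2 ^ 2) (inputLaw ε τ) := hi1.add hi2
      have hi : Integrable (fun s => E.indicator id (state D g₀ s (k + 1)).1 ^ 2)
          (inputLaw ε τ) :=
        hi3.mono' (hsq (k + 1)) (Eventually.of_forall fun s => by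
          rw [Real.norm_of_nonneg (sq_nonneg _)]
          exact hle s)
      refine ⟨hi, (integral_mono hi hi3 hle).trans ?_⟩
      have e1 : ∫ s, (dopCycle (state D g₀ s k).2).2 ^ 2 ∂(inputLaw ε τ) =
          ∫ x, (dopCycle x).2 ^ 2 ∂(inputLaw ε τ) := by
        conv_rhs => rw [← (hlaw k).1]
        rw [integral_map (hsm k).aemeasurable
          (measurable_dopCycle.snd.pow_const 2).aestronglyMeasurable]
      have e2 : ∫ s, (dnpCycle (state D g₀ s k).2).2 ^ 2 ∂(inputLaw ε τ) =
          ∫ x, (dnpCycle x).2 ^ 2 ∂(inputLaw ε τ) := by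
        conv_rhs => rw [← (hlaw k).1]
        rw [integral_map (hsm k).aemeasurable
          (measurable_dnpCycle.snd.pow_const 2).aestronglyMeasurable]
      rw [integral_add hi1 hi2, e1, e2, hc]
      linarith [sq_nonneg g₀]
  have hZsq : ∀ k, ∫ s, ((Y (state D g₀ s k).2).1 - d) ^ 2 ∂(inputLaw ε τ) =
      ∫ x, ((Y x).1 - d) ^ 2 ∂(inputLaw ε τ) := by
    intro k
    conv_rhs => rw [← (hlaw k).1]
    rw [integral_map (hsm k).aemeasurable
      ((hY.fst.sub_const d).pow_const 2).aestronglyMeasurable]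
  have hsumm : Summable fun k : ℕ => 1 / ((k : ℝ) + 1) ^ 2 := by
    have := (summable_nat_add_iff 1).2 (Real.summable_one_div_nat_pow.2 one_lt_two)
    simpa using this
  set v := ∫ x, ((Y x).1 - d) ^ 2 ∂(inputLaw ε τ) with hv
  have hv0 : 0 ≤ v := integral_nonneg fun _ => sq_nonneg _
  have h := ae_tendsto_average_predictable_mul (μ := inputLaw ε τ) (cycleFiltration hD g₀)
    (V := fun k s => E.indicator id (state D g₀ s k).1)
    (Z := fun k s => (Y (state D g₀ s k).2).1 - d)
    (C := c * v * ∑' k : ℕ, 1 / ((k : ℝ) + 1) ^ 2)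
    (fun k => (hVm k).stronglyMeasurable) (fun k => (hV k).1)
    (fun k => (hY.fst.sub_const d).comp (hsm k))
    (fun k => hZ2'.comp_measurePreserving (hpres k)) (fun k => ?_) (fun k => ?_) (fun k => ?_)
    (fun n => ?_)
  · filter_upwards [h] with s hs
    refine hs.congr fun n => ?_
    congr 1
    refine Finset.sum_congr rfl fun k _ => ?_
    by_cases hk : (state D g₀ s k).1 ∈ E
    · rw [cycleAt, hYE _ hk]
    · rw [Set.indicator_of_notMem hk, zero_mul, zero_mul]
  · have := integral_map (μ := inputLaw ε τ) (hsm k).aemeasurable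
      (f := fun s => (Y s).1 - d) (hY.fst.sub_const d).aestronglyMeasurable
    rw [(hlaw k).1] at this
    rw [← this, integral_sub hYi (integrable_const _)]
    simp [hd]
  · refine indep_of_indep_of_le_right ((IndepFun_iff_Indep _ _ _).1 (hlaw k).2) ?_
    exact ((hY.fst.sub_const d).comp (comap_measurable _)).comap_le
  · have e : (fun s => E.indicator id (state D g₀ s k).1 * ((Y (state D g₀ s k).2).1 - d)) =
        fun s => E.indicator id (state D g₀ s k).1 * ((cycleAt D g₀ s k).1 - d) := by
      ext s
      by_cases hk : (state D g₀ s k).1 ∈ E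
      · rw [cycleAt, hYE _ hk]
      · rw [Set.indicator_of_notMem hk, zero_mul, zero_mul]
    rw [e]
    refine Measurable.stronglyMeasurable (Measurable.mul ?_ ?_)
    · exact (hVm k).mono ((cycleFiltration hD g₀).mono k.le_succ) le_rfl
    · exact (measurable_cycleAt_filtration hD k).fst.sub_const d
  · calc _ ≤ ∑ k ∈ Finset.range n, c * v * (1 / ((k : ℝ) + 1) ^ 2) := by
          refine Finset.sum_le_sum fun k _ => ?_
          rw [hZsq k, mul_one_div]
          gcongr
          exact (hV k).2
      _ = c * v * ∑ k ∈ Finset.range n, 1 / ((k : ℝ) + 1) ^ 2 := by rw [Finset.mul_sum]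
      _ ≤ _ := by
          refine mul_le_mul_of_nonneg_left ?_ (mul_nonneg hc0 hv0)
          exact hsumm.sum_le_tsum _ fun k _ => by positivity

end History

/-! ### The time average of the age along a regular input -/

namespace IsRegular

variable {s : Input} {D : Set ℝ} {g₀ : ℝ}

theorem strictMono_epoch (hs : IsRegular s) :
    StrictMono fun k => (epoch D (gaps s) (transfers s) g₀ k).1 :=
  strictMono_nat_of_lt_succ fun k => by
    rw [hs.epoch_fst_succ]
    have : 0 < (cycleAt D g₀ s k).1 := (hs.state_snd D g₀ k).cycle_fst_pos D _
    linarith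

theorem state_fst_nonneg (hs : IsRegular s) (hg : 0 ≤ g₀) (k : ℕ) :
    0 ≤ (state D g₀ s k).1 := by
  rcases k with _ | k
  · exact hg
  · rw [state_succ]
    exact (hs.state_snd D g₀ k).cycle_snd_nonneg D _

theorem state_fst (hs : IsRegular s) (k : ℕ) : (state D g₀ s k).1 =
    (epoch D (gaps s) (transfers s) g₀ k).1 - (epoch D (gaps s) (transfers s) g₀ k).2 := by
  rw [hs.state_eq]

theorem lastDelivery_eq (hs : IsRegular s) {t : ℝ} {k : ℕ}
    (h1 : (epoch D (gaps s) (transfers s) g₀ k).1 ≤ t)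
    (h2 : t < (epoch D (gaps s) (transfers s) g₀ (k + 1)).1) :
    lastDelivery D (gaps s) (transfers s) g₀ t = k := by
  have : {k | (epoch D (gaps s) (transfers s) g₀ k).1 ≤ t} = Set.Iic k := by
    ext n
    have hm := hs.strictMono_epoch (D := D) (g₀ := g₀)
    constructor
    · intro hn
      by_contra hlt
      have h3 : k + 1 ≤ n := Nat.succ_le_of_lt (not_le.1 (show ¬ n ≤ k from hlt))
      exact absurd (lt_of_lt_of_le h2 (hm.monotone h3)) (not_lt.2 hn)
    · intro hn
      exact (hm.monotone hn).trans h1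
  rw [lastDelivery, this, csSup_Iic]

theorem age_eq (hs : IsRegular s) {t : ℝ} {k : ℕ}
    (h1 : (epoch D (gaps s) (transfers s) g₀ k).1 ≤ t)
    (h2 : t < (epoch D (gaps s) (transfers s) g₀ (k + 1)).1) :
    age D (gaps s) (transfers s) g₀ t = t - (epoch D (gaps s) (transfers s) g₀ k).2 := by
  rw [age, hs.lastDelivery_eq h1 h2]

theorem age_of_neg (hs : IsRegular s) {t : ℝ} (ht : t < 0) :
    age D (gaps s) (transfers s) g₀ t = t + g₀ := by
  have : {k | (epoch D (gaps s) (transfers s) g₀ k).1 ≤ t} = ∅ := by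
    ext k
    have h := hs.strictMono_epoch (D := D) (g₀ := g₀).monotone (Nat.zero_le k)
    simp only [Set.mem_ofPred_eq, Set.mem_empty_iff_false, iff_false, not_le]
    exact lt_of_lt_of_le ht h
  rw [age, lastDelivery, this]
  simp [epoch]

theorem intervalIntegrable_age_cycle (hs : IsRegular s) (k : ℕ) :
    IntervalIntegrable (age D (gaps s) (transfers s) g₀) volume
      (epoch D (gaps s) (transfers s) g₀ k).1 (epoch D (gaps s) (transfers s) g₀ (k + 1)).1 := by
  have hlt : (epoch D (gaps s) (transfers s) g₀ k).1 <
    (epoch D (gaps s) (transfers s) g₀ (k + 1)).1 := hs.strictMono_epoch (Nat.lt_succ_self k)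
  refine IntervalIntegrable.congr_uIoo
    (f := fun t => t - (epoch D (gaps s) (transfers s) g₀ k).2)
    (Continuous.intervalIntegrable (by fun_prop) _ _) (fun t ht => ?_)
  rw [Set.uIoo_of_lt hlt] at ht
  exact (hs.age_eq ht.1.le ht.2).symm

/-- The area under the age during the `k`-th cycle. -/
theorem integral_age_cycle (hs : IsRegular s) (k : ℕ) :
    ∫ t in (epoch D (gaps s) (transfers s) g₀ k).1..(epoch D (gaps s) (transfers s) g₀ (k + 1)).1,
      age D (gaps s) (transfers s) g₀ t =
    (state D g₀ s k).1 * (cycleAt D g₀ s k).1 + (cycleAt D g₀ s k).1 ^ 2 / 2 := by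
  have hlt : (epoch D (gaps s) (transfers s) g₀ k).1 <
    (epoch D (gaps s) (transfers s) g₀ (k + 1)).1 := hs.strictMono_epoch (Nat.lt_succ_self k)
  rw [intervalIntegral.integral_congr_uIoo
    (g := fun t => t - (epoch D (gaps s) (transfers s) g₀ k).2) (fun t ht => by
      rw [Set.uIoo_of_lt hlt] at ht
      exact hs.age_eq ht.1.le ht.2)]
  rw [intervalIntegral.integral_sub (by simp) (by simp), integral_id,
    intervalIntegral.integral_const, hs.state_fst, hs.epoch_fst_succ, smul_eq_mul]
  ring

/-- If the lengths of the cycles and the areas under the age have averages `d` and `q` per cycle,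
then the age has time average `q / d`. -/
theorem tendsto_average_age (hs : IsRegular s) (hg : 0 ≤ g₀) {d q : ℝ} (hd : 0 < d)
    (hL : Tendsto (fun n : ℕ => (∑ k ∈ Finset.range n, (cycleAt D g₀ s k).1) / n) atTop (𝓝 d))
    (hQ : Tendsto (fun n : ℕ => (∑ k ∈ Finset.range n, ((state D g₀ s k).1 * (cycleAt D g₀ s k).1 +
      (cycleAt D g₀ s k).1 ^ 2 / 2)) / (n : ℝ)) atTop (𝓝 q)) :
    (∀ t : ℝ, IntervalIntegrable (age D (gaps s) (transfers s) g₀) volume 0 t) ∧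
    Tendsto (fun t : ℝ => (∫ x in (0 : ℝ)..t, age D (gaps s) (transfers s) g₀ x) / t) atTop
      (𝓝 (q / d)) := by
  set R : ℕ → ℝ := fun k => (epoch D (gaps s) (transfers s) g₀ k).1 with hR
  set a : ℝ → ℝ := age D (gaps s) (transfers s) g₀ with ha
  set A : ℕ → ℝ := fun n => ∑ k ∈ Finset.range n, ((state D g₀ s k).1 * (cycleAt D g₀ s k).1 +
      (cycleAt D g₀ s k).1 ^ 2 / 2) with hA
  have hR0 : R 0 = 0 := rfl
  have hRmono : StrictMono R := hs.strictMono_epoch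
  have hRsum : ∀ n, ∑ k ∈ Finset.range n, (cycleAt D g₀ s k).1 = R n := by
    intro n
    induction n with
    | zero => simp [hR0]
    | succ n ih => exact (Finset.sum_range_succ _ n).trans (ih ▸ (hs.epoch_fst_succ D g₀ n).symm)
  simp only [hRsum] at hL
  have hRtop : Tendsto R atTop atTop := by
    refine (hL.pos_mul_atTop hd tendsto_natCast_atTop_atTop).congr' ?_
    filter_upwards [eventually_gt_atTop 0] with n hn
    rw [div_mul_cancel₀]
    positivity
  have hint : ∀ k, IntervalIntegrable a volume (R k) (R (k + 1)) :=
    hs.intervalIntegrable_age_cycle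
  have hint0 : ∀ n, IntervalIntegrable a volume 0 (R n) := fun n => by
    have := IntervalIntegrable.trans_iterate (a := R) (n := n) fun k _ => hint k
    rwa [hR0] at this
  have hintA : ∀ n, ∫ x in (0 : ℝ)..R n, a x = A n := by
    intro n
    have := intervalIntegral.sum_integral_adjacent_intervals (a := R) (n := n) fun k _ => hint k
    rw [hR0] at this
    rw [← this]
    exact Finset.sum_congr rfl fun k _ => hs.integral_age_cycle k
  have hfind : ∀ t, 0 ≤ t → ∃ n, R n ≤ t ∧ t < R (n + 1) := by
    intro t ht
    have hex : ∃ n, t < R n := (hRtop.eventually_gt_atTop t).exists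
    classical
    have hpos : Nat.find hex ≠ 0 := by
      intro h0
      have := Nat.find_spec hex
      rw [h0, hR0] at this
      linarith
    obtain ⟨m, hm⟩ := Nat.exists_eq_succ_of_ne_zero hpos
    refine ⟨m, not_lt.1 (Nat.find_min hex (by omega)), ?_⟩
    have := Nat.find_spec hex
    rwa [hm] at this
  have hnn : ∀ t, 0 ≤ t → 0 ≤ a t := by
    intro t ht
    obtain ⟨n, h1, h2⟩ := hfind t ht
    rw [ha, hs.age_eq h1 h2]
    have := hs.state_fst_nonneg (D := D) hg n
    rw [hs.state_fst] at this
    linarith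
  have hinteg : ∀ t : ℝ, IntervalIntegrable a volume 0 t := by
    intro t
    rcases le_or_gt 0 t with ht | ht
    · obtain ⟨n, h1, h2⟩ := hfind t ht
      refine (hint0 (n + 1)).mono_set ?_
      rw [Set.uIcc_of_le ht, Set.uIcc_of_le (ht.trans h2.le)]
      exact Set.Icc_subset_Icc_right h2.le
    · refine IntervalIntegrable.congr_uIoo (f := fun x => x + g₀)
        (Continuous.intervalIntegrable (by fun_prop) _ _) (fun x hx => ?_)
      rw [Set.uIoo_of_gt ht] at hx
      exact (hs.age_of_neg hx.2).symm
  refine ⟨hinteg, ?_⟩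
  set n : ℝ → ℕ := fun t => lastDelivery D (gaps s) (transfers s) g₀ t with hn
  have hnspec : ∀ t, 0 ≤ t → R (n t) ≤ t ∧ t < R (n t + 1) := by
    intro t ht
    obtain ⟨m, h1, h2⟩ := hfind t ht
    have : n t = m := hs.lastDelivery_eq h1 h2
    rw [this]
    exact ⟨h1, h2⟩
  have hntop : Tendsto n atTop atTop := by
    refine tendsto_atTop.2 fun N => ?_
    filter_upwards [eventually_ge_atTop (R N), eventually_ge_atTop 0] with t ht ht0
    by_contra hlt
    have h1 := (hnspec t ht0).2
    have h2 : R (n t + 1) ≤ R N := hRmono.monotone (not_le.1 hlt)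
    linarith
  have hratio : Tendsto (fun n : ℕ => ((n : ℝ) + 1) / n) atTop (𝓝 1) := by
    have := (tendsto_const_nhds (x := (1 : ℝ))).add tendsto_one_div_atTop_nhds_zero_nat
    rw [add_zero] at this
    refine this.congr' ?_
    filter_upwards [eventually_gt_atTop 0] with n hn
    have : (n : ℝ) ≠ 0 := by positivity
    field_simp
  have hL1 := hL.comp (tendsto_add_atTop_nat 1)
  replace hQ : Tendsto (fun n : ℕ => A n / (n : ℝ)) atTop (𝓝 q) := hQ
  have hQ1 := hQ.comp (tendsto_add_atTop_nat 1)
  -- up to time `t` there are `n t` complete cycles, and the area is monotone in time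
  have hlow : Tendsto (fun n : ℕ => A n / R (n + 1)) atTop (𝓝 (q / d)) := by
    have := hQ.div (hL1.mul hratio) (by simpa using hd.ne')
    rw [mul_one] at this
    refine this.congr' ?_
    filter_upwards [eventually_gt_atTop 0] with n hn
    have h1 : (n : ℝ) ≠ 0 := by positivity
    have h2 : (n : ℝ) + 1 ≠ 0 := by positivity
    simp only [Function.comp_apply, Pi.div_apply]
    push_cast
    field_simp
  have hup : Tendsto (fun n : ℕ => A (n + 1) / R n) atTop (𝓝 (q / d)) := by
    have := (hQ1.mul hratio).div hL hd.ne'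
    rw [mul_one] at this
    refine this.congr' ?_
    filter_upwards [eventually_gt_atTop 0] with n hn
    have h1 : (n : ℝ) ≠ 0 := by positivity
    have h2 : (n : ℝ) + 1 ≠ 0 := by positivity
    simp only [Function.comp_apply, Pi.div_apply]
    push_cast
    field_simp
  have hmonoF : ∀ t t', 0 ≤ t → t ≤ t' → ∫ x in (0 : ℝ)..t, a x ≤ ∫ x in (0 : ℝ)..t', a x := by
    intro t t' ht htt'
    refine intervalIntegral.integral_mono_interval le_rfl ht htt' ?_ (hinteg t')
    refine (ae_restrict_iff' measurableSet_Ioc).2 (Eventually.of_forall fun x hx => ?_)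
    exact hnn x hx.1.le
  refine tendsto_of_tendsto_of_tendsto_of_le_of_le' (hlow.comp hntop) (hup.comp hntop) ?_ ?_
  · filter_upwards [eventually_gt_atTop 0] with t ht
    obtain ⟨h1, h2⟩ := hnspec t ht.le
    have h3 : 0 ≤ R (n t) := hR0 ▸ hRmono.monotone (Nat.zero_le _)
    have h4 : A (n t) ≤ ∫ x in (0 : ℝ)..t, a x := hintA (n t) ▸ hmonoF _ _ h3 h1
    have h5 : 0 ≤ ∫ x in (0 : ℝ)..t, a x :=
      intervalIntegral.integral_nonneg ht.le fun x hx => hnn x hx.1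
    exact div_le_div₀ h5 h4 ht h2.le
  · filter_upwards [eventually_gt_atTop 0, eventually_ge_atTop (R 1)] with t ht ht1
    obtain ⟨h1, h2⟩ := hnspec t ht.le
    have h3 : 0 < R (n t) := by
      rw [← hR0]
      refine hRmono (Nat.pos_of_ne_zero fun h0 => ?_)
      rw [h0] at h2
      simp only [zero_add] at h2
      linarith
    have h4 : ∫ x in (0 : ℝ)..t, a x ≤ A (n t + 1) := hintA (n t + 1) ▸ hmonoF _ _ ht.le h2.le
    have h5 : 0 ≤ ∫ x in (0 : ℝ)..t, a x :=
      intervalIntegral.integral_nonneg ht.le fun x hx => hnn x hx.1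
    exact div_le_div₀ (h5.trans h4) h4 h3 h1

end IsRegular

/-! ### The average age of a policy -/

section AverageAge

/-- Mean length of a cycle that follows `Y`. -/
noncomputable def meanLength (ν : Measure Input) (Y : Input → ℝ × ℝ) : ℝ := ∫ s, (Y s).1 ∂ν

/-- Second moment of the length of a cycle that follows `Y`. -/
noncomputable def secondMomentLength (ν : Measure Input) (Y : Input → ℝ × ℝ) : ℝ :=
  ∫ s, (Y s).1 ^ 2 ∂ν

/-- Probability that a cycle that follows `Y` ends with an age in `D`. -/
noncomputable def probAge (ν : Measure Input) (Y : Input → ℝ × ℝ) (D : Set ℝ) : ℝ :=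
  ∫ s, D.indicator 1 (Y s).2 ∂ν

/-- Contribution of the set `D` to the mean age at the end of a cycle that follows `Y`. -/
noncomputable def meanAge (ν : Measure Input) (Y : Input → ℝ × ℝ) (D : Set ℝ) : ℝ :=
  ∫ s, D.indicator id (Y s).2 ∂ν

/-- Long-run fraction of the cycles in which old packets are dropped: the stationary probability of
the two-state Markov chain that records the action. -/
noncomputable def dopFrequency (ν : Measure Input) (D : Set ℝ) : ℝ :=
  probAge ν dnpCycle D / (1 - probAge ν dopCycle D + probAge ν dnpCycle D)

/-- Mean area under the age in a cycle, in the stationary regime of the policy `D`, divided by the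
mean length of a cycle. -/
noncomputable def averageAge (ν : Measure Input) (D : Set ℝ) : ℝ :=
  (meanLength ν dopCycle * (dopFrequency ν D * meanAge ν dopCycle D +
      (1 - dopFrequency ν D) * meanAge ν dnpCycle D) +
    meanLength ν dnpCycle * (dopFrequency ν D * meanAge ν dopCycle Dᶜ +
      (1 - dopFrequency ν D) * meanAge ν dnpCycle Dᶜ) +
    (dopFrequency ν D * secondMomentLength ν dopCycle +
      (1 - dopFrequency ν D) * secondMomentLength ν dnpCycle) / 2) /
  (dopFrequency ν D * meanLength ν dopCycle + (1 - dopFrequency ν D) * meanLength ν dnpCycle)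

theorem tendsto_average_of_tendsto_average_succ {V : ℕ → ℝ} {l : ℝ}
    (h : Tendsto (fun n : ℕ => (∑ k ∈ Finset.range n, V (k + 1)) / (n : ℝ)) atTop (𝓝 l)) :
    Tendsto (fun n : ℕ => (∑ k ∈ Finset.range n, V k) / (n : ℝ)) atTop (𝓝 l) := by
  rw [← tendsto_add_atTop_iff_nat 1]
  have h1 : Tendsto (fun n : ℕ => V 0 * (1 / ((n : ℝ) + 1))) atTop (𝓝 (V 0 * 0)) :=
    tendsto_one_div_add_atTop_nhds_zero_nat.const_mul _
  have h2 : Tendsto (fun n : ℕ => 1 - 1 / ((n : ℝ) + 1)) atTop (𝓝 (1 - 0)) :=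
    tendsto_const_nhds.sub tendsto_one_div_add_atTop_nhds_zero_nat
  have := h1.add (h.mul h2)
  rw [mul_zero, sub_zero, mul_one, zero_add] at this
  refine this.congr' ?_
  filter_upwards [eventually_gt_atTop 0] with n hn
  have hn' : (n : ℝ) ≠ 0 := by positivity
  rw [Finset.sum_range_succ']
  push_cast
  field_simp
  ring

theorem indicator_compl_one (D : Set ℝ) (x : ℝ) :
    Dᶜ.indicator (1 : ℝ → ℝ) x = 1 - D.indicator 1 x := by
  by_cases hx : x ∈ D <;> simp [hx]

theorem indicator_add_indicator_compl_id (D : Set ℝ) (x : ℝ) :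
    D.indicator id x + Dᶜ.indicator id x = x := by
  by_cases hx : x ∈ D <;> simp [hx]

variable {D : Set ℝ} {g₀ r : ℝ} {ε τ : Measure ℝ} [IsProbabilityMeasure ε] [IsProbabilityMeasure τ]

/-- On average, a function of the cycles may be replaced by its mean given the action. -/
theorem ae_tendsto_average_sub_mean (hε : ε = expMeasure r)
    (hreg : ∀ᵐ s ∂(inputLaw ε τ), IsRegular s) (hD : MeasurableSet D) {f : ℝ × ℝ → ℝ}
    (hf : Measurable f) (hf0 : ∀ c, 0 ≤ f c)
    (ho : Integrable (fun s => f (dopCycle s)) (inputLaw ε τ))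
    (hn : Integrable (fun s => f (dnpCycle s)) (inputLaw ε τ)) :
    ∀ᵐ s ∂(inputLaw ε τ), Tendsto (fun n : ℕ => (∑ k ∈ Finset.range n, (f (cycleAt D g₀ s k) -
      ((∫ x, f (dopCycle x) ∂(inputLaw ε τ)) * D.indicator 1 (state D g₀ s k).1 +
        (∫ x, f (dnpCycle x) ∂(inputLaw ε τ)) * (1 - D.indicator 1 (state D g₀ s k).1)))) / (n : ℝ))
      atTop (𝓝 0) := by
  filter_upwards [ae_tendsto_average_cycles (g₀ := g₀) hε hreg hD measurable_dopCycle hD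
      (fun g hg s => if_pos hg) hf hf0 ho,
    ae_tendsto_average_cycles (g₀ := g₀) hε hreg hD measurable_dnpCycle hD.compl
      (fun g hg s => if_neg hg) hf hf0 hn] with s h1 h2
  have h := h1.add h2
  rw [add_zero] at h
  refine h.congr fun n => ?_
  rw [← add_div, ← Finset.sum_add_distrib]
  congr 1
  refine Finset.sum_congr rfl fun k _ => ?_
  rw [indicator_compl_one]
  ring

theorem tendsto_average_of_frequency {w x : ℕ → ℝ} {a b p : ℝ}
    (h : Tendsto (fun n : ℕ => (∑ k ∈ Finset.range n, (x k - (a * w k + b * (1 - w k)))) / (n : ℝ))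
      atTop (𝓝 0))
    (hw : Tendsto (fun n : ℕ => (∑ k ∈ Finset.range n, w k) / (n : ℝ)) atTop (𝓝 p)) :
    Tendsto (fun n : ℕ => (∑ k ∈ Finset.range n, x k) / (n : ℝ)) atTop
      (𝓝 (p * a + (1 - p) * b)) := by
  have h1 := h.add ((hw.const_mul (a - b)).add_const b)
  have e : 0 + ((a - b) * p + b) = p * a + (1 - p) * b := by ring
  rw [e] at h1
  refine h1.congr' ?_
  filter_upwards [eventually_gt_atTop 0] with n hn
  have hn' : (n : ℝ) ≠ 0 := by positivity
  have e2 : ∑ k ∈ Finset.range n, (x k - (a * w k + b * (1 - w k))) =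
      ∑ k ∈ Finset.range n, x k - (a - b) * ∑ k ∈ Finset.range n, w k - n * b := by
    rw [Finset.mul_sum, ← Finset.sum_sub_distrib]
    have : (n : ℝ) * b = ∑ k ∈ Finset.range n, b := by simp
    rw [this, ← Finset.sum_sub_distrib]
    refine Finset.sum_congr rfl fun k _ => ?_
    ring
  rw [e2]
  field_simp
  ring

/-- The time average of the age under the policy `D` almost surely converges to
`averageAge`. The number of cycles of each kind obeys the balance equation of the two-state chain,
and the rest follows from the strong laws along the cycles. -/
theorem ae_tendsto_average_age (hε : ε = expMeasure r)
    (hreg : ∀ᵐ s ∂(inputLaw ε τ), IsRegular s) (hD : MeasurableSet D)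
    (ho : MemLp (fun s => (dopCycle s).1) 2 (inputLaw ε τ))
    (hn : MemLp (fun s => (dnpCycle s).1) 2 (inputLaw ε τ))
    (ho' : MemLp (fun s => (dopCycle s).2) 2 (inputLaw ε τ))
    (hn' : MemLp (fun s => (dnpCycle s).2) 2 (inputLaw ε τ))
    (hq : 0 < 1 - probAge (inputLaw ε τ) dopCycle D + probAge (inputLaw ε τ) dnpCycle D)
    (hd : 0 < dopFrequency (inputLaw ε τ) D * meanLength (inputLaw ε τ) dopCycle +
      (1 - dopFrequency (inputLaw ε τ) D) * meanLength (inputLaw ε τ) dnpCycle) (hg : 0 ≤ g₀) :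
    ∀ᵐ s ∂(inputLaw ε τ),
      (∀ t : ℝ, IntervalIntegrable (age D (gaps s) (transfers s) g₀) volume 0 t) ∧
      Tendsto (fun t : ℝ => (∫ x in (0 : ℝ)..t, age D (gaps s) (transfers s) g₀ x) / t) atTop
        (𝓝 (averageAge (inputLaw ε τ) D)) := by
  set ν := inputLaw ε τ with hν
  set p := dopFrequency ν D with hp
  have hindm : ∀ E : Set ℝ, MeasurableSet E →
      Measurable fun c : ℝ × ℝ => E.indicator (1 : ℝ → ℝ) c.2 := fun E hE =>
    (measurable_one.indicator hE).comp measurable_snd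
  have hindm' : ∀ E : Set ℝ, MeasurableSet E →
      Measurable fun c : ℝ × ℝ => |E.indicator id c.2| := fun E hE =>
    ((measurable_id.indicator hE).comp measurable_snd).norm
  have hind_int : ∀ Y : Input → ℝ × ℝ, Measurable Y →
      Integrable (fun s => D.indicator (1 : ℝ → ℝ) (Y s).2) ν := by
    intro Y hY
    refine (integrable_const (1 : ℝ)).mono' ((hindm D hD).comp hY).aestronglyMeasurable
      (Eventually.of_forall fun s => ?_)
    by_cases h : (Y s).2 ∈ D <;> simp [h]
  have hage_int : ∀ (Y : Input → ℝ × ℝ) (E : Set ℝ), Measurable Y → MeasurableSet E →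
      MemLp (fun s => (Y s).2) 2 ν → Integrable (fun s => |E.indicator id (Y s).2|) ν := by
    intro Y E hY hE h2
    refine (h2.integrable (by norm_num)).norm.mono' ((hindm' E hE).comp hY).aestronglyMeasurable
      (Eventually.of_forall fun s => ?_)
    by_cases h : (Y s).2 ∈ E <;> simp [h]
  have habs1 : ∀ Y : Input → ℝ × ℝ, (∀ s, IsRegular s → gaps s 0 ≤ (Y s).1) →
      ∫ s, |(Y s).1| ∂ν = meanLength ν Y := by
    intro Y hY
    refine integral_congr_ae ?_
    filter_upwards [hreg] with s hs
    exact abs_of_nonneg ((hs.gap_pos 0).le.trans (hY s hs))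
  have habs2 : ∀ (Y : Input → ℝ × ℝ) (E : Set ℝ), (∀ s, IsRegular s → 0 ≤ (Y s).2) →
      ∫ s, |E.indicator id (Y s).2| ∂ν = meanAge ν Y E := by
    intro Y E hY
    refine integral_congr_ae ?_
    filter_upwards [hreg] with s hs
    exact abs_of_nonneg (Set.indicator_apply_nonneg fun _ => hY s hs)
  have hreg' := hreg
  filter_upwards [hreg',
    ae_tendsto_average_sub_mean (g₀ := g₀) hε hreg hD (hindm D hD)
      (fun c => Set.indicator_nonneg (fun _ _ => zero_le_one) _)
      (hind_int _ measurable_dopCycle) (hind_int _ measurable_dnpCycle),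
    ae_tendsto_average_sub_mean (g₀ := g₀) hε hreg hD (f := fun c => |c.1|) measurable_fst.norm
      (fun c => abs_nonneg _) (ho.integrable (by norm_num)).norm (hn.integrable (by norm_num)).norm,
    ae_tendsto_average_sub_mean (g₀ := g₀) hε hreg hD (f := fun c => c.1 ^ 2)
      (measurable_fst.pow_const 2) (fun c => sq_nonneg _) ho.integrable_sq hn.integrable_sq,
    ae_tendsto_average_sub_mean (g₀ := g₀) hε hreg hD (hindm' D hD) (fun c => abs_nonneg _)
      (hage_int _ D measurable_dopCycle hD ho') (hage_int _ D measurable_dnpCycle hD hn'),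
    ae_tendsto_average_sub_mean (g₀ := g₀) hε hreg hD (hindm' Dᶜ hD.compl) (fun c => abs_nonneg _)
      (hage_int _ Dᶜ measurable_dopCycle hD.compl ho')
      (hage_int _ Dᶜ measurable_dnpCycle hD.compl hn'),
    ae_tendsto_average_age_mul_cycles (g₀ := g₀) hε hreg hD ho' hn' measurable_dopCycle hD
      (fun g hg s => if_pos hg) ho,
    ae_tendsto_average_age_mul_cycles (g₀ := g₀) hε hreg hD ho' hn' measurable_dnpCycle hD.compl
      (fun g hg s => if_neg hg) hn] with s hs h1 h2 h3 h4 h5 h6 h7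
  rw [habs1 _ fun s hs => hs.le_dopCycle_fst, habs1 _ fun s hs => hs.le_dnpCycle_fst] at h2
  rw [habs2 _ _ fun s hs => hs.dopCycle_snd_nonneg, habs2 _ _ fun s hs => hs.dnpCycle_snd_nonneg]
    at h4 h5
  have hcyc : ∀ k, 0 < (cycleAt D g₀ s k).1 := fun k => (hs.state_snd D g₀ k).cycle_fst_pos D _
  have hg' : ∀ k, 0 ≤ (state D g₀ s k).1 := fun k => hs.state_fst_nonneg hg k
  have hsucc : ∀ k, (cycleAt D g₀ s k).2 = (state D g₀ s (k + 1)).1 := fun k => rfl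
  -- the balance equation for the numbers of cycles of the two kinds
  have hw : Tendsto (fun n : ℕ => (∑ k ∈ Finset.range n,
      D.indicator (1 : ℝ → ℝ) (state D g₀ s k).1) / (n : ℝ)) atTop (𝓝 p) := by
    set w : ℕ → ℝ := fun k => D.indicator (1 : ℝ → ℝ) (state D g₀ s k).1 with hw
    have hw01 : ∀ k, ‖w k‖ ≤ 1 := fun k => by
      by_cases h : (state D g₀ s k).1 ∈ D <;> simp [hw, h]
    have hb : Tendsto (fun n : ℕ => (w n - w 0) / (n : ℝ)) atTop (𝓝 0) := by
      refine squeeze_zero_norm (a := fun n : ℕ => 2 * (1 / (n : ℝ))) (fun n => ?_) ?_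
      · rw [norm_div, Real.norm_natCast, mul_one_div]
        gcongr
        calc ‖w n - w 0‖ ≤ ‖w n‖ + ‖w 0‖ := norm_sub_le _ _
          _ ≤ 2 := by linarith [hw01 n, hw01 0]
      · simpa using tendsto_one_div_atTop_nhds_zero_nat.const_mul (2 : ℝ)
    have h8 := ((h1.sub hb).add_const (probAge ν dnpCycle D)).div_const
      (1 - probAge ν dopCycle D + probAge ν dnpCycle D)
    rw [sub_zero, zero_add] at h8
    refine h8.congr' ?_
    filter_upwards [eventually_gt_atTop 0] with n hn
    have hn0 : (n : ℝ) ≠ 0 := by positivity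
    have e1 : ∑ k ∈ Finset.range n, w (k + 1) = ∑ k ∈ Finset.range n, w k + (w n - w 0) := by
      have := Finset.sum_range_sub w n
      rw [Finset.sum_sub_distrib] at this
      linarith
    have e2 : ∑ k ∈ Finset.range n, (D.indicator (1 : ℝ → ℝ) (cycleAt D g₀ s k).2 -
        ((∫ x, D.indicator (1 : ℝ → ℝ) (dopCycle x).2 ∂ν) * w k +
          (∫ x, D.indicator (1 : ℝ → ℝ) (dnpCycle x).2 ∂ν) * (1 - w k))) =
        ∑ k ∈ Finset.range n, w (k + 1) -
          (probAge ν dopCycle D - probAge ν dnpCycle D) * ∑ k ∈ Finset.range n, w k -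
          n * probAge ν dnpCycle D := by
      have : (n : ℝ) * probAge ν dnpCycle D = ∑ k ∈ Finset.range n, probAge ν dnpCycle D := by simp
      rw [this, Finset.mul_sum, ← Finset.sum_sub_distrib, ← Finset.sum_sub_distrib]
      refine Finset.sum_congr rfl fun k _ => ?_
      rw [hsucc]
      simp only [probAge, hw]
      ring
    rw [e2, e1, div_eq_iff hq.ne']
    field_simp
    ring
  have hL : Tendsto (fun n : ℕ => (∑ k ∈ Finset.range n, (cycleAt D g₀ s k).1) / (n : ℝ)) atTop
      (𝓝 (p * meanLength ν dopCycle + (1 - p) * meanLength ν dnpCycle)) := by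
    refine (tendsto_average_of_frequency h2 hw).congr fun n => ?_
    congr 1
    exact Finset.sum_congr rfl fun k _ => abs_of_pos (hcyc k)
  have hS := tendsto_average_of_frequency h3 hw
  have hV : ∀ E : Set ℝ, Tendsto (fun n : ℕ => (∑ k ∈ Finset.range n,
      |E.indicator id (cycleAt D g₀ s k).2|) / (n : ℝ)) atTop
        (𝓝 (p * meanAge ν dopCycle E + (1 - p) * meanAge ν dnpCycle E)) →
      Tendsto (fun n : ℕ => (∑ k ∈ Finset.range n,
      E.indicator id (state D g₀ s k).1) / (n : ℝ)) atTop
        (𝓝 (p * meanAge ν dopCycle E + (1 - p) * meanAge ν dnpCycle E)) := by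
    intro E hE
    refine tendsto_average_of_tendsto_average_succ (hE.congr fun n => ?_)
    congr 1
    refine Finset.sum_congr rfl fun k _ => ?_
    rw [hsucc]
    exact abs_of_nonneg (Set.indicator_apply_nonneg fun _ => hg' (k + 1))
  have hV1 := hV D (tendsto_average_of_frequency h4 hw)
  have hV2 := hV Dᶜ (tendsto_average_of_frequency h5 hw)
  have hQ := ((h6.add h7).add ((hV1.const_mul (meanLength ν dopCycle)).add
    (hV2.const_mul (meanLength ν dnpCycle)))).add (hS.div_const 2)
  rw [add_zero, zero_add] at hQ
  refine hs.tendsto_average_age hg hd hL (hQ.congr fun n => ?_)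
  rw [← add_div, ← mul_div_assoc, ← mul_div_assoc, ← add_div, ← add_div, div_right_comm, ← add_div,
    Finset.mul_sum, Finset.mul_sum, Finset.sum_div, ← Finset.sum_add_distrib,
    ← Finset.sum_add_distrib, ← Finset.sum_add_distrib, ← Finset.sum_add_distrib]
  congr 1
  refine Finset.sum_congr rfl fun k _ => ?_
  have e := indicator_add_indicator_compl_id D (state D g₀ s k).1
  simp only [meanLength]
  linear_combination (cycleAt D g₀ s k).1 * e

end AverageAge

/-! ### The service of a packet under interruptions -/

/-- Index of the first transfer time that is smaller than the gap of the same index. In contrast to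
`interruptions`, gaps and transfer times are not shifted against each other. -/
noncomputable def served (t : Input) : ℕ := sInf {i | transfers t i < gaps t i}

/-- Time until the first completed transfer, if the gap of index `i` runs in parallel to the
transfer of index `i`. -/
noncomputable def serviceTime (t : Input) : ℝ :=
  ∑ i ∈ Finset.range (served t), gaps t i + transfers t (served t)

/-- Duration of the first completed transfer. -/
noncomputable def servedTransfer (t : Input) : ℝ := transfers t (served t)

/-- The input without its first gap: the gaps that run in parallel to the transfers. -/
def dropFirstGap (s : Input) : Input := fun i => s (Sum.map (· + 1) id i)

theorem dopCycle_eq (s : Input) : dopCycle s =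
    (s (Sum.inl 0) + serviceTime (dropFirstGap s), servedTransfer (dropFirstGap s)) := by
  have h : interruptions (gaps s) (transfers s) 0 = served (dropFirstGap s) := by
    simp [interruptions, served, transfers, gaps, dropFirstGap]
  have h2 : ∀ i, transfers (dropFirstGap s) i = transfers s i := fun i => rfl
  have h3 : ∀ i, gaps (dropFirstGap s) i = gaps s (i + 1) := fun i => rfl
  have h0 : gaps s 0 = s (Sum.inl 0) := rfl
  simp only [dopCycle, h, serviceTime, servedTransfer, h2, h3, arrivalTime,
    Finset.sum_range_succ', h0]
  congr 1
  ring

theorem measurable_served : Measurable served :=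
  measurable_nat_sInf fun i => measurableSet_lt (measurable_transfers i) (measurable_gaps i)

theorem measurable_servedTransfer : Measurable servedTransfer :=
  measurable_apply_nat (f := fun n t => transfers t n) measurable_transfers measurable_served

theorem measurable_serviceTime : Measurable serviceTime :=
  measurable_apply_nat
    (f := fun n (t : Input) => ∑ i ∈ Finset.range n, gaps t i + transfers t n)
    (fun n => by fun_prop) measurable_served

theorem measurable_dropFirstGap : Measurable dropFirstGap :=
  measurable_pi_iff.2 fun _ => measurable_pi_apply _

/-- The event that the first transfer is completed. -/
def firstCompleted : Set Input := {t | transfers t 0 < gaps t 0}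

theorem measurableSet_firstCompleted : MeasurableSet firstCompleted :=
  measurableSet_lt (measurable_transfers 0) (measurable_gaps 0)

theorem served_of_mem {t : Input} (h : t ∈ firstCompleted) : served t = 0 :=
  Nat.sInf_eq_zero.2 (Or.inl h)

theorem served_of_notMem {t : Input} (h : t ∉ firstCompleted)
    (hex : ∃ i, transfers t i < gaps t i) : served t = served (shift 1 t) + 1 := by
  have h0 : served t ≠ 0 := by
    intro h0
    rcases Nat.sInf_eq_zero.1 h0 with h1 | h1
    · exact h h1
    · obtain ⟨i, hi⟩ := hex
      exact absurd (show i ∈ {i | transfers t i < gaps t i} from hi) (by simp [h1])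
  exact (Nat.sInf_add (p := fun i => transfers t i < gaps t i)
    (Nat.one_le_iff_ne_zero.2 h0)).symm

theorem serviceTime_of_mem {t : Input} (h : t ∈ firstCompleted) :
    serviceTime t = transfers t 0 := by
  simp [serviceTime, served_of_mem h]

theorem serviceTime_of_notMem {t : Input} (h : t ∉ firstCompleted)
    (hex : ∃ i, transfers t i < gaps t i) :
    serviceTime t = gaps t 0 + serviceTime (shift 1 t) := by
  rw [serviceTime, served_of_notMem h hex, Finset.sum_range_succ', serviceTime]
  simp only [shift, gaps, transfers, Sum.map_inl, Sum.map_inr]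
  ring

theorem servedTransfer_of_mem {t : Input} (h : t ∈ firstCompleted) :
    servedTransfer t = transfers t 0 := by
  simp [servedTransfer, served_of_mem h]

theorem servedTransfer_of_notMem {t : Input} (h : t ∉ firstCompleted)
    (hex : ∃ i, transfers t i < gaps t i) :
    servedTransfer t = servedTransfer (shift 1 t) := by
  rw [servedTransfer, served_of_notMem h hex]
  rfl

theorem setIntegral_Ioi_expMeasure {r : ℝ} {ε : Measure ℝ} (hε : ε = expMeasure r)
    {u : ℝ} (hu : 0 ≤ u) {f : ℝ → ℝ} (hf : Measurable f) :
    ∫ w in Set.Ioi u, f w ∂ε = Real.exp (-(r * u)) * ∫ w, f (w + u) ∂ε := by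
  have hmap : (ε.restrict (Set.Ioi u)).map (fun w => w - u) =
      ENNReal.ofReal (Real.exp (-(r * u))) • ε := by
    ext A hA
    have hA' : MeasurableSet ((fun w => w - u) ⁻¹' A) := measurable_sub_const u hA
    rw [Measure.map_apply (by fun_prop) hA, Measure.restrict_apply hA',
      Measure.smul_apply, smul_eq_mul, hε, ← expMeasure_memoryless hu hA, Set.inter_comm]
    rfl
  have h := integral_map (μ := ε.restrict (Set.Ioi u)) (φ := fun w => w - u) (by fun_prop)
    (f := fun w => f (w + u)) (hf.comp (measurable_add_const u)).aestronglyMeasurable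
  rw [hmap, integral_smul_measure, ENNReal.toReal_ofReal (Real.exp_pos _).le, smul_eq_mul] at h
  rw [h]
  simp

/-- `E[T ^ n exp (-r T)]`, where `T` has law `τ`. -/
noncomputable def discountedMoment (r : ℝ) (τ : Measure ℝ) (n : ℕ) : ℝ :=
  ∫ x, x ^ n * Real.exp (-(r * x)) ∂τ

theorem integrable_mul_exp {r : ℝ} {τ : Measure ℝ} (hr : 0 < r) (hτ : ∀ᵐ x ∂τ, 0 ≤ x)
    {f : ℝ → ℝ} (hf : Integrable f τ) : Integrable (fun x => f x * Real.exp (-(r * x))) τ := by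
  refine hf.mul_bdd (c := 1) (by fun_prop) ?_
  filter_upwards [hτ] with x hx
  rw [Real.norm_of_nonneg (Real.exp_pos _).le, Real.exp_le_one_iff]
  nlinarith

section Moments

variable {r : ℝ} {ε τ : Measure ℝ} [IsProbabilityMeasure ε] [IsProbabilityMeasure τ]

theorem measurePreserving_shift (j : ℕ) :
    MeasurePreserving (shift j) (inputLaw ε τ) (inputLaw ε τ) :=
  ⟨measurable_shift j, map_shift_inputLaw j⟩

theorem measurePreserving_dropFirstGap :
    MeasurePreserving dropFirstGap (inputLaw ε τ) (inputLaw ε τ) :=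
  ⟨measurable_dropFirstGap, map_relabel_inputLaw (add_left_injective 1) Function.injective_id⟩

theorem measurePreserving_transfer (n : ℕ) :
    MeasurePreserving (fun s => transfers s n) (inputLaw ε τ) τ :=
  ⟨measurable_transfers n, map_inr_inputLaw n⟩

theorem measurePreserving_gap (n : ℕ) :
    MeasurePreserving (fun s => gaps s n) (inputLaw ε τ) ε :=
  ⟨measurable_gaps n, map_inl_inputLaw n⟩

theorem indepFun_gap_dropFirstGap :
    IndepFun (fun s => gaps s 0) dropFirstGap (inputLaw ε τ) := by
  have h := indepFun_coordinates (ε := ε) (τ := τ) (a := fun _ : Unit => Sum.inl 0)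
    (b := Sum.map (· + 1) id) (by rintro _ (n | n) <;> simp)
  exact h.comp (φ := fun v : Unit → ℝ => v ()) (ψ := id) (measurable_pi_apply _) measurable_id

/-- Data of the first packet are independent of the later input. -/
theorem indepFun_first_shift {φ : ℝ × ℝ → ℝ} (hφ : Measurable φ) {H : Input → ℝ}
    (hH : Measurable H) : IndepFun (fun t => φ (transfers t 0, gaps t 0)) (fun t => H (shift 1 t))
      (inputLaw ε τ) := by
  have h := (indepFun_past_shift (ε := ε) (τ := τ) 1).comp
    (φ := fun v : Input => φ (transfers v 0, gaps v 0)) (ψ := H)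
    (hφ.comp ((measurable_transfers 0).prodMk (measurable_gaps 0))) hH
  have e : (fun v : Input => φ (transfers v 0, gaps v 0)) ∘ past 1 =
      fun t => φ (transfers t 0, gaps t 0) := by
    ext t
    simp [past, transfers, gaps]
  rwa [e] at h

theorem integral_first_mul_shift {φ : ℝ × ℝ → ℝ} (hφ : Measurable φ) {H : Input → ℝ}
    (hH : Measurable H) :
    ∫ t, φ (transfers t 0, gaps t 0) * H (shift 1 t) ∂(inputLaw ε τ) =
      (∫ t, φ (transfers t 0, gaps t 0) ∂(inputLaw ε τ)) * ∫ t, H t ∂(inputLaw ε τ) := by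
  have hm : Measurable fun t : Input => φ (transfers t 0, gaps t 0) :=
    hφ.comp ((measurable_transfers 0).prodMk (measurable_gaps 0))
  rw [(indepFun_first_shift hφ hH).integral_fun_mul_eq_mul_integral hm.aestronglyMeasurable
    (hH.comp (measurable_shift 1)).aestronglyMeasurable]
  congr 1
  conv_rhs => rw [← map_shift_inputLaw (ε := ε) (τ := τ) 1,
    integral_map (measurable_shift 1).aemeasurable hH.aestronglyMeasurable]

/-- Expectations over the event that the first transfer is completed: given the transfer time `x`,
this event has probability `exp (-r x)`, and then the gap exceeds `x` by an exponential time. -/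
theorem integral_firstCompleted (hε : ε = expMeasure r) (hτ : ∀ᵐ x ∂τ, 0 ≤ x) {φ : ℝ × ℝ → ℝ}
    (hφ : Measurable φ) (hint : Integrable φ (τ.prod ε)) :
    ∫ t in firstCompleted, φ (transfers t 0, gaps t 0) ∂(inputLaw ε τ) =
      ∫ x, Real.exp (-(r * x)) * ∫ w, φ (x, w + x) ∂ε ∂τ := by
  have hm : MeasurableSet {q : ℝ × ℝ | q.1 < q.2} := measurableSet_lt measurable_fst measurable_snd
  have h1 : ∫ t in firstCompleted, φ (transfers t 0, gaps t 0) ∂(inputLaw ε τ) =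
      ∫ q in {q : ℝ × ℝ | q.1 < q.2}, φ q ∂(τ.prod ε) := by
    rw [← map_inr_inl_inputLaw (ε := ε) (τ := τ) 0 0, setIntegral_map hm
      hφ.aestronglyMeasurable (by fun_prop)]
    rfl
  rw [h1, ← integral_indicator hm, integral_prod _ (hint.indicator hm)]
  refine integral_congr_ae ?_
  filter_upwards [hτ] with x hx
  have h2 := setIntegral_Ioi_expMeasure hε hx (f := fun w => φ (x, w))
    (hφ.comp measurable_prodMk_left)
  rw [← h2, ← integral_indicator measurableSet_Ioi]
  rfl

theorem integral_transfer_firstCompleted (hε : ε = expMeasure r)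
    (hτ : ∀ᵐ x ∂τ, 0 ≤ x) {f : ℝ → ℝ} (hfm : Measurable f) (hf : Integrable f τ) :
    ∫ t in firstCompleted, f (transfers t 0) ∂(inputLaw ε τ) =
      ∫ x, f x * Real.exp (-(r * x)) ∂τ := by
  rw [integral_firstCompleted hε hτ (φ := fun q => f q.1) (hfm.comp measurable_fst)
    (hf.comp_fst ε)]
  simp [mul_comm]

theorem integral_gap_firstCompleted (hr : 0 < r) (hε : ε = expMeasure r) (hτ : ∀ᵐ x ∂τ, 0 ≤ x)
    (hτ2 : MemLp id 2 τ) :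
    ∫ t in firstCompleted, gaps t 0 ∂(inputLaw ε τ) =
      discountedMoment r τ 1 + discountedMoment r τ 0 / r := by
  obtain ⟨i1, m1⟩ := integrable_pow_expMeasure hr 1
  simp only [pow_one, Nat.factorial_one, Nat.cast_one, ← hε] at i1 m1
  rw [integral_firstCompleted hε hτ (φ := fun q => q.2) measurable_snd (i1.comp_snd τ)]
  have e : ∀ x : ℝ, Real.exp (-(r * x)) * ∫ w, (w + x) ∂ε =
      x ^ 1 * Real.exp (-(r * x)) + x ^ 0 * Real.exp (-(r * x)) / r := by
    intro x
    rw [integral_add i1 (integrable_const _), m1]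
    simp
    ring
  have hi1 : Integrable (fun x : ℝ => x ^ 1) τ := by
    simp only [pow_one]
    exact hτ2.integrable (by norm_num)
  have hi0 : Integrable (fun x : ℝ => x ^ 0) τ := by simp
  simp_rw [e]
  rw [integral_add (integrable_mul_exp hr hτ hi1) ((integrable_mul_exp hr hτ hi0).div_const r),
    integral_div]
  rfl

theorem integral_sq_gap_firstCompleted (hr : 0 < r) (hε : ε = expMeasure r)
    (hτ : ∀ᵐ x ∂τ, 0 ≤ x) (hτ2 : MemLp id 2 τ) :
    ∫ t in firstCompleted, gaps t 0 ^ 2 ∂(inputLaw ε τ) =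
      discountedMoment r τ 2 + 2 * discountedMoment r τ 1 / r +
        2 * discountedMoment r τ 0 / r ^ 2 := by
  obtain ⟨i1, m1⟩ := integrable_pow_expMeasure hr 1
  obtain ⟨i2, m2⟩ := integrable_pow_expMeasure hr 2
  simp only [pow_one, Nat.factorial_one, Nat.cast_one, ← hε] at i1 m1
  simp only [Nat.factorial_two, Nat.cast_ofNat, ← hε] at i2 m2
  rw [integral_firstCompleted hε hτ (φ := fun q => q.2 ^ 2) (measurable_snd.pow_const 2)
    (i2.comp_snd τ)]
  have e : ∀ x : ℝ, Real.exp (-(r * x)) * ∫ w, (w + x) ^ 2 ∂ε =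
      x ^ 2 * Real.exp (-(r * x)) + x ^ 1 * Real.exp (-(r * x)) * (2 / r) +
        x ^ 0 * Real.exp (-(r * x)) * (2 / r ^ 2) := by
    intro x
    have e1 : ∀ w : ℝ, (w + x) ^ 2 = w ^ 2 + (2 * x * w + x ^ 2) := fun w => by ring
    simp_rw [e1]
    have i3 : Integrable (fun w : ℝ => 2 * x * w + x ^ 2) ε :=
      (i1.const_mul (2 * x)).add (integrable_const _)
    rw [integral_add i2 i3, integral_add (i1.const_mul (2 * x)) (integrable_const _),
      integral_const_mul, m1, m2]
    simp
    ring
  have hi2 : Integrable (fun x : ℝ => x ^ 2) τ := hτ2.integrable_sq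
  have hi1 : Integrable (fun x : ℝ => x ^ 1) τ := by
    simp only [pow_one]
    exact hτ2.integrable (by norm_num)
  have hi0 : Integrable (fun x : ℝ => x ^ 0) τ := by simp
  simp_rw [e]
  have j2 := integrable_mul_exp hr hτ hi2
  have j1 := (integrable_mul_exp hr hτ hi1).mul_const (2 / r)
  have j0 := (integrable_mul_exp hr hτ hi0).mul_const (2 / r ^ 2)
  have j21 : Integrable (fun x : ℝ => x ^ 2 * Real.exp (-(r * x)) +
    x ^ 1 * Real.exp (-(r * x)) * (2 / r)) τ := j2.add j1
  rw [integral_add j21 j0, integral_add j2 j1, integral_mul_const, integral_mul_const]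
  simp only [discountedMoment]
  ring

theorem ae_exists_served (hε : ε = expMeasure r) (hτ : ∀ᵐ x ∂τ, 0 ≤ x) :
    ∀ᵐ t ∂(inputLaw ε τ), ∃ i, transfers t i < gaps t i := by
  have h := ae_exists_completed hε hτ 0
  have h2 : ∀ᵐ t ∂((inputLaw ε τ).map dropFirstGap), ∃ i, transfers t i < gaps t i := by
    have hm : MeasurableSet {t : Input | ∃ i, transfers t i < gaps t i} := by
      simp only [Set.ofPred_exists]
      exact MeasurableSet.iUnion fun i => measurableSet_lt (measurable_transfers i)
        (measurable_gaps i)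
    rw [ae_map_iff measurable_dropFirstGap.aemeasurable hm]
    filter_upwards [h] with s hs
    simpa [dropFirstGap, transfers, gaps] using hs
  rwa [measurePreserving_dropFirstGap.map_eq] at h2

theorem measureReal_firstCompleted (hε : ε = expMeasure r) (hτ : ∀ᵐ x ∂τ, 0 ≤ x) :
    (inputLaw ε τ).real firstCompleted = discountedMoment r τ 0 := by
  have := integral_transfer_firstCompleted (ε := ε) hε hτ (f := fun _ => 1) measurable_const
    (integrable_const _)
  simpa [discountedMoment] using this

theorem discountedMoment_zero_pos (hε : ε = expMeasure r) (hτ : ∀ᵐ x ∂τ, 0 ≤ x) :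
    0 < discountedMoment r τ 0 := by
  rw [← measureReal_firstCompleted (ε := ε) hε hτ]
  exact ENNReal.toReal_pos (measure_completed_pos hε hτ).ne' (measure_ne_top _ _)

end Moments

/-! ### Moments of the service time -/

section ServiceMoments

variable {r : ℝ} {ε τ : Measure ℝ} [IsProbabilityMeasure ε] [IsProbabilityMeasure τ]

/-- If the first transfer is interrupted, the input from then on is as good as new. -/
theorem setIntegral_compl_firstCompleted_mul_shift {φ : ℝ × ℝ → ℝ} (hφ : Measurable φ)
    {H : Input → ℝ} (hH : Measurable H) :
    ∫ t in firstCompletedᶜ, φ (transfers t 0, gaps t 0) * H (shift 1 t) ∂(inputLaw ε τ) =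
      (∫ t in firstCompletedᶜ, φ (transfers t 0, gaps t 0) ∂(inputLaw ε τ)) *
        ∫ t, H t ∂(inputLaw ε τ) := by
  have hm : MeasurableSet {q : ℝ × ℝ | ¬ q.1 < q.2} :=
    (measurableSet_lt measurable_fst measurable_snd).compl
  have h := integral_first_mul_shift (ε := ε) (τ := τ) (hφ.indicator hm) hH
  rw [← integral_indicator measurableSet_firstCompleted.compl,
    ← integral_indicator measurableSet_firstCompleted.compl]
  have e1 : ∀ t : Input, firstCompletedᶜ.indicator (fun t => φ (transfers t 0, gaps t 0)) t =
      {q : ℝ × ℝ | ¬ q.1 < q.2}.indicator φ (transfers t 0, gaps t 0) := fun t => rfl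
  have e2 : ∀ t : Input,
      firstCompletedᶜ.indicator (fun t => φ (transfers t 0, gaps t 0) * H (shift 1 t)) t =
        {q : ℝ × ℝ | ¬ q.1 < q.2}.indicator φ (transfers t 0, gaps t 0) * H (shift 1 t) := by
    intro t
    rw [← e1]
    by_cases ht : t ∈ firstCompletedᶜ <;> simp [ht]
  simp_rw [e1, e2]
  exact h

theorem setIntegral_compl_firstCompleted_shift {H : Input → ℝ} (hH : Measurable H) :
    ∫ t in firstCompletedᶜ, H (shift 1 t) ∂(inputLaw ε τ) =
      (1 - (inputLaw ε τ).real firstCompleted) * ∫ t, H t ∂(inputLaw ε τ) := by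
  have h := setIntegral_compl_firstCompleted_mul_shift (ε := ε) (τ := τ) (φ := fun _ => 1)
    measurable_const hH
  simpa [probReal_compl_eq_one_sub measurableSet_firstCompleted] using h

theorem integrable_comp_shift {H : Input → ℝ} (hH : Integrable H (inputLaw ε τ)) :
    Integrable (fun t => H (shift 1 t)) (inputLaw ε τ) :=
  (measurePreserving_shift 1).integrable_comp_of_integrable hH

theorem integrable_transfer {f : ℝ → ℝ} (hf : Integrable f τ) (n : ℕ) :
    Integrable (fun t => f (transfers t n)) (inputLaw ε τ) :=
  (measurePreserving_transfer n).integrable_comp_of_integrable hf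

theorem integrable_gap {f : ℝ → ℝ} (hf : Integrable f ε) (n : ℕ) :
    Integrable (fun t => f (gaps t n)) (inputLaw ε τ) :=
  (measurePreserving_gap n).integrable_comp_of_integrable hf

theorem integral_transfer {f : ℝ → ℝ} (hf : Measurable f) (n : ℕ) :
    ∫ t, f (transfers t n) ∂(inputLaw ε τ) = ∫ x, f x ∂τ := by
  conv_rhs => rw [← map_inr_inputLaw (ε := ε) (τ := τ) n,
    integral_map (measurable_pi_apply _).aemeasurable hf.aestronglyMeasurable]
  rfl

theorem integral_gap {f : ℝ → ℝ} (hf : Measurable f) (n : ℕ) :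
    ∫ t, f (gaps t n) ∂(inputLaw ε τ) = ∫ x, f x ∂ε := by
  conv_rhs => rw [← map_inl_inputLaw (ε := ε) (τ := τ) n,
    integral_map (measurable_pi_apply _).aemeasurable hf.aestronglyMeasurable]
  rfl

/-- The second moments of the service times with fewer than `m` interruptions are bounded in `m`:
an interruption contributes a factor `1 - p` with `p = P(first transfer completed)`, which absorbs
the factor `1 + p` lost when the square of the sum is expanded. -/
theorem setIntegral_sq_serviceTime_le (hr : 0 < r) (hε : ε = expMeasure r)
    (hτ : ∀ᵐ x ∂τ, 0 ≤ x) (hτ2 : MemLp id 2 τ) :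
    ∃ K, ∀ m, IntegrableOn (fun t => serviceTime t ^ 2) {t | served t < m} (inputLaw ε τ) ∧
      ∫ t in {t | served t < m}, serviceTime t ^ 2 ∂(inputLaw ε τ) ≤ K := by
  have hp := discountedMoment_zero_pos (ε := ε) hε hτ
  have hpF := measureReal_firstCompleted (ε := ε) hε hτ
  set p := discountedMoment r τ 0
  have hp1 : p ≤ 1 := hpF ▸ measureReal_le_one
  have iX : Integrable (fun t => transfers t 0 ^ 2) (inputLaw ε τ) :=
    integrable_transfer (f := fun x => x ^ 2) hτ2.integrable_sq 0
  have iW : Integrable (fun t => gaps t 0 ^ 2) (inputLaw ε τ) :=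
    integrable_gap (f := fun x => x ^ 2) (hε ▸ (integrable_pow_expMeasure hr 2).1) 0
  set C := ∫ t, (transfers t 0 ^ 2 + (1 + 1 / p) * gaps t 0 ^ 2) ∂(inputLaw ε τ) with hC
  have iC : Integrable (fun t => transfers t 0 ^ 2 + (1 + 1 / p) * gaps t 0 ^ 2)
    (inputLaw ε τ) := iX.add (iW.const_mul _)
  have hC0 : 0 ≤ C := integral_nonneg fun t => by positivity
  have hmeas : ∀ m, MeasurableSet {t | served t < m} := fun m =>
    measurable_served measurableSet_Iio
  have hmG : Measurable fun t => serviceTime t ^ 2 := measurable_serviceTime.pow_const 2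
  refine ⟨C / p ^ 2, fun m => ?_⟩
  rw [← integrable_indicator_iff (hmeas m), ← integral_indicator (hmeas m)]
  induction m with
  | zero =>
    simp only [Nat.not_lt_zero, Set.ofPred_false, Set.indicator_empty, integral_zero]
    exact ⟨integrable_zero _ _ _, by positivity⟩
  | succ m ih =>
    set H : ℕ → Input → ℝ := fun m => {t | served t < m}.indicator fun t => serviceTime t ^ 2
      with hH
    have hmH : ∀ m, Measurable (H m) := fun m => hmG.indicator (hmeas m)
    have hH0 : ∀ m t, 0 ≤ H m t := fun m t => Set.indicator_nonneg (fun _ _ => sq_nonneg _) t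
    have iH : Integrable (firstCompletedᶜ.indicator fun t => H m (shift 1 t)) (inputLaw ε τ) :=
      (integrable_comp_shift ih.1).indicator measurableSet_firstCompleted.compl
    have hle : ∀ᵐ t ∂(inputLaw ε τ), H (m + 1) t ≤
        (transfers t 0 ^ 2 + (1 + 1 / p) * gaps t 0 ^ 2) +
          (1 + p) * firstCompletedᶜ.indicator (fun t => H m (shift 1 t)) t := by
      filter_upwards [ae_exists_served hε hτ] with t ht
      by_cases hF : t ∈ firstCompleted
      · have : 0 ≤ (1 + 1 / p) * gaps t 0 ^ 2 := by positivity
        simp [hH, served_of_mem hF, serviceTime_of_mem hF, hF]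
        simpa using this
      · rw [Set.indicator_of_mem (show t ∈ firstCompletedᶜ from hF)]
        by_cases hs : served (shift 1 t) < m
        · have e1 : H (m + 1) t = serviceTime t ^ 2 :=
            Set.indicator_of_mem (by simp [served_of_notMem hF ht, hs]) _
          have e2 : H m (shift 1 t) = serviceTime (shift 1 t) ^ 2 :=
            Set.indicator_of_mem (by simpa using hs) _
          rw [e1, e2, serviceTime_of_notMem hF ht]
          set a := gaps t 0
          set b := serviceTime (shift 1 t)
          -- the weights in `(a + b) ^ 2 ≤ (1 + 1 / p) a ^ 2 + (1 + p) b ^ 2` make the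
          -- recursion contract: `(1 + p) * (1 - p) < 1`
          have h3 : (1 + 1 / p) * a ^ 2 + (1 + p) * b ^ 2 - (a + b) ^ 2 =
              p * (a / p - b) ^ 2 := by
            field_simp
            ring
          have h4 : 0 ≤ p * (a / p - b) ^ 2 := by positivity
          nlinarith [sq_nonneg (transfers t 0)]
        · have e1 : H (m + 1) t = 0 :=
            Set.indicator_of_notMem (by simpa [served_of_notMem hF ht] using hs) _
          rw [e1]
          have := hH0 m (shift 1 t)
          positivity
    have iR := iC.add (iH.const_mul (1 + p))
    have iM : Integrable (H (m + 1)) (inputLaw ε τ) := by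
      refine iR.mono' (hmH _).aestronglyMeasurable ?_
      filter_upwards [hle] with t ht
      rwa [Real.norm_of_nonneg (hH0 _ _)]
    refine ⟨iM, (integral_mono_ae iM iR hle).trans ?_⟩
    have h5 : ∫ t, firstCompletedᶜ.indicator (fun t => H m (shift 1 t)) t ∂(inputLaw ε τ) =
        (1 - p) * ∫ t, H m t ∂(inputLaw ε τ) := by
      rw [integral_indicator measurableSet_firstCompleted.compl,
        setIntegral_compl_firstCompleted_shift (hmH m), hpF]
    rw [integral_add' iC (iH.const_mul _), integral_const_mul, h5, ← hC]
    have h6 : (1 + p) * ((1 - p) * ∫ t, H m t ∂(inputLaw ε τ)) ≤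
        (1 + p) * ((1 - p) * (C / p ^ 2)) := by
      have := ih.2
      have h1p : 0 ≤ 1 - p := by linarith
      gcongr
    refine (add_le_add_right h6 C).trans_eq ?_
    field_simp
    ring

theorem memLp_serviceTime (hr : 0 < r) (hε : ε = expMeasure r) (hτ : ∀ᵐ x ∂τ, 0 ≤ x)
    (hτ2 : MemLp id 2 τ) : MemLp serviceTime 2 (inputLaw ε τ) := by
  obtain ⟨K, hK⟩ := setIntegral_sq_serviceTime_le hr hε hτ hτ2
  rw [memLp_two_iff_integrable_sq measurable_serviceTime.aestronglyMeasurable]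
  have hc : AECover (inputLaw ε τ) atTop fun m : ℕ => {t | served t < m} :=
    ⟨ae_of_all _ fun t => eventually_gt_atTop (served t), fun m =>
      measurable_served measurableSet_Iio⟩
  exact hc.integrable_of_integral_bounded_of_nonneg_ae K (fun m => (hK m).1)
    (ae_of_all _ fun t => sq_nonneg _) (Eventually.of_forall fun m => (hK m).2)

theorem ae_servedTransfer_mem_Icc (hε : ε = expMeasure r) (hτ : ∀ᵐ x ∂τ, 0 ≤ x) :
    ∀ᵐ t ∂(inputLaw ε τ), servedTransfer t ∈ Set.Icc 0 (serviceTime t) := by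
  filter_upwards [ae_all_iff.2 (ae_gap_pos (τ := τ) hε), ae_all_iff.2 (ae_transfer_nonneg hτ)]
    with t h1 h2
  exact ⟨h2 _, le_add_of_nonneg_left (Finset.sum_nonneg fun i _ => (h1 i).le)⟩

theorem memLp_servedTransfer (hr : 0 < r) (hε : ε = expMeasure r) (hτ : ∀ᵐ x ∂τ, 0 ≤ x)
    (hτ2 : MemLp id 2 τ) : MemLp servedTransfer 2 (inputLaw ε τ) := by
  refine (memLp_serviceTime hr hε hτ hτ2).mono measurable_servedTransfer.aestronglyMeasurable ?_
  filter_upwards [ae_servedTransfer_mem_Icc hε hτ] with t ht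
  rw [Real.norm_of_nonneg ht.1]
  exact ht.2.trans (Real.le_norm_self _)

/-- The first completed transfer has the law of `T` given that `T` is smaller than an independent
exponential time. -/
theorem integral_servedTransfer (hε : ε = expMeasure r) (hτ : ∀ᵐ x ∂τ, 0 ≤ x) {f : ℝ → ℝ}
    (hfm : Measurable f) (hf : Integrable f τ)
    (hfs : Integrable (fun t => f (servedTransfer t)) (inputLaw ε τ)) :
    discountedMoment r τ 0 * ∫ t, f (servedTransfer t) ∂(inputLaw ε τ) =
      ∫ x, f x * Real.exp (-(r * x)) ∂τ := by
  have h1 : ∫ t in firstCompleted, f (servedTransfer t) ∂(inputLaw ε τ) =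
      ∫ x, f x * Real.exp (-(r * x)) ∂τ := by
    rw [← integral_transfer_firstCompleted (ε := ε) hε hτ hfm hf]
    exact setIntegral_congr_fun measurableSet_firstCompleted fun t ht => by
      simp only [servedTransfer_of_mem ht]
  have h2 : ∫ t in firstCompletedᶜ, f (servedTransfer t) ∂(inputLaw ε τ) =
      (1 - discountedMoment r τ 0) * ∫ t, f (servedTransfer t) ∂(inputLaw ε τ) := by
    rw [← measureReal_firstCompleted (ε := ε) hε hτ,
      ← setIntegral_compl_firstCompleted_shift
        (H := fun t => f (servedTransfer t)) (hfm.comp measurable_servedTransfer)]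
    refine setIntegral_congr_ae measurableSet_firstCompleted.compl ?_
    filter_upwards [ae_exists_served hε hτ] with t ht hF
    simp only [servedTransfer_of_notMem hF ht]
  have h3 := integral_add_compl measurableSet_firstCompleted hfs
  rw [h1, h2] at h3
  linarith

/-- Wald's identity for the service time, from the recursion at the first interruption. -/
theorem integral_serviceTime (hr : 0 < r) (hε : ε = expMeasure r) (hτ : ∀ᵐ x ∂τ, 0 ≤ x)
    (hτ2 : MemLp id 2 τ) :
    discountedMoment r τ 0 * ∫ t, serviceTime t ∂(inputLaw ε τ) =
      (1 - discountedMoment r τ 0) / r := by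
  have iG := (memLp_serviceTime hr hε hτ hτ2).integrable (by norm_num)
  obtain ⟨i1, m1⟩ := integrable_pow_expMeasure hr 1
  simp only [pow_one, Nat.factorial_one, Nat.cast_one, ← hε] at i1 m1
  have iW := integrable_gap (τ := τ) (f := fun x => x) i1 0
  have hW := integral_gap (ε := ε) (τ := τ) (f := fun x => x) measurable_id 0
  have h1 : ∫ t in firstCompleted, serviceTime t ∂(inputLaw ε τ) = discountedMoment r τ 1 := by
    have := integral_transfer_firstCompleted (ε := ε) hε hτ (f := fun x => x ^ 1)
      (by fun_prop) (by simp only [pow_one]; exact hτ2.integrable (by norm_num))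
    rw [discountedMoment, ← this]
    exact setIntegral_congr_fun measurableSet_firstCompleted fun t ht => by
      simp only [serviceTime_of_mem ht, pow_one]
  have h2 : ∫ t in firstCompletedᶜ, serviceTime t ∂(inputLaw ε τ) =
      ∫ t in firstCompletedᶜ, gaps t 0 ∂(inputLaw ε τ) +
        (1 - discountedMoment r τ 0) * ∫ t, serviceTime t ∂(inputLaw ε τ) := by
    rw [← measureReal_firstCompleted (ε := ε) hε hτ,
      ← setIntegral_compl_firstCompleted_shift measurable_serviceTime,
      ← integral_add iW.integrableOn (integrable_comp_shift iG).integrableOn]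
    refine setIntegral_congr_ae measurableSet_firstCompleted.compl ?_
    filter_upwards [ae_exists_served hε hτ] with t ht hF
    rw [serviceTime_of_notMem hF ht]
  have h3 := integral_add_compl measurableSet_firstCompleted iG
  have h4 := integral_add_compl measurableSet_firstCompleted iW
  rw [hW, m1, integral_gap_firstCompleted hr hε hτ hτ2] at h4
  rw [h1, h2] at h3
  rw [sub_div]
  linarith

theorem integral_sq_serviceTime (hr : 0 < r) (hε : ε = expMeasure r) (hτ : ∀ᵐ x ∂τ, 0 ≤ x)
    (hτ2 : MemLp id 2 τ) :
    discountedMoment r τ 0 * ∫ t, serviceTime t ^ 2 ∂(inputLaw ε τ) =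
      2 * (1 - discountedMoment r τ 0) / r ^ 2 - 2 * discountedMoment r τ 1 / r +
        2 * ((1 - discountedMoment r τ 0) / r - discountedMoment r τ 1) *
          ∫ t, serviceTime t ∂(inputLaw ε τ) := by
  have mG := memLp_serviceTime hr hε hτ hτ2
  have iG := mG.integrable (by norm_num)
  have iG2 := mG.integrable_sq
  obtain ⟨i1, m1⟩ := integrable_pow_expMeasure hr 1
  obtain ⟨i2, m2⟩ := integrable_pow_expMeasure hr 2
  simp only [pow_one, Nat.factorial_one, Nat.cast_one, ← hε] at i1 m1
  simp only [Nat.factorial_two, Nat.cast_ofNat, ← hε] at i2 m2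
  have iW := integrable_gap (τ := τ) (f := fun x => x) i1 0
  have hW := integral_gap (ε := ε) (τ := τ) (f := fun x => x) measurable_id 0
  have iW2 := integrable_gap (τ := τ) (f := fun x => x ^ 2) i2 0
  have hW2 := integral_gap (ε := ε) (τ := τ) (f := fun x => x ^ 2) (by fun_prop) 0
  have h1 : ∫ t in firstCompleted, serviceTime t ^ 2 ∂(inputLaw ε τ) =
      discountedMoment r τ 2 := by
    have := integral_transfer_firstCompleted (ε := ε) hε hτ (f := fun x => x ^ 2)
      (by fun_prop) hτ2.integrable_sq
    rw [discountedMoment, ← this]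
    exact setIntegral_congr_fun measurableSet_firstCompleted fun t ht => by
      simp only [serviceTime_of_mem ht]
  have iX : Integrable (fun t => gaps t 0 * serviceTime (shift 1 t)) (inputLaw ε τ) :=
    (indepFun_first_shift measurable_snd measurable_serviceTime).integrable_mul iW
      (integrable_comp_shift iG)
  have iXG : Integrable (fun t => 2 * (gaps t 0 * serviceTime (shift 1 t)) +
    serviceTime (shift 1 t) ^ 2) (inputLaw ε τ) := (iX.const_mul 2).add (integrable_comp_shift iG2)
  have h2 : ∫ t in firstCompletedᶜ, serviceTime t ^ 2 ∂(inputLaw ε τ) =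
      ∫ t in firstCompletedᶜ, gaps t 0 ^ 2 ∂(inputLaw ε τ) +
        (2 * ((∫ t in firstCompletedᶜ, gaps t 0 ∂(inputLaw ε τ)) *
            ∫ t, serviceTime t ∂(inputLaw ε τ)) +
          (1 - discountedMoment r τ 0) * ∫ t, serviceTime t ^ 2 ∂(inputLaw ε τ)) := by
    rw [← measureReal_firstCompleted (ε := ε) hε hτ,
      ← setIntegral_compl_firstCompleted_shift (measurable_serviceTime.pow_const 2),
      ← setIntegral_compl_firstCompleted_mul_shift measurable_snd measurable_serviceTime,
      ← integral_const_mul,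
      ← integral_add (iX.const_mul 2).integrableOn (integrable_comp_shift iG2).integrableOn,
      ← integral_add iW2.integrableOn iXG.integrableOn]
    refine setIntegral_congr_ae measurableSet_firstCompleted.compl ?_
    filter_upwards [ae_exists_served hε hτ] with t ht hF
    rw [serviceTime_of_notMem hF ht]
    ring
  have h3 := integral_add_compl measurableSet_firstCompleted iG2
  have h4 := integral_add_compl measurableSet_firstCompleted iW
  have h5 := integral_add_compl measurableSet_firstCompleted iW2
  rw [hW, m1, integral_gap_firstCompleted hr hε hτ hτ2] at h4
  rw [hW2, m2, integral_sq_gap_firstCompleted hr hε hτ hτ2] at h5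
  rw [h1, h2, eq_sub_iff_add_eq'.2 h4, eq_sub_iff_add_eq'.2 h5] at h3
  linear_combination (-1) * h3

end ServiceMoments

/-! ### Moments of the two kinds of cycles -/

section CycleMoments

variable {r : ℝ} {ε τ : Measure ℝ} [IsProbabilityMeasure ε] [IsProbabilityMeasure τ]

theorem memLp_gap (hr : 0 < r) (hε : ε = expMeasure r) (n : ℕ) :
    MemLp (fun s => gaps s n) 2 (inputLaw ε τ) := by
  rw [memLp_two_iff_integrable_sq (measurable_gaps n).aestronglyMeasurable]
  exact integrable_gap (f := fun x => x ^ 2) (hε ▸ (integrable_pow_expMeasure hr 2).1) n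

theorem memLp_transfer (hτ2 : MemLp id 2 τ) (n : ℕ) :
    MemLp (fun s => transfers s n) 2 (inputLaw ε τ) :=
  hτ2.comp_measurePreserving (measurePreserving_transfer n)

theorem memLp_dnpCycle_fst (hr : 0 < r) (hε : ε = expMeasure r) (hτ2 : MemLp id 2 τ) :
    MemLp (fun s => (dnpCycle s).1) 2 (inputLaw ε τ) :=
  (memLp_gap hr hε 0).add (memLp_transfer hτ2 0)

theorem memLp_dnpCycle_snd (hτ2 : MemLp id 2 τ) :
    MemLp (fun s => (dnpCycle s).2) 2 (inputLaw ε τ) := memLp_transfer hτ2 0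

theorem dopCycle_fst (s : Input) :
    (dopCycle s).1 = gaps s 0 + serviceTime (dropFirstGap s) := by
  rw [dopCycle_eq]
  rfl

theorem dopCycle_snd (s : Input) : (dopCycle s).2 = servedTransfer (dropFirstGap s) := by
  rw [dopCycle_eq]

theorem memLp_dopCycle_fst (hr : 0 < r) (hε : ε = expMeasure r) (hτ : ∀ᵐ x ∂τ, 0 ≤ x)
    (hτ2 : MemLp id 2 τ) : MemLp (fun s => (dopCycle s).1) 2 (inputLaw ε τ) := by
  simp_rw [dopCycle_fst]
  exact (memLp_gap hr hε 0).add
    ((memLp_serviceTime hr hε hτ hτ2).comp_measurePreserving measurePreserving_dropFirstGap)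

theorem memLp_dopCycle_snd (hr : 0 < r) (hε : ε = expMeasure r) (hτ : ∀ᵐ x ∂τ, 0 ≤ x)
    (hτ2 : MemLp id 2 τ) : MemLp (fun s => (dopCycle s).2) 2 (inputLaw ε τ) := by
  simp_rw [dopCycle_snd]
  exact (memLp_servedTransfer hr hε hτ hτ2).comp_measurePreserving measurePreserving_dropFirstGap

theorem integral_comp_dropFirstGap {H : Input → ℝ} (hH : Measurable H) :
    ∫ s, H (dropFirstGap s) ∂(inputLaw ε τ) = ∫ t, H t ∂(inputLaw ε τ) := by
  conv_rhs => rw [← measurePreserving_dropFirstGap (ε := ε) (τ := τ) |>.map_eq,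
    integral_map measurable_dropFirstGap.aemeasurable hH.aestronglyMeasurable]

/-- The moments of a sum of an exponential gap and an independent square-integrable variable. -/
theorem integral_gap_add (hr : 0 < r) (hε : ε = expMeasure r) {H : Input → ℝ} (hH : Measurable H)
    (hHL : MemLp H 2 (inputLaw ε τ)) (hind : IndepFun (fun s => gaps s 0) H (inputLaw ε τ)) :
    ∫ s, (gaps s 0 + H s) ∂(inputLaw ε τ) = 1 / r + ∫ s, H s ∂(inputLaw ε τ) ∧
      ∫ s, (gaps s 0 + H s) ^ 2 ∂(inputLaw ε τ) = 2 / r ^ 2 +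
        2 / r * ∫ s, H s ∂(inputLaw ε τ) + ∫ s, H s ^ 2 ∂(inputLaw ε τ) := by
  obtain ⟨i1, m1⟩ := integrable_pow_expMeasure hr 1
  obtain ⟨i2, m2⟩ := integrable_pow_expMeasure hr 2
  simp only [pow_one, Nat.factorial_one, Nat.cast_one, ← hε] at i1 m1
  simp only [Nat.factorial_two, Nat.cast_ofNat, ← hε] at i2 m2
  have iW := integrable_gap (τ := τ) (f := fun x => x) i1 0
  have hW := integral_gap (ε := ε) (τ := τ) (f := fun x => x) measurable_id 0
  have iW2 := integrable_gap (τ := τ) (f := fun x => x ^ 2) i2 0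
  have hW2 := integral_gap (ε := ε) (τ := τ) (f := fun x => x ^ 2) (by fun_prop) 0
  have iH := hHL.integrable (by norm_num)
  have iP : Integrable (fun s => 2 * (gaps s 0 * H s)) (inputLaw ε τ) :=
    (hind.integrable_mul iW iH).const_mul 2
  refine ⟨by rw [integral_add iW iH, hW, m1], ?_⟩
  have e : ∀ s, (gaps s 0 + H s) ^ 2 = gaps s 0 ^ 2 + (2 * (gaps s 0 * H s) + H s ^ 2) :=
    fun s => by ring
  have iPH : Integrable (fun s => 2 * (gaps s 0 * H s) + H s ^ 2) (inputLaw ε τ) :=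
    iP.add hHL.integrable_sq
  simp_rw [e]
  rw [integral_add iW2 iPH, integral_add iP hHL.integrable_sq, integral_const_mul,
    hind.integral_fun_mul_eq_mul_integral iW.aestronglyMeasurable hH.aestronglyMeasurable, hW2, m2,
    hW, m1]
  ring

theorem indepFun_gap_serviceTime : IndepFun (fun s => gaps s 0)
    (fun s => serviceTime (dropFirstGap s)) (inputLaw ε τ) :=
  indepFun_gap_dropFirstGap.comp measurable_id measurable_serviceTime

theorem indepFun_gap_transfer :
    IndepFun (fun s => gaps s 0) (fun s => transfers s 0) (inputLaw ε τ) :=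
  indepFun_gap_dropFirstGap.comp measurable_id (measurable_transfers 0)

theorem meanLength_dopCycle (hr : 0 < r) (hε : ε = expMeasure r) (hτ : ∀ᵐ x ∂τ, 0 ≤ x)
    (hτ2 : MemLp id 2 τ) :
    meanLength (inputLaw ε τ) dopCycle = 1 / (discountedMoment r τ 0 * r) := by
  have h := (integral_gap_add hr hε (measurable_serviceTime.comp measurable_dropFirstGap)
    ((memLp_serviceTime hr hε hτ hτ2).comp_measurePreserving measurePreserving_dropFirstGap)
    indepFun_gap_serviceTime).1
  simp only [Function.comp_apply] at h
  rw [integral_comp_dropFirstGap measurable_serviceTime] at h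
  simp only [meanLength, dopCycle_fst]
  have h2 := integral_serviceTime hr hε hτ hτ2
  have hp := discountedMoment_zero_pos (ε := ε) hε hτ
  rw [h]
  field_simp at h2 ⊢
  linarith

theorem secondMomentLength_dopCycle (hr : 0 < r) (hε : ε = expMeasure r)
    (hτ : ∀ᵐ x ∂τ, 0 ≤ x) (hτ2 : MemLp id 2 τ) :
    secondMomentLength (inputLaw ε τ) dopCycle =
      2 * meanLength (inputLaw ε τ) dopCycle ^ 2 * (1 - r * discountedMoment r τ 1) := by
  have h := (integral_gap_add hr hε (measurable_serviceTime.comp measurable_dropFirstGap)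
    ((memLp_serviceTime hr hε hτ hτ2).comp_measurePreserving measurePreserving_dropFirstGap)
    indepFun_gap_serviceTime).2
  simp only [Function.comp_apply] at h
  rw [integral_comp_dropFirstGap measurable_serviceTime,
    integral_comp_dropFirstGap (measurable_serviceTime.pow_const 2)] at h
  rw [meanLength_dopCycle hr hε hτ hτ2]
  simp only [secondMomentLength, dopCycle_fst]
  have hp := discountedMoment_zero_pos (ε := ε) hε hτ
  have h2 := integral_serviceTime hr hε hτ hτ2
  have h3 := integral_sq_serviceTime hr hε hτ hτ2
  rw [mul_comm, ← eq_div_iff hp.ne'] at h2 h3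
  rw [h, h3, h2]
  field_simp
  ring

theorem meanAge_add_meanAge_compl {ν : Measure Input} {Y : Input → ℝ × ℝ} {D : Set ℝ}
    (hD : MeasurableSet D) (hY : Measurable Y) (hi : Integrable (fun s => (Y s).2) ν) :
    meanAge ν Y D + meanAge ν Y Dᶜ = ∫ s, (Y s).2 ∂ν := by
  have h : ∀ B, MeasurableSet B → Integrable (fun s => B.indicator id (Y s).2) ν := fun B hB =>
    hi.indicator (hY.snd hB)
  rw [meanAge, meanAge, ← integral_add (h D hD) (h Dᶜ hD.compl)]
  simp_rw [indicator_add_indicator_compl_id]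

theorem integral_dopCycle_snd (hr : 0 < r) (hε : ε = expMeasure r) (hτ : ∀ᵐ x ∂τ, 0 ≤ x)
    (hτ2 : MemLp id 2 τ) :
    discountedMoment r τ 0 * ∫ s, (dopCycle s).2 ∂(inputLaw ε τ) = discountedMoment r τ 1 := by
  have h := integral_servedTransfer hε hτ measurable_id (hτ2.integrable (by norm_num))
    ((memLp_servedTransfer hr hε hτ hτ2).integrable (by norm_num))
  simp_rw [dopCycle_snd]
  rw [integral_comp_dropFirstGap measurable_servedTransfer]
  simpa [discountedMoment] using h

theorem measurable_indicator_one {D : Set ℝ} (hD : MeasurableSet D) :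
    Measurable (D.indicator (1 : ℝ → ℝ)) := measurable_one.indicator hD

theorem probAge_dopCycle (hε : ε = expMeasure r) (hτ : ∀ᵐ x ∂τ, 0 ≤ x) {D : Set ℝ}
    (hD : MeasurableSet D) :
    discountedMoment r τ 0 * probAge (inputLaw ε τ) dopCycle D =
      ∫ x, D.indicator 1 x * Real.exp (-(r * x)) ∂τ := by
  have i (m : Measure ℝ) [IsProbabilityMeasure m] : Integrable (D.indicator (1 : ℝ → ℝ)) m :=
    (integrable_const (1 : ℝ)).indicator hD
  have h := integral_servedTransfer hε hτ (measurable_indicator_one hD) (i τ)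
    ((integrable_const (1 : ℝ)).indicator (measurable_servedTransfer hD))
  rw [← h, probAge]
  simp_rw [dopCycle_snd]
  rw [integral_comp_dropFirstGap
    (H := fun t => D.indicator (1 : ℝ → ℝ) (servedTransfer t))
    ((measurable_indicator_one hD).comp measurable_servedTransfer)]

theorem meanLength_dnpCycle (hr : 0 < r) (hε : ε = expMeasure r) (hτ2 : MemLp id 2 τ) :
    meanLength (inputLaw ε τ) dnpCycle = 1 / r + ∫ x, x ∂τ := by
  have h := (integral_gap_add hr hε (measurable_transfers 0) (memLp_transfer hτ2 0)
    indepFun_gap_transfer).1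
  rwa [integral_transfer (f := fun x => x) measurable_id] at h

theorem secondMomentLength_dnpCycle (hr : 0 < r) (hε : ε = expMeasure r) (hτ2 : MemLp id 2 τ) :
    secondMomentLength (inputLaw ε τ) dnpCycle =
      2 / r ^ 2 + 2 / r * ∫ x, x ∂τ + ∫ x, x ^ 2 ∂τ := by
  have h := (integral_gap_add hr hε (measurable_transfers 0) (memLp_transfer hτ2 0)
    indepFun_gap_transfer).2
  rwa [integral_transfer (f := fun x => x) measurable_id,
    integral_transfer (f := fun x => x ^ 2) (by fun_prop)] at h

theorem probAge_dnpCycle {D : Set ℝ} (hD : MeasurableSet D) :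
    probAge (inputLaw ε τ) dnpCycle D = τ.real D := by
  have h := integral_transfer (ε := ε) (τ := τ) (measurable_indicator_one hD) 0
  rw [integral_indicator_one hD] at h
  exact h

theorem integral_dnpCycle_snd : ∫ s, (dnpCycle s).2 ∂(inputLaw ε τ) = ∫ x, x ∂τ :=
  integral_transfer measurable_id 0

theorem probAge_mem_Icc {Y : Input → ℝ × ℝ} (hY : Measurable Y) {D : Set ℝ}
    (hD : MeasurableSet D) : probAge (inputLaw ε τ) Y D ∈ Set.Icc 0 1 := by
  have h : probAge (inputLaw ε τ) Y D = (inputLaw ε τ).real {s | (Y s).2 ∈ D} := by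
    rw [← integral_indicator_one (show MeasurableSet {s | (Y s).2 ∈ D} from hY.snd hD)]
    rfl
  rw [h]
  exact ⟨measureReal_nonneg, measureReal_le_one⟩

/-- At most one of the two actions is absorbing: the final transfer time of a DOP cycle has a
density with respect to that of a DNP cycle, so that a set of ages which a DNP cycle avoids is
avoided by a DOP cycle as well. -/
theorem one_sub_probAge_add_pos (hε : ε = expMeasure r) (hτ : ∀ᵐ x ∂τ, 0 ≤ x)
    {D : Set ℝ} (hD : MeasurableSet D) :
    0 < 1 - probAge (inputLaw ε τ) dopCycle D + probAge (inputLaw ε τ) dnpCycle D := by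
  have ho := probAge_mem_Icc (ε := ε) (τ := τ) measurable_dopCycle hD
  have hn := probAge_mem_Icc (ε := ε) (τ := τ) measurable_dnpCycle hD
  by_contra hcon
  have ho1 : probAge (inputLaw ε τ) dopCycle D = 1 := by linarith [ho.1, ho.2, hn.1, hn.2]
  have hn0 : probAge (inputLaw ε τ) dnpCycle D = 0 := by linarith [ho.1, ho.2, hn.1, hn.2]
  have hp := probAge_dopCycle (ε := ε) hε hτ hD
  rw [ho1, mul_one] at hp
  rw [probAge_dnpCycle hD, measureReal_eq_zero_iff] at hn0
  have h0 : ∫ x, D.indicator 1 x * Real.exp (-(r * x)) ∂τ = 0 := by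
    refine integral_eq_zero_of_ae ?_
    filter_upwards [measure_eq_zero_iff_ae_notMem.1 hn0] with x hx
    simp [hx]
  exact (discountedMoment_zero_pos (ε := ε) hε hτ).ne' (hp.trans h0)

theorem dopFrequency_mem_Icc (hε : ε = expMeasure r) (hτ : ∀ᵐ x ∂τ, 0 ≤ x)
    {D : Set ℝ} (hD : MeasurableSet D) : dopFrequency (inputLaw ε τ) D ∈ Set.Icc 0 1 := by
  have h := one_sub_probAge_add_pos hε hτ hD
  have ho := probAge_mem_Icc (ε := ε) (τ := τ) measurable_dopCycle hD
  have hn := probAge_mem_Icc (ε := ε) (τ := τ) measurable_dnpCycle hD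
  refine ⟨div_nonneg hn.1 h.le, (div_le_one h).2 ?_⟩
  linarith [ho.2]

end CycleMoments

/-! ### Dropping the new packets is optimal -/

section Optimality

variable {r : ℝ} {ε τ : Measure ℝ} [IsProbabilityMeasure ε] [IsProbabilityMeasure τ]

theorem meanLength_dnpCycle_pos (hr : 0 < r) (hε : ε = expMeasure r) (hτ : ∀ᵐ x ∂τ, 0 ≤ x)
    (hτ2 : MemLp id 2 τ) : 0 < meanLength (inputLaw ε τ) dnpCycle := by
  rw [meanLength_dnpCycle hr hε hτ2]
  have := integral_nonneg_of_ae hτ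
  positivity

theorem meanLength_dopCycle_pos (hr : 0 < r) (hε : ε = expMeasure r) (hτ : ∀ᵐ x ∂τ, 0 ≤ x)
    (hτ2 : MemLp id 2 τ) : 0 < meanLength (inputLaw ε τ) dopCycle := by
  rw [meanLength_dopCycle hr hε hτ hτ2]
  have := discountedMoment_zero_pos (ε := ε) hε hτ
  positivity

theorem stationary_meanLength_pos (hr : 0 < r) (hε : ε = expMeasure r) (hτ : ∀ᵐ x ∂τ, 0 ≤ x)
    (hτ2 : MemLp id 2 τ) {D : Set ℝ} (hD : MeasurableSet D) :
    0 < dopFrequency (inputLaw ε τ) D * meanLength (inputLaw ε τ) dopCycle +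
      (1 - dopFrequency (inputLaw ε τ) D) * meanLength (inputLaw ε τ) dnpCycle := by
  obtain ⟨h0, h1⟩ := dopFrequency_mem_Icc (ε := ε) hε hτ hD
  have hn := meanLength_dnpCycle_pos hr hε hτ hτ2
  have ho := meanLength_dopCycle_pos hr hε hτ hτ2
  rcases h0.eq_or_lt with h | h
  · rw [← h]
    linarith
  · exact add_pos_of_pos_of_nonneg (mul_pos h ho) (mul_nonneg (sub_nonneg.2 h1) hn.le)

/-- Existence and value of the average age of a policy. -/
theorem ae_tendsto_average_age_inputLaw (hr : 0 < r) (hε : ε = expMeasure r)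
    (hτ : ∀ᵐ x ∂τ, 0 ≤ x) (hτ2 : MemLp id 2 τ) {D : Set ℝ} (hD : MeasurableSet D) {g₀ : ℝ}
    (hg : 0 ≤ g₀) :
    ∀ᵐ s ∂(inputLaw ε τ),
      (∀ t : ℝ, IntervalIntegrable (age D (gaps s) (transfers s) g₀) volume 0 t) ∧
      Tendsto (fun t : ℝ => (∫ u in (0 : ℝ)..t, age D (gaps s) (transfers s) g₀ u) / t) atTop
        (𝓝 (averageAge (inputLaw ε τ) D)) :=
  ae_tendsto_average_age hε (ae_isRegular hr hε hτ) hD (memLp_dopCycle_fst hr hε hτ hτ2)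
    (memLp_dnpCycle_fst hr hε hτ2) (memLp_dopCycle_snd hr hε hτ hτ2) (memLp_dnpCycle_snd hτ2)
    (one_sub_probAge_add_pos hε hτ hD) (stationary_meanLength_pos hr hε hτ hτ2 hD) hg

/-- The average age if new packets are always dropped. The last two summands are the mean residual
of a DNP cycle, `E[L ^ 2] / (2 E[L])` with `L = T + ξ`. -/
noncomputable def averageAgeDropNew (r : ℝ) (τ : Measure ℝ) : ℝ :=
  (∫ x, x ∂τ) + 1 / r + r * (∫ x, x ^ 2 ∂τ) / (2 * (1 + r * ∫ x, x ∂τ))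

theorem averageAge_of_measure_eq_zero (hr : 0 < r) (hε : ε = expMeasure r) (hτ : ∀ᵐ x ∂τ, 0 ≤ x)
    (hτ2 : MemLp id 2 τ) {D : Set ℝ} (hD : MeasurableSet D) (hD0 : τ D = 0) :
    averageAge (inputLaw ε τ) D = averageAgeDropNew r τ := by
  have hπ : dopFrequency (inputLaw ε τ) D = 0 := by
    rw [dopFrequency, probAge_dnpCycle hD, measureReal_def, hD0]
    simp
  have hm0 : meanAge (inputLaw ε τ) dnpCycle D = 0 := by
    have h := integral_transfer (ε := ε) (τ := τ) (measurable_id.indicator hD) 0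
    refine h.trans (integral_eq_zero_of_ae ?_)
    filter_upwards [measure_eq_zero_iff_ae_notMem.1 hD0] with x hx
    simp [hx]
  have hm1 := meanAge_add_meanAge_compl (ν := inputLaw ε τ) hD measurable_dnpCycle
    ((memLp_dnpCycle_snd hτ2).integrable (by norm_num))
  rw [hm0, zero_add, integral_dnpCycle_snd] at hm1
  have hm := integral_nonneg_of_ae hτ
  rw [averageAge, hπ, hm1, hm0, meanLength_dnpCycle hr hε hτ2,
    secondMomentLength_dnpCycle hr hε hτ2, averageAgeDropNew]
  set m := ∫ x, x ∂τ
  have h1 : 1 / r + m = (1 + r * m) / r := by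
    field_simp
  have h2 : 1 + r * m ≠ 0 := by positivity
  rw [h1]
  simp only [zero_mul, mul_zero, sub_zero, zero_add, one_mul]
  field_simp
  ring

/-- Replacing `D` by the empty set in the weights of the final ages can only decrease the mean area
of a cycle, since DNP cycles are shorter on average. What remains is a mixture of the areas of the
two kinds of cycles, followed by a DNP cycle; the area of the DOP cycle exceeds the average age
times its length precisely under the last hypothesis. -/
theorem averageAgeDropNew_le_averageAge (hr : 0 < r) (hε : ε = expMeasure r)
    (hτ : ∀ᵐ x ∂τ, 0 ≤ x) (hτ2 : MemLp id 2 τ) {D : Set ℝ} (hD : MeasurableSet D)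
    (hd : meanLength (inputLaw ε τ) dnpCycle ≤ meanLength (inputLaw ε τ) dopCycle)
    (hcond : r * (∫ x, x ^ 2 ∂τ) / (2 * (1 + r * ∫ x, x ∂τ)) ≤
      (meanLength (inputLaw ε τ) dopCycle - meanLength (inputLaw ε τ) dnpCycle) *
        (1 - r * discountedMoment r τ 1)) :
    averageAgeDropNew r τ ≤ averageAge (inputLaw ε τ) D := by
  obtain ⟨h0, h1⟩ := dopFrequency_mem_Icc (ε := ε) hε hτ hD
  rw [averageAge, le_div_iff₀ (stationary_meanLength_pos hr hε hτ hτ2 hD)]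
  have hreg := ae_isRegular hr hε hτ
  have hmo := meanAge_add_meanAge_compl (ν := inputLaw ε τ) hD measurable_dopCycle
    ((memLp_dopCycle_snd hr hε hτ hτ2).integrable (by norm_num))
  have hmn := meanAge_add_meanAge_compl (ν := inputLaw ε τ) hD measurable_dnpCycle
    ((memLp_dnpCycle_snd hτ2).integrable (by norm_num))
  have hmo0 : 0 ≤ meanAge (inputLaw ε τ) dopCycle D := by
    refine integral_nonneg_of_ae ?_
    filter_upwards [hreg] with s hs
    exact Set.indicator_apply_nonneg fun _ => hs.dopCycle_snd_nonneg
  have hmn0 : 0 ≤ meanAge (inputLaw ε τ) dnpCycle D := by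
    refine integral_nonneg_of_ae ?_
    filter_upwards [hreg] with s hs
    exact Set.indicator_apply_nonneg fun _ => hs.dnpCycle_snd_nonneg
  have hG := integral_dopCycle_snd hr hε hτ hτ2
  have hp := discountedMoment_zero_pos (ε := ε) hε hτ
  have hdo := meanLength_dopCycle hr hε hτ hτ2
  have hso := secondMomentLength_dopCycle hr hε hτ hτ2
  have hdn := meanLength_dnpCycle hr hε hτ2
  have hsn := secondMomentLength_dnpCycle hr hε hτ2
  have hop := meanLength_dopCycle_pos hr hε hτ hτ2
  have hm := integral_nonneg_of_ae hτ
  rw [integral_dnpCycle_snd] at hmn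
  have hG' : ∫ s, (dopCycle s).2 ∂(inputLaw ε τ) =
      r * discountedMoment r τ 1 * meanLength (inputLaw ε τ) dopCycle := by
    rw [hdo, ← hG]
    field_simp
  rw [hG', ← eq_sub_iff_add_eq'] at hmo
  rw [← eq_sub_iff_add_eq'] at hmn
  rw [hmo, hmn, hso, hsn]
  have ha : averageAgeDropNew r τ = meanLength (inputLaw ε τ) dnpCycle +
      r * (∫ x, x ^ 2 ∂τ) / (2 * (1 + r * ∫ x, x ∂τ)) := by
    rw [averageAgeDropNew, hdn, add_comm (1 / r)]
  -- the area of a DNP cycle that follows a DNP cycle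
  have hbal : averageAgeDropNew r τ * meanLength (inputLaw ε τ) dnpCycle =
      meanLength (inputLaw ε τ) dnpCycle * (∫ x, x ∂τ) +
        (2 / r ^ 2 + 2 / r * ∫ x, x ∂τ + ∫ x, x ^ 2 ∂τ) / 2 := by
    rw [ha, hdn]
    set m := ∫ x, x ∂τ
    have h2 : 1 + r * m ≠ 0 := by positivity
    field_simp
    ring
  set ν := inputLaw ε τ
  set π := dopFrequency ν D
  set dO := meanLength ν dopCycle
  set dN := meanLength ν dnpCycle
  set a := averageAgeDropNew r τ
  set c := r * (∫ x, x ^ 2 ∂τ) / (2 * (1 + r * ∫ x, x ∂τ))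
  have hdiff : 0 ≤ (dO - dN) * (π * meanAge ν dopCycle D + (1 - π) * meanAge ν dnpCycle D) :=
    mul_nonneg (sub_nonneg.2 hd) (add_nonneg (mul_nonneg h0 hmo0)
      (mul_nonneg (sub_nonneg.2 h1) hmn0))
  have hDOP : 0 ≤ π * (dO * ((dO - dN) * (1 - r * discountedMoment r τ 1) - c)) :=
    mul_nonneg h0 (mul_nonneg hop.le (sub_nonneg.2 hcond))
  rw [← sub_nonneg]
  refine (add_nonneg hdiff hDOP).trans_eq ?_
  linear_combination (1 - π) * hbal + π * dO * ha

end Optimality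

/-! ### From random variables to the space of inputs -/

theorem map_sumElim_eq_inputLaw {Ω : Type*} [MeasurableSpace Ω] {P : Measure Ω}
    {ε τ : Measure ℝ} [IsProbabilityMeasure ε] [IsProbabilityMeasure τ] {ξ T : ℕ → Ω → ℝ}
    (hξ_meas : ∀ n, Measurable (ξ n)) (hT_meas : ∀ n, Measurable (T n))
    (hindep : iIndepFun (Sum.elim ξ T) P) (hξ_law : ∀ n, P.map (ξ n) = ε)
    (hT_law : ∀ n, P.map (T n) = τ) :
    P.map (fun ω i => Sum.elim ξ T i ω) = inputLaw ε τ := by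
  rw [hindep.map_fun_eq_infinitePi_map (by rintro (n | n); exacts [hξ_meas n, hT_meas n]), inputLaw]
  congr 1
  funext i
  rcases i with n | n
  exacts [hξ_law n, hT_law n]

theorem dopCycle_sumElim_fst (x y : ℕ → ℝ) :
    (dopCycle (Sum.elim x y)).1 = x 0 + interruptedTransferTime x y := by
  have hx : gaps (Sum.elim x y) = x := rfl
  have hy : transfers (Sum.elim x y) = y := rfl
  simp only [dopCycle, hx, hy, arrivalTime, Finset.sum_range_succ', interruptedTransferTime]
  ring

end AgeOfInformation

open AgeOfInformation in
theorem theorem2 {Ω : Type*} [MeasurableSpace Ω] (P : Measure Ω) [IsProbabilityMeasure P]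
    (lam : ℝ) (hlam : 0 < lam) (ξ T : ℕ → Ω → ℝ)
    (hξ_meas : ∀ n, Measurable (ξ n)) (hT_meas : ∀ n, Measurable (T n))
    (hindep : iIndepFun (Sum.elim ξ T) P)
    (hξ_law : ∀ n, P.map (ξ n) = expMeasure lam)
    (hT_law : ∀ n, IdentDistrib (T n) (T 0) P P)
    (hT_nonneg : ∀ᵐ ω ∂P, 0 ≤ T 0 ω)
    (hT_sq : MemLp (T 0) 2 P)
    (ρ : ℝ) (hρ : ρ = lam * ∫ ω, T 0 ω ∂P)
    (hd : AgeOfInformation.meanCycleDNP P ξ T < AgeOfInformation.meanCycleDOP P ξ T)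
    (hcond : ρ * ((∫ ω, T 0 ω ^ 2 ∂P) / (2 * ∫ ω, T 0 ω ∂P)) -
      (1 + ρ) * (AgeOfInformation.meanCycleDOP P ξ T - AgeOfInformation.meanCycleDNP P ξ T) *
        (1 - lam * ∫ ω, T 0 ω * Real.exp (-lam * T 0 ω) ∂P) ≤ 0) :
    ∃ (abar : EReal → ℝ) (aDNP : ℝ),
      (∀ θ : EReal, 0 ≤ θ →
        AgeOfInformation.HasAverageAge P ξ T (AgeOfInformation.threshold θ) (abar θ)) ∧
      AgeOfInformation.HasAverageAge P ξ T AgeOfInformation.alwaysDropNew aDNP ∧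
      aDNP = (∫ ω, T 0 ω ∂P) + 1 / lam +
        (∫ ω, T 0 ω ^ 2 ∂P) / (2 * ∫ ω, T 0 ω ∂P) * (ρ / (1 + ρ)) ∧
      IsLeast (abar '' {θ : EReal | 0 ≤ θ}) (abar 0) ∧
      abar 0 = aDNP := by
  set τ := P.map (T 0) with hτdef
  have : IsProbabilityMeasure τ := Measure.isProbabilityMeasure_map (hT_meas 0).aemeasurable
  have : IsProbabilityMeasure (expMeasure lam) := isProbabilityMeasure_expMeasure hlam
  have hmap : P.map (fun ω i => Sum.elim ξ T i ω) = inputLaw (expMeasure lam) τ :=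
    map_sumElim_eq_inputLaw hξ_meas hT_meas hindep hξ_law fun n => (hT_law n).map_eq
  have hΦ : Measurable fun ω i => Sum.elim ξ T i ω :=
    measurable_pi_iff.2 (by rintro (n | n); exacts [hξ_meas n, hT_meas n])
  have hΦe : ∀ ω, (fun i => Sum.elim ξ T i ω) = Sum.elim (ξ · ω) (T · ω) := by
    intro ω
    ext i
    rcases i with n | n <;> rfl
  have hτ : ∀ᵐ x ∂τ, 0 ≤ x :=
    (ae_map_iff (hT_meas 0).aemeasurable measurableSet_Ici).2 hT_nonneg
  have hτ2 : MemLp id 2 τ :=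
    (memLp_map_measure_iff aestronglyMeasurable_id (hT_meas 0).aemeasurable).2 hT_sq
  have hT1 : ∫ ω, T 0 ω ∂P = ∫ x, x ∂τ :=
    (integral_map (hT_meas 0).aemeasurable aestronglyMeasurable_id).symm
  have hT2 : ∫ ω, T 0 ω ^ 2 ∂P = ∫ x, x ^ 2 ∂τ :=
    (integral_map (f := fun x => x ^ 2) (hT_meas 0).aemeasurable (by fun_prop)).symm
  have hT3 : ∫ ω, T 0 ω * Real.exp (-lam * T 0 ω) ∂P = discountedMoment lam τ 1 := by
    rw [discountedMoment, integral_map (hT_meas 0).aemeasurable (by fun_prop)]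
    simp only [pow_one, neg_mul]
  have hlen : ∀ {Y : Input → ℝ × ℝ}, Measurable Y →
      meanLength (inputLaw (expMeasure lam) τ) Y = ∫ ω, (Y (Sum.elim (ξ · ω) (T · ω))).1 ∂P := by
    intro Y hY
    rw [meanLength, ← hmap, integral_map hΦ.aemeasurable hY.fst.aestronglyMeasurable]
    simp_rw [hΦe]
  have hdn : meanCycleDNP P ξ T = meanLength (inputLaw (expMeasure lam) τ) dnpCycle := by
    rw [hlen measurable_dnpCycle, meanCycleDNP]
    simp only [dnpCycle, Sum.elim_inl, Sum.elim_inr, add_comm]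
  have hdo : meanCycleDOP P ξ T = meanLength (inputLaw (expMeasure lam) τ) dopCycle := by
    rw [hlen measurable_dopCycle, meanCycleDOP]
    simp only [dopCycle_sumElim_fst]
  have hage : ∀ D, MeasurableSet D →
      HasAverageAge P ξ T D (averageAge (inputLaw (expMeasure lam) τ) D) := by
    intro D hD g₀ hg
    have h := ae_tendsto_average_age_inputLaw hlam rfl hτ hτ2 hD hg
    rw [← hmap] at h
    filter_upwards [ae_of_ae_map hΦ.aemeasurable h] with ω hω
    rw [hmap] at hω
    exact hω
  have hmeas : ∀ θ : EReal, MeasurableSet (threshold θ) := fun θ =>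
    measurable_coe_real_ereal measurableSet_Iio
  -- If `T = 0` almost surely, the quotient in the statement is the junk value `0 / 0 = 0`, and both
  -- sides vanish.
  have hquot : (∫ x, x ^ 2 ∂τ) / (2 * ∫ x, x ∂τ) * ρ = lam * (∫ x, x ^ 2 ∂τ) / 2 := by
    rw [hρ, hT1]
    rcases eq_or_ne (∫ x, x ∂τ) 0 with h | h
    · have h0 := (integral_eq_zero_iff_of_nonneg_ae hτ (hτ2.integrable (by norm_num))).1 h
      have h2 : ∫ x, x ^ 2 ∂τ = 0 := integral_eq_zero_of_ae (by
        filter_upwards [h0] with x hx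
        simp only [Pi.zero_apply] at hx ⊢
        simp [hx])
      simp [h, h2]
    · field_simp
  have hρ0 : 0 < 1 + ρ := by
    rw [hρ, hT1]
    have := integral_nonneg_of_ae hτ
    positivity
  -- `threshold 0` is not empty: it consists of the negative reals, which have
  -- probability `0` as final ages.
  have hzero : τ (threshold 0) = 0 := by
    refine measure_eq_zero_iff_ae_notMem.2 ?_
    filter_upwards [hτ] with x hx
    simpa [threshold] using hx
  have hval : averageAge (inputLaw (expMeasure lam) τ) alwaysDropNew = averageAgeDropNew lam τ :=
    averageAge_of_measure_eq_zero hlam rfl hτ hτ2 MeasurableSet.empty measure_empty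
  have hval0 : averageAge (inputLaw (expMeasure lam) τ) (threshold 0) = averageAgeDropNew lam τ :=
    averageAge_of_measure_eq_zero hlam rfl hτ hτ2 (hmeas 0) hzero
  refine ⟨fun θ => averageAge (inputLaw (expMeasure lam) τ) (threshold θ),
    averageAge (inputLaw (expMeasure lam) τ) alwaysDropNew, fun θ _ => hage _ (hmeas θ),
    hage _ MeasurableSet.empty, ?_, ⟨⟨0, le_refl (0 : EReal), rfl⟩, ?_⟩, hval0.trans hval.symm⟩
  · rw [hval, averageAgeDropNew, hT1, hT2, ← mul_div_assoc, hquot, hρ, hT1]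
    rw [div_div]
  · rintro _ ⟨θ, -, rfl⟩
    change averageAge _ (threshold 0) ≤ _
    rw [hval0]
    rw [hdn, hdo] at hd
    rw [hdn, hdo, hT1, hT2, hT3, mul_comm ρ, hquot, sub_nonpos] at hcond
    refine averageAgeDropNew_le_averageAge hlam rfl hτ hτ2 (hmeas θ) hd.le ?_
    rw [← hT1, ← hρ, div_mul_eq_div_div, div_le_iff₀ hρ0]
    linarith
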